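/- **Theorem.** All running times are worst-case and deterministic, on an ARBITRARY CRCW PRAM: synchronous processors with private registers run one common program on a shared memory, with unit-cost loads, stores, additions, truncated subtractions and conditional moves and jumps; when several processors write to one cell, an arbitrary one succeeds, and the program must be correct whichever it is. Let $G=(V,E)$ be a simple graph on $n$ vertices $V=\{0,\dots,n-1\}$ with maximum degree at most $\Delta_{\max}$, and let $\varphi$ be a proper $(\Delta_{\max}+1)$-edge-coloring of $G$. The pair $(G,\varphi)$ is stored in the shared memory by the following data structure: $n$ and $\Delta_{\max}$; for every vertex $v$ its degree, a color missing at $v$, its adjacency list (an array, together with the position of each neighbor of $v$ in it), and two constant-time lookup tables, one giving for each color $c$ the edge at $v$ colored $c$ (if any), the other giving for each vertex $w$ the color of the edge $vw$ (if any). (The tables are directly addressed arrays reached through a pointer kept for each vertex; memory outside the data structure has arbitrary contents.) There are three fixed programs and an absolute constant $C$, independent of $n,\Delta_{\max},G,\varphi$, such that the following hold. 1. (Insertion.) Let $e=\{u,v\}\notin E$, $u\ne v$, be such that $G^+=G\cup\{e\}$ has maximum degree at most $\Delta_{\max}$. Given the data structure for $(G,\varphi)$ and $u,v$, the first program, run with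 $Cn$ processors, halts within $C\log n$ steps with the data structure for $(G^+,\varphi^+)$ in memory, for some proper $(\Delta_{\max}+1)$-edge-coloring $\varphi^+$ of $G^+$. 2. (Deletion.) Let $e'=\{u',v'\}\in E$. Given the data structure for $(G,\varphi)$ and $u',v'$, the second program, run with $C$ processors, halts within $C$ steps with the data structure for $(G^-,\varphi^-)$ in memory, for some proper $(\Delta_{\max}+1)$-edge-coloring $\varphi^-$ of $G^-=G\setminus\{e'\}$. 3. (Insertion of $K$ edges.) Let $K\ge 1$, and let $e_1,\dots,e_K$ be distinct edges on $V$ (no loops) that are not in $E$ and such that $G^{+K}=G\cup\{e_1,\dots,e_K\}$ has maximum degree at most $\Delta_{\max}$. Given the data structure for $(G,\varphi)$ and the list $e_1,\dots,e_K$, the third program, run with $Cn$ processors, halts within $C\,K\log n$ steps with the data structure for $(G^{+K},\varphi')$ in memory, for some proper $(\Delta_{\max}+1)$-edge-coloring $\varphi'$ of $G^{+K}$. -/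

import Mathlib

/-! ### The ARBITRARY CRCW PRAM

Every processor is a random access machine with its own program counter and its own registers.
All processors hold the same program and execute it synchronously, one instruction per time step;
they communicate through a shared memory of natural numbers. The arithmetic is addition and
truncated subtraction. -/

namespace PRAM

/-- Instructions; `d, a, b, x, y` are register numbers and `l` is a program position. -/
inductive Instr where
  /-- `R[d] := c` -/
  | const (d c : ℕ)
  /-- `R[d] := R[a] + R[b]` -/
  | add (d a b : ℕ)
  /-- `R[d] := max (R[a] - R[b]) 0` -/
  | sub (d a b : ℕ)
  /-- `R[d] := R[x]` if `R[a] = 0`, and `R[d] := R[y]` otherwise -/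
  | sel (d a x y : ℕ)
  /-- `R[d] := M[R[a]]` -/
  | load (d a : ℕ)
  /-- `M[R[a]] := R[b]` -/
  | store (a b : ℕ)
  /-- go to position `l` if `R[a] = 0` -/
  | jz (a l : ℕ)

/-- A program; a processor halts when its program counter leaves the program. -/
abbrev Program := List Instr

/-- The local state of a processor. -/
structure Proc where
  pc : ℕ
  reg : ℕ → ℕ

/-- A configuration of a machine with `P` processors. -/
structure Config (P : ℕ) where
  proc : Fin P → Proc
  mem : ℕ → ℕ

/-- The local state after one step, with `m` the shared memory before the step. -/
def Proc.next (prog : Program) (m : ℕ → ℕ) (s : Proc) : Proc :=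
  match prog[s.pc]? with
  | none => s
  | some (.const d c) => ⟨s.pc + 1, Function.update s.reg d c⟩
  | some (.add d a b) => ⟨s.pc + 1, Function.update s.reg d (s.reg a + s.reg b)⟩
  | some (.sub d a b) => ⟨s.pc + 1, Function.update s.reg d (s.reg a - s.reg b)⟩
  | some (.sel d a x y) =>
      ⟨s.pc + 1, Function.update s.reg d (if s.reg a = 0 then s.reg x else s.reg y)⟩
  | some (.load d a) => ⟨s.pc + 1, Function.update s.reg d (m (s.reg a))⟩
  | some (.store _ _) => ⟨s.pc + 1, s.reg⟩
  | some (.jz a l) => ⟨if s.reg a = 0 then l else s.pc + 1, s.reg⟩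

/-- The pair (address, value) that a processor tries to write in this step, if any. -/
def Proc.write (prog : Program) (s : Proc) : Option (ℕ × ℕ) :=
  match prog[s.pc]? with
  | some (.store a b) => some (s.reg a, s.reg b)
  | _ => none

/-- One synchronous step. All reads see the memory before the step. A cell to which nobody writes
is unchanged; if several processors write to a cell, an arbitrary one of them succeeds. -/
def Step {P : ℕ} (prog : Program) (c c' : Config P) : Prop :=
  (∀ p, c'.proc p = (c.proc p).next prog c.mem) ∧
  ∀ x, ((∀ p y, (c.proc p).write prog ≠ some (x, y)) ∧ c'.mem x = c.mem x) ∨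
    ∃ p, (c.proc p).write prog = some (x, c'.mem x)

/-- The initial configuration: register `0` of every processor holds the number of the processor,
all other registers hold `0`, and `m` is the shared memory. -/
def init (P : ℕ) (m : ℕ → ℕ) : Config P where
  proc p := ⟨0, fun r => if r = 0 then (p : ℕ) else 0⟩
  mem := m

/-- All processors have halted. -/
def Halted {P : ℕ} (prog : Program) (c : Config P) : Prop :=
  ∀ p, prog.length ≤ (c.proc p).pc

/-- Run with `P` processors on the shared memory `m`, the program halts within `T` steps with a
shared memory that satisfies `Q`, however the write conflicts are resolved. -/
def Computes (prog : Program) (P : ℕ) (T : ℝ) (m : ℕ → ℕ) (Q : (ℕ → ℕ) → Prop) : Prop :=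
  ∀ run : ℕ → Config P, run 0 = init P m → (∀ t, Step prog (run t) (run (t + 1))) →
    ∃ t : ℕ, (t : ℝ) ≤ T ∧ Halted prog (run t) ∧ Q (run t).mem

end PRAM

/-! ### Edge-colored graphs in the shared memory -/

namespace EdgeColoringUpdate

/-- The maximum degree of `G` is at most `D`. -/
def MaxDegreeLE {n : ℕ} (G : SimpleGraph (Fin n)) (D : ℕ) : Prop :=
  ∀ v, (G.neighborSet v).ncard ≤ D

/-- A proper `k`-edge-coloring: distinct edges that share an endpoint get distinct colors. The
colors are `0, …, k - 1`; color `c` is stored in memory as `c + 1`. -/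
abbrev ProperEdgeColoring {n : ℕ} (G : SimpleGraph (Fin n)) (k : ℕ) := G.lineGraph.Coloring (Fin k)

/-- The number of memory cells in the block of a vertex. -/
def blockSize (n D : ℕ) : ℕ := 2 + (D + 1) + n + n + D

/-- The first cell of the block of vertex `v`. Cells `0, …, 4` are a header and cells
`5, …, 5 + n - 1` hold pointers to the blocks. -/
def block (n D v : ℕ) : ℕ := 5 + n + v * blockSize n D

/-- The cell for a color that is missing at `v`. -/
def missingCell (n D v : ℕ) : ℕ := block n D v

/-- The cell for the degree of `v`. -/
def degCell (n D v : ℕ) : ℕ := block n D v + 1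

/-- Entry `c` of the table Color2Edge of `v`. -/
def color2edgeCell (n D v c : ℕ) : ℕ := block n D v + 2 + c

/-- Entry `w` of the table Edge2Color of `v`. -/
def edge2colorCell (n D v w : ℕ) : ℕ := block n D v + 2 + (D + 1) + w

/-- The cell for the position of `w` in the adjacency list of `v`. -/
def posCell (n D v w : ℕ) : ℕ := block n D v + 2 + (D + 1) + n + w

/-- Entry `i` of the adjacency list of `v`. -/
def adjCell (n D v i : ℕ) : ℕ := block n D v + 2 + (D + 1) + n + n + i

/-- The first cell after the data structure; all cells from here on are workspace. -/
def workspace (n D : ℕ) : ℕ := block n D n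

/-- The shared memory `m` stores the graph `G` with the edge-coloring `φ`. Cells that are not
mentioned have arbitrary contents. -/
structure Represents {n D : ℕ} (m : ℕ → ℕ) (G : SimpleGraph (Fin n))
    (φ : ProperEdgeColoring G (D + 1)) : Prop where
  size : m 0 = n
  bound : m 1 = D
  work : m 4 = workspace n D
  pointer : ∀ v : Fin n, m (5 + v) = block n D v
  /-- a missing color at every vertex -/
  missing : ∀ v : Fin n, ∃ c : Fin (D + 1), m (missingCell n D v) = c + 1 ∧
    ∀ (w : Fin n) (h : G.Adj v w), φ ⟨s(v, w), h⟩ ≠ c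
  degree : ∀ v : Fin n, m (degCell n D v) = (G.neighborSet v).ncard
  /-- the color of every edge, found from either endpoint -/
  edge2color : ∀ (v w : Fin n) (h : G.Adj v w),
    m (edge2colorCell n D v w) = φ ⟨s(v, w), h⟩ + 1
  edge2color_none : ∀ v w : Fin n, ¬ G.Adj v w → m (edge2colorCell n D v w) = 0
  /-- the other endpoint `w` (as `w + 1`) of the edge at `v` with a given color -/
  color2edge : ∀ (v w : Fin n) (h : G.Adj v w),
    m (color2edgeCell n D v (φ ⟨s(v, w), h⟩)) = w + 1
  color2edge_none : ∀ (v : Fin n) (c : Fin (D + 1)),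
    (∀ (w : Fin n) (h : G.Adj v w), φ ⟨s(v, w), h⟩ ≠ c) → m (color2edgeCell n D v c) = 0
  /-- the first `deg v` entries of the adjacency list of `v` are the neighbors of `v`, each once -/
  adjacency : ∀ v w : Fin n, G.Adj v w → m (posCell n D v w) < (G.neighborSet v).ncard ∧
    m (adjCell n D v (m (posCell n D v w))) = w

/-- `m` stores a proper `(D + 1)`-edge-coloring of `G`, in the form above. -/
def StoresColoring {n : ℕ} (D : ℕ) (G : SimpleGraph (Fin n)) (m : ℕ → ℕ) : Prop :=
  ∃ φ : ProperEdgeColoring G (D + 1), Represents m G φ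

end EdgeColoringUpdate

open PRAM EdgeColoringUpdate

/-!
The insertion is the proof of Vizing's theorem by fans and Kempe chains, arranged so that every
step is either a constant number of synchronous assignments or the search of an orbit of a map on
at most `2 * n` states.

Let `M x` be the stored color missing at `x`, and let `uv` be the new edge. The fan at `u` is the
orbit of `v` under the map `fan` that sends `x` to the neighbor `y` of `u` for which `uy` has the
color `M x`, and fixes `x` if `M x` is missing at `u` too.

* If the orbit ends in a fixed point, then it is a path, the colors `M x` along it are distinct, and
  giving every edge `ux` to the fan the color `M x` makes room for `uv` (`exists_rotate`).
* Otherwise two vertices `x ≠ y` of the orbit have the same successor (`fan_fixed_or_collision`),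
  and so the same missing color `d`. Let `a` be the color missing at `u`. The Kempe chain of `u`
  for the colors `a` and `d` has at most one end at which `d` is missing (`chain_end_unique`), so
  it misses one of `x` and `y`. After the two colors are exchanged on the chain, the map `fan` is
  what it was on the old orbit, except that `x` and `y` are fixed points if they are not in the
  chain. So the new orbit of `v` ends (`fan_flip_fixed`), whichever of `x` and `y` comes first and
  whichever is in the chain, and the first case applies.

Both the fan and the Kempe chain are orbits of a map that every state can evaluate from the tables
in constant time; for the chain, a state is a vertex together with the color of the next edge
(`kempe`). An orbit is marked by pointer jumping: in every round the marks are passed on along the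
current jumps and the jumps are doubled, so that after `t` rounds the marked states are those that
fewer than `2 ^ t` steps reach (`runs_jump`). This takes `O(log n)` rounds. The collision in the fan
is found by a write conflict: all vertices of the fan write their numbers to their successors, and a
vertex that reads a different number is one of the two vertices `x` and `y` (`runs_collide`). At the
end, the endpoints of the new edge find new missing colors among the first `n` colors, all of which
are tried in parallel (`holds_refill`).

The programs are written in a small structured language: a statement is a synchronous assignment, in
which every processor evaluates guards, addresses and values on the same memory before anything is
written, a sequence, or a loop with a condition that has the same value for all processors. `Runs`
is total correctness with a time bound, stated about the machine code; `Runs.assign`, `Runs.seq`,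
`Runs.loop` and `Runs.computes` reduce the theorem to the effect of assignments on the memory. This
effect is described by naming the cells of the data structure (`Cell`); since different names have
different addresses (`Cell.addr_injective`), it can be read off from the names (`Written.read`).
Cell `3` serves as the target of the writes whose guard fails.
-/

namespace PRAM

/-! ### Expressions and their machine code -/

/-- Expressions over the processor number and the shared memory. -/
inductive Expr where
  | const (c : ℕ)
  | pid
  | load (e : Expr)
  | add (e f : Expr)
  | sub (e f : Expr)
  /-- `x` if `c` is nonzero, and `y` otherwise -/
  | ite (c x y : Expr)

/-- The value of an expression for processor `p` and shared memory `m`. -/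
def Expr.eval (p : ℕ) (m : ℕ → ℕ) : Expr → ℕ
  | const c => c
  | pid => p
  | load e => m (e.eval p m)
  | add e f => e.eval p m + f.eval p m
  | sub e f => e.eval p m - f.eval p m
  | ite c x y => if c.eval p m = 0 then y.eval p m else x.eval p m

/-- Straight-line code that puts the value of an expression into register `k`, leaving the registers
below `k` alone. -/
def Expr.code : Expr → ℕ → List Instr
  | const c, k => [.const k c]
  | pid, k => [.sel k 0 0 0]
  | load e, k => e.code k ++ [.load k k]
  | add e f, k => e.code k ++ f.code (k + 1) ++ [.add k k (k + 1)]
  | sub e f, k => e.code k ++ f.code (k + 1) ++ [.sub k k (k + 1)]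
  | ite c x y, k => c.code k ++ x.code (k + 1) ++ y.code (k + 2) ++ [.sel k k (k + 2) (k + 1)]

/-- An instruction that neither writes to the shared memory nor jumps. -/
def Instr.IsLocal : Instr → Prop
  | .store _ _ => False
  | .jz _ _ => False
  | _ => True

/-- The effect of a local instruction on the registers. -/
def Instr.exec (m : ℕ → ℕ) (r : ℕ → ℕ) : Instr → ℕ → ℕ
  | .const d c => Function.update r d c
  | .add d a b => Function.update r d (r a + r b)
  | .sub d a b => Function.update r d (r a - r b)
  | .sel d a x y => Function.update r d (if r a = 0 then r x else r y)
  | .load d a => Function.update r d (m (r a))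
  | .store _ _ => r
  | .jz _ _ => r

theorem Expr.isLocal_of_mem_code (e : Expr) (k : ℕ) : ∀ i ∈ e.code k, i.IsLocal := by
  induction e generalizing k with
  | const c => simp [code, Instr.IsLocal]
  | pid => simp [code, Instr.IsLocal]
  | load e ih => 
    simp only [code, List.mem_append, List.mem_singleton]
    rintro i (h | rfl)
    · exact ih _ _ h
    · trivial
  | add e f ihe ihf | sub e f ihe ihf =>
    simp only [code, List.mem_append, List.mem_singleton]
    rintro i ((h | h) | rfl)
    · exact ihe _ _ h
    · exact ihf _ _ h
    · trivial
  | ite c x y ihc ihx ihy =>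
    simp only [code, List.mem_append, List.mem_singleton]
    rintro i (((h | h) | h) | rfl)
    · exact ihc _ _ h
    · exact ihx _ _ h
    · exact ihy _ _ h
    · trivial

theorem Expr.foldl_code (e : Expr) (m r : ℕ → ℕ) (k : ℕ) (hk : 1 ≤ k) :
    (e.code k).foldl (Instr.exec m) r k = e.eval (r 0) m ∧
      ∀ j < k, (e.code k).foldl (Instr.exec m) r j = r j := by
  induction e generalizing k r with
  | const c => simp +contextual [code, eval, Instr.exec, Nat.ne_of_lt]
  | pid => simp +contextual [code, eval, Instr.exec, Nat.ne_of_lt]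
  | load e ih =>
    obtain ⟨h1, h2⟩ := ih r k hk
    simp +contextual [code, eval, Instr.exec, Nat.ne_of_lt, h1, h2]
  | add e f ihe ihf | sub e f ihe ihf =>
    obtain ⟨h1, h2⟩ := ihe r k hk
    obtain ⟨h3, h4⟩ := ihf ((e.code k).foldl (Instr.exec m) r) (k + 1) (by omega)
    rw [h2 0 (by omega)] at h3
    simp only [code, eval, List.foldl_append, List.foldl_cons, List.foldl_nil, Instr.exec,
      Function.update_self, h3, h4 k (by omega), h1, true_and]
    intro j hj
    rw [Function.update_of_ne hj.ne, h4 j (by omega), h2 j hj]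
  | ite c x y ihc ihx ihy =>
    obtain ⟨h1, h2⟩ := ihc r k hk
    obtain ⟨h3, h4⟩ := ihx ((c.code k).foldl (Instr.exec m) r) (k + 1) (by omega)
    obtain ⟨h5, h6⟩ := ihy ((x.code (k + 1)).foldl (Instr.exec m)
      ((c.code k).foldl (Instr.exec m) r)) (k + 2) (by omega)
    rw [h2 0 (by omega)] at h3
    rw [h4 0 (by omega), h2 0 (by omega)] at h5
    simp only [code, eval, List.foldl_append, List.foldl_cons, List.foldl_nil, Instr.exec,
      Function.update_self, h3, h5, h6 k (by omega), h4 k (by omega), h6 (k + 1) (by omega), h1,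
      true_and]
    intro j hj
    rw [Function.update_of_ne hj.ne, h6 j (by omega), h4 j (by omega), h2 j hj]

/-- The code `l` stands at position `o` of the program. -/
def At (prog : Program) (o : ℕ) (l : List Instr) : Prop :=
  ∃ a b, prog = a ++ l ++ b ∧ a.length = o

theorem At.left {prog : Program} {o : ℕ} {l l' : List Instr} (h : At prog o (l ++ l')) :
    At prog o l := by
  obtain ⟨a, b, h, ha⟩ := h
  exact ⟨a, l' ++ b, by simpa using h, ha⟩

theorem At.right {prog : Program} {o : ℕ} {l l' : List Instr} (h : At prog o (l ++ l')) :
    At prog (o + l.length) l' := by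
  obtain ⟨a, b, h, ha⟩ := h
  exact ⟨a ++ l, b, by simpa using h, by simp [ha]⟩

theorem At.head {prog : Program} {o : ℕ} {i : Instr} {l : List Instr} (h : At prog o (i :: l)) :
    prog[o]? = some i := by
  obtain ⟨a, b, rfl, rfl⟩ := h
  simp

theorem At.tail {prog : Program} {o : ℕ} {i : Instr} {l : List Instr} (h : At prog o (i :: l)) :
    At prog (o + 1) l :=
  At.right (l := [i]) h

theorem Proc.next_of_isLocal {prog : Program} {m : ℕ → ℕ} {s : Proc} {i : Instr}
    (h : prog[s.pc]? = some i) (hi : i.IsLocal) :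
    s.next prog m = ⟨s.pc + 1, i.exec m s.reg⟩ := by
  cases i <;> simp_all [Proc.next, Instr.exec, Instr.IsLocal]

theorem Proc.write_of_isLocal {prog : Program} {s : Proc} {i : Instr}
    (h : prog[s.pc]? = some i) (hi : i.IsLocal) : s.write prog = none := by
  cases i <;> simp_all [Proc.write, Instr.IsLocal]

theorem Step.mem_eq {P : ℕ} {prog : Program} {c c' : Config P} (h : Step prog c c')
    (hw : ∀ p, (c.proc p).write prog = none) : c'.mem = c.mem := by
  funext x
  rcases h.2 x with h | ⟨p, hp⟩
  · exact h.2
  · simp [hw] at hp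

/-- All processors of a run execute a block of local instructions in lockstep. -/
theorem run_local {P : ℕ} {prog : Program} {run : ℕ → Config P}
    (hrun : ∀ t, Step prog (run t) (run (t + 1))) (l : List Instr) (hl : ∀ i ∈ l, i.IsLocal)
    (o t : ℕ) (hat : At prog o l) (hpc : ∀ p, ((run t).proc p).pc = o) :
    (run (t + l.length)).mem = (run t).mem ∧ ∀ p, (run (t + l.length)).proc p =
      ⟨o + l.length, l.foldl (Instr.exec (run t).mem) ((run t).proc p).reg⟩ := by
  induction l generalizing o t with
  | nil => exact ⟨rfl, fun p => by simp [← hpc p]⟩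
  | cons i l ih =>
    have hi := hl i (by simp)
    have hm : (run (t + 1)).mem = (run t).mem :=
      (hrun t).mem_eq fun p => Proc.write_of_isLocal (by rw [hpc]; exact hat.head) hi
    have hp : ∀ p, (run (t + 1)).proc p = ⟨o + 1, i.exec (run t).mem ((run t).proc p).reg⟩ := by
      intro p
      rw [(hrun t).1 p, Proc.next_of_isLocal (by rw [hpc]; exact hat.head) hi, hpc]
    obtain ⟨h1, h2⟩ := ih (fun j hj => hl j (by simp [hj])) (o + 1) (t + 1) hat.tail
      (fun p => by rw [hp])
    have e : t + 1 + l.length = t + (i :: l).length := by simp; omega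
    rw [e, hm] at h1
    refine ⟨h1, fun p => ?_⟩
    rw [← e, h2 p, hm, hp]
    simp; omega

/-! ### Synchronous assignments -/

/-- A guarded write: if `guard` is nonzero, then `val` is written to the cell `addr`. -/
structure Write where
  guard : Expr
  addr : Expr
  val : Expr

/-- The cell that receives the values of writes whose guard is zero. -/
def trash : ℕ := 3

/-- Code that puts the addresses and the values of a list of writes into registers `k, k + 1, …`. -/
def evalCode : List Write → ℕ → List Instr
  | [], _ => []
  | w :: l, k => (Expr.ite w.guard w.addr (.const trash)).code k ++ w.val.code (k + 1) ++
      evalCode l (k + 2)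

/-- Code that performs the writes prepared by `evalCode`. -/
def storeCode : List Write → ℕ → List Instr
  | [], _ => []
  | _ :: l, k => .store k (k + 1) :: storeCode l (k + 2)

/-- The registers hold what `evalCode` computes. -/
def Prepared (m : ℕ → ℕ) (p : ℕ) (r : ℕ → ℕ) : List Write → ℕ → Prop
  | [], _ => True
  | w :: l, k => r k = (if w.guard.eval p m = 0 then trash else w.addr.eval p m) ∧
      r (k + 1) = w.val.eval p m ∧ Prepared m p r l (k + 2)

theorem isLocal_of_mem_evalCode (l : List Write) (k : ℕ) : ∀ i ∈ evalCode l k, i.IsLocal := by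
  induction l generalizing k with
  | nil => simp [evalCode]
  | cons w l ih =>
    simp only [evalCode, List.mem_append]
    rintro i ((h | h) | h)
    · exact Expr.isLocal_of_mem_code _ _ _ h
    · exact Expr.isLocal_of_mem_code _ _ _ h
    · exact ih _ _ h

theorem foldl_evalCode (l : List Write) (m r : ℕ → ℕ) (k : ℕ) (hk : 1 ≤ k) :
    Prepared m (r 0) ((evalCode l k).foldl (Instr.exec m) r) l k ∧
      ∀ j < k, (evalCode l k).foldl (Instr.exec m) r j = r j := by
  induction l generalizing r k with
  | nil => simp [Prepared, evalCode]
  | cons w l ih =>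
    obtain ⟨h1, h2⟩ := (Expr.ite w.guard w.addr (.const trash)).foldl_code m r k hk
    obtain ⟨h3, h4⟩ := w.val.foldl_code m
      (((Expr.ite w.guard w.addr (.const trash)).code k).foldl (Instr.exec m) r) (k + 1) (by omega)
    obtain ⟨h5, h6⟩ := ih ((w.val.code (k + 1)).foldl (Instr.exec m)
      (((Expr.ite w.guard w.addr (.const trash)).code k).foldl (Instr.exec m) r)) (k + 2) (by omega)
    rw [h2 0 (by omega)] at h3
    rw [h4 0 (by omega), h2 0 (by omega)] at h5
    simp only [evalCode, List.foldl_append, Prepared]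
    refine ⟨⟨?_, ?_, h5⟩, fun j hj => ?_⟩
    · rw [h6 k (by omega), h4 k (by omega), h1]; rfl
    · rw [h6 (k + 1) (by omega), h3]
    · rw [h6 j (by omega), h4 j (by omega), h2 j hj]

/-- The memory `m'` results from `m` by the writes `l` of all of `P` processors, where guards,
addresses and values refer to `m`. -/
def Written (P : ℕ) (l : List Write) (m m' : ℕ → ℕ) : Prop :=
  ∀ x ≠ trash, ((∀ p : Fin P, ∀ w ∈ l, w.guard.eval p m ≠ 0 → w.addr.eval p m ≠ x) ∧
    m' x = m x) ∨
    ∃ p : Fin P, ∃ w ∈ l, w.guard.eval p m ≠ 0 ∧ w.addr.eval p m = x ∧ m' x = w.val.eval p m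

theorem run_store {P : ℕ} {prog : Program} {run : ℕ → Config P}
    (hrun : ∀ t, Step prog (run t) (run (t + 1))) (m : ℕ → ℕ) (l : List Write)
    (o t k : ℕ) (hat : At prog o (storeCode l k)) (hpc : ∀ p, ((run t).proc p).pc = o)
    (hr : ∀ p : Fin P, Prepared m p ((run t).proc p).reg l k) :
    (∀ p, (run (t + (storeCode l k).length)).proc p =
      ⟨o + (storeCode l k).length, ((run t).proc p).reg⟩) ∧
    ∀ x ≠ trash, ((∀ p : Fin P, ∀ w ∈ l, w.guard.eval p m ≠ 0 → w.addr.eval p m ≠ x) ∧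
      (run (t + (storeCode l k).length)).mem x = (run t).mem x) ∨
      ∃ p : Fin P, ∃ w ∈ l, w.guard.eval p m ≠ 0 ∧ w.addr.eval p m = x ∧
        (run (t + (storeCode l k).length)).mem x = w.val.eval p m := by
  induction l generalizing o t k with
  | nil => exact ⟨fun p => by simp [storeCode, ← hpc p], fun x _ => by simp [storeCode]⟩
  | cons w l ih =>
    simp only [storeCode] at hat
    have hp : ∀ p, (run (t + 1)).proc p = ⟨o + 1, ((run t).proc p).reg⟩ := by
      intro p
      rw [(hrun t).1 p]
      simp [Proc.next, hpc, hat.head]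
    have hw : ∀ p, ((run t).proc p).write prog =
        some (if w.guard.eval p m = 0 then trash else w.addr.eval p m, w.val.eval p m) := by
      intro p
      obtain ⟨h1, h2, -⟩ := hr p
      simp [Proc.write, hpc, hat.head, h1, h2]
    obtain ⟨h1, h2⟩ := ih (o + 1) (t + 1) (k + 2) hat.tail (fun p => by rw [hp])
      (fun p => by rw [hp]; exact (hr p).2.2)
    have e : t + 1 + (storeCode l (k + 2)).length = t + (storeCode (w :: l) k).length := by
      simp [storeCode]; omega
    rw [e] at h1 h2
    refine ⟨fun p => ?_, fun x hx => ?_⟩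
    · rw [h1 p, hp]
      simp [storeCode]; omega
    · rcases h2 x hx with ⟨h3, h4⟩ | ⟨p, w', hw', h3⟩
      · rw [h4]
        rcases (hrun t).2 x with ⟨h5, h6⟩ | ⟨p, h5⟩
        · refine .inl ⟨fun p w' hw' hg => ?_, h6⟩
          rcases List.mem_cons.1 hw' with rfl | hw'
          · intro hax
            apply h5 p (w'.val.eval p m)
            rw [hw p, if_neg hg, hax]
          · exact h3 p w' hw' hg
        · right
          rw [hw p] at h5
          simp only [Option.some.injEq, Prod.mk.injEq] at h5
          by_cases hg : w.guard.eval p m = 0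
          · rw [if_pos hg] at h5
            exact absurd h5.1.symm hx
          · rw [if_neg hg] at h5
            exact ⟨p, w, by simp, hg, h5.1, h5.2.symm⟩
      · exact .inr ⟨p, w', by simp [hw'], h3⟩

/-! ### Structured programs -/

/-- Programs in structured form. All processors are at the same place of the program at all times,
so that the condition of a loop must have the same value for all of them. -/
inductive Stmt where
  /-- synchronous execution of all writes by all processors -/
  | assign (l : List Write)
  | seq (s s' : Stmt)
  /-- repeat `s` while `c` is nonzero -/
  | loop (c : Expr) (s : Stmt)

/-- The machine code of a structured program that starts at position `o`. -/
def Stmt.code : Stmt → ℕ → List Instr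
  | assign l, _ => evalCode l 1 ++ storeCode l 1
  | seq s s', o => s.code o ++ s'.code (o + (s.code o).length)
  | loop c s, o =>
      let b := s.code (o + (c.code 1).length + 1)
      c.code 1 ++ (.jz 1 (o + (c.code 1).length + 1 + b.length + 2) :: (b ++ [.const 1 0, .jz 1 o]))

/-- All processors are at position `o`, and they know their numbers. -/
def Sync {P : ℕ} (c : Config P) (o : ℕ) : Prop :=
  ∀ p, (c.proc p).pc = o ∧ (c.proc p).reg 0 = p

/-- Started on the memory `m`, the statement `s` ends within `T` steps with a memory that satisfies
`Q`, however the write conflicts are resolved. -/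
def Runs (P : ℕ) (s : Stmt) (T : ℕ) (m : ℕ → ℕ) (Q : (ℕ → ℕ) → Prop) : Prop :=
  ∀ (prog : Program) (o : ℕ), At prog o (s.code o) → ∀ run : ℕ → Config P,
    (∀ t, Step prog (run t) (run (t + 1))) → ∀ t, Sync (run t) o → (run t).mem = m →
    ∃ t' ≤ T, Sync (run (t + t')) (o + (s.code o).length) ∧ Q (run (t + t')).mem

theorem Runs.mono {P : ℕ} {s : Stmt} {T T' : ℕ} {m : ℕ → ℕ} {Q Q' : (ℕ → ℕ) → Prop}
    (h : Runs P s T m Q) (hT : T ≤ T') (hQ : ∀ m', Q m' → Q' m') : Runs P s T' m Q' := by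
  intro prog o hat run hrun t hs hm
  obtain ⟨t', ht, h1, h2⟩ := h prog o hat run hrun t hs hm
  exact ⟨t', ht.trans hT, h1, hQ _ h2⟩

/-- The number of steps of a synchronous assignment. -/
def assignCost (l : List Write) : ℕ := (evalCode l 1 ++ storeCode l 1).length

theorem Runs.assign {P : ℕ} {l : List Write} {m : ℕ → ℕ} {Q : (ℕ → ℕ) → Prop}
    (h : ∀ m', Written P l m m' → Q m') : Runs P (.assign l) (assignCost l) m Q := by
  intro prog o hat run hrun t hs hm
  simp only [Stmt.code] at hat ⊢
  obtain ⟨h1, h2⟩ := run_local hrun _ (isLocal_of_mem_evalCode l 1) o t hat.left (fun p => (hs p).1)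
  have h3 := fun p => foldl_evalCode l m ((run t).proc p).reg 1 le_rfl
  obtain ⟨h4, h5⟩ := run_store hrun m l _ (t + (evalCode l 1).length) 1 hat.right
    (fun p => by rw [h2]) (fun p => by
      rw [h2, hm]
      have := (h3 p).1
      rwa [(hs p).2] at this)
  have e : t + (evalCode l 1).length + (storeCode l 1).length = t + assignCost l := by
    simp [assignCost]; omega
  rw [e] at h4 h5
  refine ⟨assignCost l, le_rfl, fun p => ?_, h _ ?_⟩
  · rw [h4 p, h2, hm]
    refine ⟨by simp; omega, ?_⟩
    dsimp only
    rw [(h3 p).2 0 one_pos, (hs p).2]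
  · rw [h1, hm] at h5
    exact h5

theorem Runs.seq {P : ℕ} {s s' : Stmt} {T T' : ℕ} {m : ℕ → ℕ} {Q : (ℕ → ℕ) → Prop}
    (h : Runs P s T m fun m' => Runs P s' T' m' Q) : Runs P (.seq s s') (T + T') m Q := by
  intro prog o hat run hrun t hs hm
  simp only [Stmt.code] at hat ⊢
  obtain ⟨t₁, ht₁, h1, h2⟩ := h prog o hat.left run hrun t hs hm
  obtain ⟨t₂, ht₂, h3, h4⟩ := h2 prog _ hat.right run hrun _ h1 rfl
  refine ⟨t₁ + t₂, by omega, ?_, ?_⟩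
  · rw [← add_assoc, List.length_append, ← add_assoc]
    exact h3
  · rwa [← add_assoc]

/-- The number of steps of the evaluation of an expression. -/
def Expr.cost (c : Expr) : ℕ := (c.code 1).length

/-- A loop whose invariant `I` counts down the remaining iterations. -/
theorem Runs.loop {P : ℕ} {c : Expr} {s : Stmt} {T : ℕ} {I : ℕ → (ℕ → ℕ) → Prop}
    (hc : ∀ k m, I k m → ∀ p, c.eval p m = 0 ↔ k = 0)
    (hs : ∀ k m, I (k + 1) m → Runs P s T m (I k)) (k : ℕ) (m : ℕ → ℕ) (hI : I k m) :
    Runs P (.loop c s) (k * (T + c.cost + 3) + (c.cost + 1)) m (I 0) := by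
  intro prog o hat run hrun t hsync hm
  simp only [Stmt.code] at hat ⊢
  set b := s.code (o + (c.code 1).length + 1) with hb
  have hjz := hat.right.head
  have hbody := hat.right.tail.left
  have hend := hat.right.tail.right
  have hstep : ∀ (t : ℕ) (m : ℕ → ℕ), Sync (run t) o → (run t).mem = m →
      (run (t + (c.cost + 1))).mem = m ∧ ∀ p, (run (t + (c.cost + 1))).proc p =
        ⟨if c.eval p m = 0 then o + (c.code 1).length + 1 + b.length + 2
          else o + (c.code 1).length + 1,
         (c.code 1).foldl (Instr.exec m) ((run t).proc p).reg⟩ := by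
    intro t m hsync hm
    obtain ⟨h1, h2⟩ := run_local hrun _ (c.isLocal_of_mem_code 1) o t hat.left
      (fun p => (hsync p).1)
    have h3 := fun p => c.foldl_code m ((run t).proc p).reg 1 le_rfl
    have hst := hrun (t + (c.code 1).length)
    constructor
    · rw [Expr.cost, ← add_assoc, hst.mem_eq, h1, hm]
      intro p
      simp [Proc.write, h2, hjz]
    · intro p
      rw [Expr.cost, ← add_assoc, hst.1 p]
      have := (h3 p).1
      rw [(hsync p).2] at this
      simp [Proc.next, h2, hjz, hm, this]
  induction k generalizing m t with
  | zero =>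
    obtain ⟨h1, h2⟩ := hstep t m hsync hm
    refine ⟨c.cost + 1, by omega, fun p => ?_, by rw [h1]; exact hI⟩
    rw [h2 p, if_pos ((hc 0 m hI p).2 rfl)]
    refine ⟨by simp; omega, ?_⟩
    dsimp only
    rw [(c.foldl_code m _ 1 le_rfl).2 0 one_pos, (hsync p).2]
  | succ k ih =>
    obtain ⟨h1, h2⟩ := hstep t m hsync hm
    have hsync' : Sync (run (t + (c.cost + 1))) (o + (c.code 1).length + 1) := by
      intro p
      rw [h2 p, if_neg (fun h => by simpa using (hc _ m hI p).1 h)]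
      refine ⟨rfl, ?_⟩
      dsimp only
      rw [(c.foldl_code m _ 1 le_rfl).2 0 one_pos, (hsync p).2]
    obtain ⟨t₁, ht₁, h3, h4⟩ := hs k m hI prog _ hbody run hrun _ hsync' h1
    rw [← hb] at h3
    set t₂ := t + (c.cost + 1) + t₁
    have hl := run_local hrun [.const 1 0] (by simp [Instr.IsLocal]) _ t₂ (At.left (l' := [_]) hend)
      (fun p => (h3 p).1)
    have hj := (At.right (l := [Instr.const 1 0]) hend).head
    simp only [List.length_singleton, List.foldl_cons, List.foldl_nil, Instr.exec] at hl hj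
    have hst := hrun (t₂ + 1)
    have hm' : (run (t₂ + 1 + 1)).mem = (run t₂).mem := by
      rw [hst.mem_eq, hl.1]
      intro p
      simp [Proc.write, hl.2, hj]
    have hsync₂ : Sync (run (t₂ + 1 + 1)) o := by
      intro p
      rw [hst.1 p]
      simp [Proc.next, hl.2, hj, (h3 p).2]
    obtain ⟨t₃, ht₃, h5, h6⟩ := ih _ h4 (t₂ + 1 + 1) hsync₂ hm'
    have e : t₂ + 1 + 1 + t₃ = t + (c.cost + 1 + t₁ + 2 + t₃) := by omega
    rw [e] at h5 h6
    exact ⟨_, by rw [Nat.succ_mul]; omega, h5, h6⟩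

/-- A structured program that runs in time is a machine program that computes in time. -/
theorem Runs.computes {P : ℕ} {s : Stmt} {T : ℕ} {m : ℕ → ℕ} {Q : (ℕ → ℕ) → Prop} {T' : ℝ}
    (h : Runs P s T m Q) (hT : (T : ℝ) ≤ T') : Computes (s.code 0) P T' m Q := by
  intro run h0 hrun
  obtain ⟨t, ht, h1, h2⟩ := h (s.code 0) 0 ⟨[], [], by simp, rfl⟩ run hrun 0
    (by intro p; simp [h0, init]) (by simp [h0, init])
  rw [zero_add] at h1 h2
  exact ⟨t, le_trans (by exact_mod_cast ht) hT, fun p => by rw [(h1 p).1]; simp, h2⟩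

end PRAM

namespace EdgeColoringUpdate

/-! ### Named memory cells -/

/-- The entries of the block of a vertex. -/
inductive Field (n D : ℕ) where
  | missing
  | degree
  | vertexOf (c : Fin (D + 1))
  | colorOf (w : Fin n)
  | position (w : Fin n)
  | neighbor (i : Fin D)

/-- Names for the cells of the shared memory; `base` is a header cell that the data structure leaves
free. -/
inductive Cell (n D : ℕ) where
  | size
  | bound
  | base
  | trash
  | work
  | pointer (v : Fin n)
  | entry (v : Fin n) (f : Field n D)
  | scratch (i : ℕ)

/-- The position of an entry within its block. -/
def Field.offset {n D : ℕ} : Field n D → ℕ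
  | missing => 0
  | degree => 1
  | vertexOf c => 2 + c
  | colorOf w => 2 + (D + 1) + w
  | position w => 2 + (D + 1) + n + w
  | neighbor i => 2 + (D + 1) + n + n + i

/-- The address of a cell. -/
def Cell.addr {n D : ℕ} : Cell n D → ℕ
  | size => 0
  | bound => 1
  | base => 2
  | trash => 3
  | work => 4
  | pointer v => 5 + v
  | entry v f => block n D v + f.offset
  | scratch i => workspace n D + i

variable {n D : ℕ}

theorem Field.offset_lt (f : Field n D) : f.offset < blockSize n D := by
  cases f <;> simp only [offset, blockSize] <;> omega

theorem Field.offset_injective : Function.Injective (Field.offset (n := n) (D := D)) := by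
  intro f g h
  cases f <;> cases g <;> simp only [offset] at h <;> first | rfl | omega | (congr 1; omega)

theorem block_add_lt_workspace (v : Fin n) {i : ℕ} (hi : i < blockSize n D) :
    block n D v + i < workspace n D := by
  have := Nat.mul_le_mul_right (blockSize n D) (Nat.succ_le_of_lt v.isLt)
  simp only [block, workspace]
  rw [Nat.succ_mul] at this
  omega

theorem block_add_inj {v w : Fin n} {i j : ℕ} (hi : i < blockSize n D) (hj : j < blockSize n D)
    (h : block n D v + i = block n D w + j) : v = w ∧ i = j := by
  simp only [block] at h
  have h' : i + (v : ℕ) * blockSize n D = j + (w : ℕ) * blockSize n D := by omega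
  have hd := congrArg (· / blockSize n D) h'
  simp only [Nat.add_mul_div_right _ _ (Nat.zero_lt_of_lt hi), Nat.div_eq_of_lt hi,
    Nat.div_eq_of_lt hj, zero_add] at hd
  refine ⟨Fin.ext hd, ?_⟩
  rw [hd] at h'
  omega

theorem Cell.addr_injective : Function.Injective (Cell.addr (n := n) (D := D)) := by
  intro c c' h
  have hlt : ∀ (v : Fin n) (f : Field n D), block n D v + f.offset < workspace n D :=
    fun v f => block_add_lt_workspace v f.offset_lt
  have hge : ∀ v, 5 + n ≤ block n D v := fun v => by simp only [block]; omega
  have hw : 5 + n ≤ workspace n D := hge n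
  cases c with
  | entry v f =>
    have h1 := hlt v f
    have h2 := hge v
    cases c' with
    | entry w g =>
      obtain ⟨rfl, h'⟩ := block_add_inj f.offset_lt g.offset_lt h
      rw [Field.offset_injective h']
    | _ => simp only [addr] at h; omega
  | _ =>
    cases c' with
    | entry w g =>
      have h1 := hlt w g
      have h2 := hge w
      simp only [addr] at h; omega
    | _ => simp only [addr] at h; first | rfl | omega | (congr 1; omega)

/-! ### The tables of an edge-coloring in the memory -/

/-- What is stored for an optional vertex or color. -/
def enc {k : ℕ} : Option (Fin k) → ℕ
  | none => 0
  | some i => i + 1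

@[simp] theorem enc_none {k : ℕ} : enc (none : Option (Fin k)) = 0 := rfl

@[simp] theorem enc_some {k : ℕ} (i : Fin k) : enc (some i) = i + 1 := rfl

theorem enc_eq_zero {k : ℕ} {o : Option (Fin k)} : enc o = 0 ↔ o = none := by
  cases o <;> simp

/-- The parts of the data structure that no update changes. -/
structure Header (n D : ℕ) (m : ℕ → ℕ) : Prop where
  size : m (Cell.size : Cell n D).addr = n
  bound : m (Cell.bound : Cell n D).addr = D
  work : m (Cell.work : Cell n D).addr = workspace n D
  pointer : ∀ v : Fin n, m (Cell.pointer v : Cell n D).addr = block n D v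

/-- The tables `X` (the color of an edge) and `T` (the edge at a vertex with a given color) describe
a proper edge-coloring of `G`. -/
structure IsColoring (G : SimpleGraph (Fin n)) (X : Fin n → Fin n → Option (Fin (D + 1)))
    (T : Fin n → Fin (D + 1) → Option (Fin n)) : Prop where
  symm : ∀ v w, X v w = X w v
  isSome : ∀ v w, (X v w).isSome ↔ G.Adj v w
  vertex : ∀ v c w, T v c = some w ↔ X v w = some c

/-- The memory holds the graph `G` and the tables `X` and `T` of a proper edge-coloring; nothing is
said about the missing colors. -/
structure HoldsTables (m : ℕ → ℕ) (G : SimpleGraph (Fin n))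
    (X : Fin n → Fin n → Option (Fin (D + 1))) (T : Fin n → Fin (D + 1) → Option (Fin n)) :
    Prop where
  header : Header n D m
  isColoring : IsColoring G X T
  colorOf : ∀ v w, m (Cell.entry v (.colorOf w) : Cell n D).addr = enc (X v w)
  vertexOf : ∀ v c, m (Cell.entry v (.vertexOf c) : Cell n D).addr = enc (T v c)
  degree : ∀ v, m (Cell.entry v .degree : Cell n D).addr = (G.neighborSet v).ncard
  neighbor : ∀ v w, G.Adj v w → ∃ i : Fin D, (i : ℕ) < (G.neighborSet v).ncard ∧
    m (Cell.entry v (.position w) : Cell n D).addr = i ∧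
    m (Cell.entry v (.neighbor i) : Cell n D).addr = w

/-- The memory also holds a color `M v` that is missing at `v`, for every vertex `v`. -/
structure Holds (m : ℕ → ℕ) (G : SimpleGraph (Fin n))
    (X : Fin n → Fin n → Option (Fin (D + 1))) (T : Fin n → Fin (D + 1) → Option (Fin n))
    (M : Fin n → Fin (D + 1)) : Prop extends HoldsTables m G X T where
  missing : ∀ v, m (Cell.entry v .missing : Cell n D).addr = M v + 1
  free : ∀ v, T v (M v) = none

theorem addr_vertexOf (v : Fin n) (c : Fin (D + 1)) :
    (Cell.entry v (.vertexOf c) : Cell n D).addr = color2edgeCell n D v c := by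
  simp only [Cell.addr, Field.offset, color2edgeCell]; omega
theorem addr_colorOf (v w : Fin n) :
    (Cell.entry v (.colorOf w) : Cell n D).addr = edge2colorCell n D v w := by
  simp only [Cell.addr, Field.offset, edge2colorCell]; omega
theorem addr_position (v w : Fin n) :
    (Cell.entry v (.position w) : Cell n D).addr = posCell n D v w := by
  simp only [Cell.addr, Field.offset, posCell]; omega
theorem addr_neighbor (v : Fin n) (i : Fin D) :
    (Cell.entry v (.neighbor i) : Cell n D).addr = adjCell n D v i := by
  simp only [Cell.addr, Field.offset, adjCell]; omega

theorem color_unique {G : SimpleGraph (Fin n)} {k : ℕ} (φ : ProperEdgeColoring G k) {v w w' : Fin n}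
    (h : G.Adj v w) (h' : G.Adj v w') (e : φ ⟨s(v, w), h⟩ = φ ⟨s(v, w'), h'⟩) : w = w' := by
  by_contra hne
  refine φ.valid (v := ⟨s(v, w), h⟩) (w := ⟨s(v, w'), h'⟩) ?_ e
  rw [SimpleGraph.lineGraph_adj_iff_exists]
  refine ⟨?_, v, by simp, by simp⟩
  intro h1
  rcases Sym2.eq_iff.1 (congrArg Subtype.val h1) with ⟨-, h2⟩ | ⟨h1, h2⟩
  · exact hne h2
  · exact hne (h2.trans h1)

/-- The second table of a proper edge-coloring exists: it is determined by the first one. -/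
theorem exists_isColoring {G : SimpleGraph (Fin n)} {X : Fin n → Fin n → Option (Fin (D + 1))}
    (hsymm : ∀ v w, X v w = X w v) (hadj : ∀ v w, (X v w).isSome ↔ G.Adj v w)
    (hproper : ∀ v w w' c, X v w = some c → X v w' = some c → w = w') :
    ∃ T, IsColoring G X T := by
  classical
  refine ⟨fun v c => if hc : ∃ w, X v w = some c then some hc.choose else none, hsymm, hadj,
    fun v c w => ?_⟩
  by_cases hc : ∃ w, X v w = some c
  · simp only [dif_pos hc, Option.some.injEq]
    constructor
    · rintro rfl
      exact hc.choose_spec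
    · exact hproper _ _ _ _ hc.choose_spec
  · simp only [dif_neg hc]
    simpa using fun h1 => hc ⟨w, h1⟩

/-- The tables of a data structure in memory. -/
theorem Represents.holds {m : ℕ → ℕ} {G : SimpleGraph (Fin n)} {φ : ProperEdgeColoring G (D + 1)}
    (h : Represents m G φ) (hG : MaxDegreeLE G D) :
    ∃ X T M, Holds m G X T (M : Fin n → Fin (D + 1)) := by
  classical
  choose M hM hM' using h.missing
  let X : Fin n → Fin n → Option (Fin (D + 1)) := fun v w =>
    if hvw : G.Adj v w then some (φ ⟨s(v, w), hvw⟩) else none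
  have hX : ∀ v w c, X v w = some c ↔ ∃ hvw : G.Adj v w, φ ⟨s(v, w), hvw⟩ = c := by
    intro v w c
    by_cases hvw : G.Adj v w <;> simp [X, hvw]
  obtain ⟨T, hI⟩ : ∃ T, IsColoring G X T := by
    refine exists_isColoring (fun v w => ?_) (fun v w => ?_) (fun v w w' c h1 h2 => ?_)
    · by_cases hvw : G.Adj v w
      · simp only [X, dif_pos hvw, dif_pos hvw.symm, Sym2.eq_swap (a := v)]
      · simp only [X, dif_neg hvw, dif_neg (fun h => hvw (G.adj_symm h))]
    · by_cases hvw : G.Adj v w <;> simp [X, hvw]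
    · obtain ⟨h1, h3⟩ := (hX _ _ _).1 h1
      obtain ⟨h2, h4⟩ := (hX _ _ _).1 h2
      exact color_unique φ h1 h2 (h3.trans h4.symm)
  have hT := hI.vertex
  refine ⟨X, T, M, ⟨⟨⟨h.size, h.bound, h.work, h.pointer⟩, hI, ?_, ?_, h.degree, ?_⟩, ?_, ?_⟩⟩
  · intro v w
    rw [addr_colorOf]
    by_cases hvw : G.Adj v w
    · simp only [X, dif_pos hvw, enc_some]
      exact h.edge2color v w hvw
    · simp only [X, dif_neg hvw, enc_none]
      exact h.edge2color_none v w hvw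
  · intro v c
    rw [addr_vertexOf]
    cases hc : T v c with
    | none =>
      apply h.color2edge_none
      intro w hw e
      have := (hT v c w).2 ((hX _ _ _).2 ⟨hw, e⟩)
      simp [hc] at this
    | some w =>
      obtain ⟨hvw, rfl⟩ := (hX _ _ _).1 ((hT v c w).1 hc)
      exact h.color2edge v w hvw
  · intro v w hvw
    obtain ⟨h1, h2⟩ := h.adjacency v w hvw
    refine ⟨⟨m (posCell n D v w), h1.trans_le (hG v)⟩, h1, ?_, ?_⟩
    · rw [addr_position]
    · rw [addr_neighbor]; exact h2
  · exact hM
  · intro v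
    cases hc : T v (M v) with
    | none => rfl
    | some w =>
      obtain ⟨hvw, e⟩ := (hX _ _ _).1 ((hT v _ w).1 hc)
      exact absurd e (hM' v w hvw)

theorem Holds.storesColoring {m : ℕ → ℕ} {G : SimpleGraph (Fin n)}
    {X : Fin n → Fin n → Option (Fin (D + 1))} {T : Fin n → Fin (D + 1) → Option (Fin n)}
    {M : Fin n → Fin (D + 1)} (h : Holds m G X T M) : StoresColoring D G m := by
  have hI := h.isColoring
  -- the color of an edge as a function on unordered pairs
  let f : Sym2 (Fin n) → Option (Fin (D + 1)) := Sym2.lift ⟨X, hI.symm⟩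
  have hf : ∀ e : G.edgeSet, (f e).isSome := by
    rintro ⟨e, he⟩
    induction e with
    | h v w => exact (hI.isSome v w).2 he
  let φ : ProperEdgeColoring G (D + 1) := SimpleGraph.Coloring.mk (fun e => (f e).get (hf e)) (by
    rintro ⟨e, he⟩ ⟨e', he'⟩ hadj heq
    obtain ⟨hne, v, hv, hv'⟩ := SimpleGraph.lineGraph_adj_iff_exists.1 hadj
    obtain ⟨w, rfl⟩ := Sym2.mem_iff_exists.1 hv
    obtain ⟨w', rfl⟩ := Sym2.mem_iff_exists.1 hv'
    have h1 : X v w = X v w' := Option.get_inj.1 heq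
    obtain ⟨c, hc⟩ := Option.isSome_iff_exists.1 ((hI.isSome v w).2 he)
    have h2 := (hI.vertex v c w).2 hc
    rw [h1] at hc
    rw [(hI.vertex v c w').2 hc] at h2
    exact hne (by simp_all))
  have hφ : ∀ v w (hvw : G.Adj v w), X v w = some (φ ⟨s(v, w), hvw⟩) := fun v w hvw =>
    (Option.some_get (hf ⟨s(v, w), hvw⟩)).symm
  have hnone : ∀ v w, ¬ G.Adj v w → X v w = none := fun v w hvw => by
    rw [← hI.isSome] at hvw; simpa using hvw
  refine ⟨φ, h.header.size, h.header.bound, h.header.work, h.header.pointer, ?_, h.degree, ?_, ?_,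
    ?_, ?_, ?_⟩
  · intro v
    refine ⟨M v, h.missing v, fun w hvw e => ?_⟩
    have := (hI.vertex v (M v) w).2 (by rw [hφ v w hvw, e])
    simp [h.free v] at this
  · intro v w hvw
    rw [← addr_colorOf, h.colorOf, hφ v w hvw, enc_some]
  · intro v w hvw
    rw [← addr_colorOf, h.colorOf, hnone v w hvw, enc_none]
  · intro v w hvw
    rw [← addr_vertexOf, h.vertexOf, (hI.vertex v _ w).2 (hφ v w hvw), enc_some]
  · intro v c hc
    rw [← addr_vertexOf, h.vertexOf, enc_eq_zero]
    cases hT : T v c with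
    | none => rfl
    | some w =>
      have hX := (hI.vertex v c w).1 hT
      have hvw := (hI.isSome v w).1 (by simp [hX])
      rw [hφ v w hvw] at hX
      exact absurd (Option.some.inj hX) (hc w hvw)
  · intro v w hvw
    obtain ⟨i, h1, h2, h3⟩ := h.neighbor v w hvw
    rw [addr_position] at h2
    rw [addr_neighbor] at h3
    rw [h2]
    exact ⟨h1, h3⟩

end EdgeColoringUpdate

namespace PRAM

/-! ### Conditions, and assignments to named cells -/

namespace Expr

/-- Nonzero iff `a < b`. -/
def lt (a b : Expr) : Expr := sub b a
/-- Nonzero iff both are. -/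
def and (a b : Expr) : Expr := ite a b (const 0)
/-- Nonzero iff one of the two is. -/
def or (a b : Expr) : Expr := add a b
/-- Nonzero iff the values differ. -/
def ne (a b : Expr) : Expr := add (sub a b) (sub b a)
/-- Nonzero iff `a` is zero. -/
def not (a : Expr) : Expr := ite a (const 0) (const 1)
/-- Nonzero iff the values agree. -/
def eq (a b : Expr) : Expr := not (ne a b)

variable (p : ℕ) (m : ℕ → ℕ) (a b c : Expr)

@[simp] theorem eval_const (k : ℕ) : (const k).eval p m = k := rfl
@[simp] theorem eval_pid : pid.eval p m = p := rfl
@[simp] theorem eval_load : (load a).eval p m = m (a.eval p m) := rfl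
@[simp] theorem eval_add : (add a b).eval p m = a.eval p m + b.eval p m := rfl
@[simp] theorem eval_sub : (sub a b).eval p m = a.eval p m - b.eval p m := rfl
@[simp] theorem eval_ite :
    (ite c a b).eval p m = if c.eval p m = 0 then b.eval p m else a.eval p m := rfl
@[simp] theorem eval_lt : (lt a b).eval p m = 0 ↔ b.eval p m ≤ a.eval p m := by
  simp [lt, Nat.sub_eq_zero_iff_le]
@[simp] theorem eval_and : (and a b).eval p m = 0 ↔ a.eval p m = 0 ∨ b.eval p m = 0 := by
  simp only [and, eval_ite, eval_const]; split_ifs <;> simp_all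
@[simp] theorem eval_or : (or a b).eval p m = 0 ↔ a.eval p m = 0 ∧ b.eval p m = 0 := by
  simp [or]
@[simp] theorem eval_ne : (ne a b).eval p m = 0 ↔ a.eval p m = b.eval p m := by
  simp only [ne, eval_add, eval_sub]; omega
@[simp] theorem eval_not : (not a).eval p m = 0 ↔ a.eval p m ≠ 0 := by
  simp [not]
@[simp] theorem eval_eq : (eq a b).eval p m = 0 ↔ a.eval p m ≠ b.eval p m := by
  simp [eq]

end Expr

variable {n D P : ℕ}

/-- On the memory `m`, the write `w` of all of `P` processors writes the pairs in `W` (a value for a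
named cell), and nothing else. -/
def Write.Emits (P : ℕ) (m : ℕ → ℕ) (w : Write) (W : Cell n D → ℕ → Prop) : Prop :=
  (∀ p : Fin P, w.guard.eval p m ≠ 0 →
    ∃ c v, W c v ∧ w.addr.eval p m = c.addr ∧ w.val.eval p m = v) ∧
  ∀ c v, W c v → ∃ p : Fin P, w.guard.eval p m ≠ 0 ∧ w.addr.eval p m = c.addr

/-- A synchronous assignment in terms of named cells: what is not written is unchanged. -/
theorem Written.read {l : List Write} {m m' : ℕ → ℕ} (h : Written P l m m')
    {Ws : List (Cell n D → ℕ → Prop)} (hl : List.Forall₂ (Write.Emits P m) l Ws) (c : Cell n D)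
    (hc : c ≠ .trash) :
    ((∀ W ∈ Ws, ∀ v, ¬ W c v) ∧ m' c.addr = m c.addr) ∨ ∃ W ∈ Ws, W c (m' c.addr) := by
  have h1 : ∀ (p : Fin P), ∀ w ∈ l, w.guard.eval p m ≠ 0 → ∃ W ∈ Ws, ∃ c v, W c v ∧
      w.addr.eval p m = c.addr ∧ w.val.eval p m = v := by
    clear h
    induction hl with
    | nil => simp
    | cons hw _ ih =>
      intro p w hmem hg
      rcases List.mem_cons.1 hmem with rfl | hmem
      · exact ⟨_, by simp, hw.1 p hg⟩
      · obtain ⟨W, hW, h⟩ := ih p w hmem hg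
        exact ⟨W, by simp [hW], h⟩
  have h2 : ∀ W ∈ Ws, ∀ c v, W c v →
      ∃ p : Fin P, ∃ w ∈ l, w.guard.eval p m ≠ 0 ∧ w.addr.eval p m = c.addr := by
    clear h h1
    induction hl with
    | nil => simp
    | cons hw _ ih =>
      intro W hmem c v hW
      rcases List.mem_cons.1 hmem with rfl | hmem
      · obtain ⟨p, hp⟩ := hw.2 c v hW
        exact ⟨p, _, by simp, hp⟩
      · obtain ⟨p, w, hw, hp⟩ := ih W hmem c v hW
        exact ⟨p, w, by simp [hw], hp⟩
  rcases h c.addr (fun e => hc (Cell.addr_injective e)) with ⟨h3, h4⟩ | ⟨p, w, hw, hg, ha, hv⟩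
  · refine .inl ⟨fun W hW v hWv => ?_, h4⟩
    obtain ⟨p, w, hw, hg, ha⟩ := h2 W hW c v hWv
    exact h3 p w hw hg ha
  · right
    obtain ⟨W, hW, c', v, hWv, ha', hv'⟩ := h1 p w hw hg
    obtain rfl := Cell.addr_injective (ha.symm.trans ha')
    exact ⟨W, hW, by rwa [hv, hv']⟩

/-- The write of every processor with a number below the value of `N` whose guard `g` is nonzero. -/
def Write.each (N g a v : Expr) : Write := ⟨.and (.lt .pid N) g, a, v⟩

theorem Write.emits_each {m : ℕ → ℕ} {N g a v : Expr} {k : ℕ} (hN : ∀ p, N.eval p m = k)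
    (hP : k ≤ P) (cond : Fin k → Prop) (cell : Fin k → Cell n D) (val : Fin k → ℕ)
    (hg : ∀ x : Fin k, g.eval x m ≠ 0 ↔ cond x)
    (h : ∀ x : Fin k, cond x → a.eval x m = (cell x).addr ∧ v.eval x m = val x) :
    (Write.each N g a v).Emits P m fun c y => ∃ x, cond x ∧ c = cell x ∧ y = val x := by
  constructor
  · intro p hp
    simp only [each, ne_eq, Expr.eval_and, Expr.eval_lt, hN, Expr.eval_pid, not_or, not_le] at hp
    have hc := (hg ⟨p, hp.1⟩).1 hp.2
    exact ⟨_, _, ⟨⟨p, hp.1⟩, hc, rfl, rfl⟩, h _ hc⟩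
  · rintro c y ⟨x, hc, rfl, rfl⟩
    refine ⟨⟨x, x.isLt.trans_le hP⟩, ?_, (h x hc).1⟩
    simpa [each, hN] using (hg x).2 hc

/-- The write of processor `0`. -/
def Write.solo (g a v : Expr) : Write := .each (.const 1) g a v

theorem Write.emits_solo {m : ℕ → ℕ} {g a v : Expr} (hP : 1 ≤ P) (cond : Prop) (cell : Cell n D)
    (val : ℕ) (hg : g.eval 0 m ≠ 0 ↔ cond)
    (h : cond → a.eval 0 m = cell.addr ∧ v.eval 0 m = val) :
    (Write.solo g a v).Emits P m fun c y => cond ∧ c = cell ∧ y = val := by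
  have := Write.emits_each (P := P) (m := m) (N := .const 1) (g := g) (a := a) (v := v) (k := 1)
    (fun _ => rfl) hP (fun _ => cond) (fun _ => cell) (fun _ => val)
    (fun x => by rw [Fin.fin_one_eq_zero x]; exact hg)
    (fun x => by rw [Fin.fin_one_eq_zero x]; exact h)
  simpa [solo] using this

end PRAM

namespace EdgeColoringUpdate

/-! ### Orbits of a map -/

section Orbits

variable {α : Type*} {f : α → α} {s : α}

/-- The points that iteration of `f` reaches from `s`. -/
def reach (f : α → α) (s : α) : Set α := {x | ∃ i, f^[i] s = x}

theorem self_mem_reach : s ∈ reach f s := ⟨0, rfl⟩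

theorem map_mem_reach {x : α} (h : x ∈ reach f s) : f x ∈ reach f s := by
  obtain ⟨i, rfl⟩ := h
  exact ⟨i + 1, Function.iterate_succ_apply' f i s⟩

theorem reach_induction {p : α → Prop} (h0 : p s) (h : ∀ x ∈ reach f s, p x → p (f x)) {x : α}
    (hx : x ∈ reach f s) : p x := by
  obtain ⟨i, rfl⟩ := hx
  induction i with
  | zero => exact h0
  | succ i ih =>
    rw [Function.iterate_succ_apply']
    exact h _ ⟨i, rfl⟩ ih

theorem exists_iterate_eq_of_fixed {t x : α} (ht : t ∈ reach f s) (hft : f t = t)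
    (hx : x ∈ reach f s) : ∃ l, f^[l] x = t := by
  obtain ⟨i, rfl⟩ := hx
  obtain ⟨l, rfl⟩ := ht
  refine ⟨l, ?_⟩
  rw [← Function.iterate_add_apply, add_comm, Function.iterate_add_apply,
    Function.iterate_fixed hft]

theorem fixed_unique {t t' : α} (ht : t ∈ reach f s) (hft : f t = t) (ht' : t' ∈ reach f s)
    (hft' : f t' = t') : t = t' := by
  obtain ⟨l, hl⟩ := exists_iterate_eq_of_fixed ht hft ht'
  rw [Function.iterate_fixed hft'] at hl
  exact hl.symm

/-- An orbit that ends in a fixed point `t` is a path: `f` is injective on it up to `t`. -/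
theorem eq_of_reach_fixed {t x y : α} (ht : t ∈ reach f s) (hft : f t = t) (hx : x ∈ reach f s)
    (hy : y ∈ reach f s) (hfx : f x ≠ x) (hfy : f y ≠ y) (hxy : f x = f y) : x = y := by
  -- if `y` comes after `x`, then it lies on the cycle through `f x`, which contains `t`
  have key : ∀ (x y : α) (k : ℕ), x ∈ reach f s → f y ≠ y → f x = f y → f^[k] x = y → x = y := by
    intro x y k hx hfy hxy hk
    cases k with
    | zero => exact hk
    | succ k =>
      exfalso
      have hper : f^[k + 1] (f x) = f x := by
        rw [← Function.iterate_succ_apply, Function.iterate_succ_apply', hk, hxy]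
      obtain ⟨l, hl⟩ := exists_iterate_eq_of_fixed ht hft (map_mem_reach hx)
      have h1 : f^[(k + 1) * l] (f x) = f x := by
        rw [Function.iterate_mul]
        exact Function.iterate_fixed hper l
      have h2 : f^[(k + 1) * l] (f x) = t := by
        rw [Nat.succ_mul, Function.iterate_add_apply, hl, Function.iterate_fixed hft]
      have h3 : f y = t := by rw [← hxy, ← h1, h2]
      rw [Function.iterate_succ_apply, hxy, h3, Function.iterate_fixed hft] at hk
      exact hfy (by rw [h3, hk])
  obtain ⟨i, rfl⟩ := hx
  obtain ⟨j, rfl⟩ := hy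
  rcases le_total i j with h | h
  · refine key _ _ (j - i) ⟨i, rfl⟩ hfy hxy ?_
    rw [← Function.iterate_add_apply, Nat.sub_add_cancel h]
  · refine (key _ _ (i - j) ⟨j, rfl⟩ hfx hxy.symm ?_).symm
    rw [← Function.iterate_add_apply, Nat.sub_add_cancel h]

/-- An orbit that does not return to its start either ends in a fixed point or runs into itself. -/
theorem exists_fixed_or_collision [Finite α] (hs : ∀ x, f x = s → f x = x) :
    (∃ t ∈ reach f s, f t = t) ∨
      ∃ x ∈ reach f s, ∃ y ∈ reach f s, f x ≠ x ∧ f y ≠ y ∧ x ≠ y ∧ f x = f y := by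
  by_contra! h
  obtain ⟨h1, h2⟩ := h
  let g : reach f s → reach f s := fun x => ⟨f x, map_mem_reach x.2⟩
  have hg : Function.Injective g := by
    intro x y hxy
    by_contra hne
    exact h2 x x.2 y y.2 (h1 x x.2) (h1 y y.2) (fun e => hne (Subtype.ext e))
      (congrArg Subtype.val hxy)
  obtain ⟨x, hx⟩ := Finite.surjective_of_injective hg ⟨s, self_mem_reach⟩
  exact h1 x x.2 (hs x (congrArg Subtype.val hx))

/-- An orbit in a set of `N` numbers is complete after `N` steps. -/
theorem exists_iterate_lt {f : ℕ → ℕ} {N s : ℕ} (hf : ∀ x < N, f x < N) (hs : s < N) (i : ℕ) :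
    ∃ j < N, f^[j] s = f^[i] s := by
  have hmem : ∀ i, f^[i] s < N := fun i => by
    induction i with
    | zero => exact hs
    | succ i ih => rw [Function.iterate_succ_apply']; exact hf _ ih
  have hex : ∃ j, f^[j] s = f^[i] s := ⟨i, rfl⟩
  classical
  refine ⟨Nat.find hex, ?_, Nat.find_spec hex⟩
  by_contra! hN
  obtain ⟨a, ha, b, hb, hab, he⟩ := Finset.exists_ne_map_eq_of_card_lt_of_maps_to
    (s := Finset.range (N + 1)) (t := Finset.range N) (f := fun i => f^[i] s) (by simp)
    (fun i _ => by simpa using hmem i)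
  simp only [Finset.mem_range] at ha hb
  have key : ∀ a b, a < b → b < N + 1 → f^[a] s = f^[b] s → False := by
    intro a b hab hb he
    refine Nat.find_min hex (m := Nat.find hex - b + a) (by omega) ?_
    rw [Function.iterate_add_apply, he, ← Function.iterate_add_apply,
      Nat.sub_add_cancel (by omega)]
    exact Nat.find_spec hex
  rcases lt_or_gt_of_ne hab with h | h
  · exact key a b h hb he
  · exact key b a h ha he.symm

theorem reach_map {β : Type*} {g : β → β} {e : α → β} (h : ∀ x, g (e x) = e (f x)) :
    reach g (e s) = e '' reach f s := by
  have hi : ∀ i, g^[i] (e s) = e (f^[i] s) := by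
    intro i
    induction i with
    | zero => rfl
    | succ i ih => rw [Function.iterate_succ_apply', Function.iterate_succ_apply', ih, h]
  ext y
  constructor
  · rintro ⟨i, rfl⟩
    exact ⟨_, ⟨i, rfl⟩, (hi i).symm⟩
  · rintro ⟨_, ⟨i, rfl⟩, rfl⟩
    exact ⟨i, hi i⟩

end Orbits

variable {n D : ℕ} {G : SimpleGraph (Fin n)} {X : Fin n → Fin n → Option (Fin (D + 1))}
  {T : Fin n → Fin (D + 1) → Option (Fin n)} {M : Fin n → Fin (D + 1)}

namespace IsColoring

theorem vertex_symm (h : IsColoring G X T) {x y : Fin n} {c : Fin (D + 1)} (hx : T x c = some y) :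
    T y c = some x := by
  rw [h.vertex] at hx ⊢
  rwa [h.symm]

theorem color_self (h : IsColoring G X T) (x : Fin n) : X x x = none := by
  simpa using mt (h.isSome x x).1 (G.irrefl (v := x))

theorem color_eq_none (h : IsColoring G X T) {x y : Fin n} (hxy : ¬ G.Adj x y) : X x y = none := by
  simpa using mt (h.isSome x y).1 hxy

end IsColoring

/-! ### Vizing fans -/

/-- The next vertex of the Vizing fan at `u`: the neighbor of `u` along the edge that has the color
missing at `x`. The fan ends, in a fixed point, where this color is missing at `u` too. -/
def fan (T : Fin n → Fin (D + 1) → Option (Fin n)) (M : Fin n → Fin (D + 1)) (u x : Fin n) :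
    Fin n :=
  (T u (M x)).getD x

theorem fan_eq_self_iff (h : IsColoring G X T) (hM : ∀ x, T x (M x) = none) {u x : Fin n} :
    fan T M u x = x ↔ T u (M x) = none := by
  constructor
  · intro h1
    cases h2 : T u (M x) with
    | none => rfl
    | some y =>
      obtain rfl : y = x := by simpa [fan, h2] using h1
      have := hM y
      rw [h.vertex_symm h2] at this
      simp at this
  · intro h1
    simp [fan, h1]

theorem fan_of_ne {u x : Fin n} (h : fan T M u x ≠ x) : T u (M x) = some (fan T M u x) := by
  cases h2 : T u (M x) with
  | none => simp [fan, h2] at h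
  | some y => simp [fan, h2]

/-- Either the fan ends, or it runs into itself, and the two vertices before the same vertex of the
fan have the same missing color. -/
theorem fan_fixed_or_collision (h : IsColoring G X T) {u v : Fin n} (huv : ¬ G.Adj u v) :
    (∃ t ∈ reach (fan T M u) v, fan T M u t = t) ∨
      ∃ x ∈ reach (fan T M u) v, ∃ y ∈ reach (fan T M u) v,
        fan T M u x ≠ x ∧ fan T M u y ≠ y ∧ x ≠ y ∧ fan T M u x = fan T M u y := by
  refine exists_fixed_or_collision fun x hx => ?_
  by_contra hne
  have := fan_of_ne hne
  rw [hx, h.vertex, h.color_eq_none huv] at this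
  simp at this

theorem missing_eq_of_fan_eq (h : IsColoring G X T) {u x y : Fin n} (hx : fan T M u x ≠ x)
    (hy : fan T M u y ≠ y) (hxy : fan T M u x = fan T M u y) : M x = M y := by
  have h1 := fan_of_ne hx
  have h2 := fan_of_ne hy
  rw [h.vertex] at h1 h2
  rw [hxy, h2] at h1
  exact (Option.some.inj h1).symm

/-! ### Kempe chains -/

/-- The walk along the edges of the colors `d` and `a` in turn; the Boolean tells whether the next
color is `a`. -/
def kempe (T : Fin n → Fin (D + 1) → Option (Fin n)) (a d : Fin (D + 1)) (s : Fin n × Bool) :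
    Fin n × Bool :=
  (T s.1 (bif s.2 then a else d)).elim s fun y => (y, !s.2)

/-- The vertices of the Kempe chain that starts at `u` with color `d`. -/
def chain (T : Fin n → Fin (D + 1) → Option (Fin n)) (a d : Fin (D + 1)) (u : Fin n) :
    Set (Fin n) :=
  {x | ∃ b, (x, b) ∈ reach (kempe T a d) (u, false)}

theorem kempe_back (h : IsColoring G X T) {a d : Fin (D + 1)} {u : Fin n} {s : Fin n × Bool}
    (hs : s ∈ reach (kempe T a d) (u, false)) :
    s = (u, false) ∨ ∃ x ∈ chain T a d u, T s.1 (bif s.2 then d else a) = some x := by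
  refine reach_induction (p := fun s => s = (u, false) ∨ ∃ x ∈ chain T a d u,
    T s.1 (bif s.2 then d else a) = some x) (.inl rfl) (fun s hs ih => ?_) hs
  obtain ⟨x, b⟩ := s
  cases hT : T x (bif b then a else d) with
  | none => simpa [kempe, hT] using ih
  | some y =>
    right
    refine ⟨x, ⟨b, hs⟩, ?_⟩
    rw [← h.vertex_symm hT]
    cases b <;> simp_all [kempe]

theorem chain_closed (h : IsColoring G X T) {a d : Fin (D + 1)} {u x y : Fin n}
    (ha : T u a = none) (hx : x ∈ chain T a d u) {c : Fin (D + 1)} (hc : c = a ∨ c = d)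
    (hxy : T x c = some y) : y ∈ chain T a d u := by
  obtain ⟨b, hb⟩ := hx
  by_cases hcb : c = bif b then a else d
  · have := map_mem_reach hb
    rw [hcb] at hxy
    simp only [kempe, hxy, Option.elim_some] at this
    exact ⟨_, this⟩
  · rcases kempe_back h hb with h1 | ⟨z, hz, h1⟩
    · simp only [Prod.mk.injEq] at h1
      obtain ⟨rfl, rfl⟩ := h1
      simp_all
    · have : c = bif b then d else a := by
        cases b <;> simp_all
      rw [this, h1] at hxy
      rwa [← Option.some.inj hxy]

theorem start_mem_chain {a d : Fin (D + 1)} {u : Fin n} : u ∈ chain T a d u :=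
  ⟨false, self_mem_reach⟩

/-- A Kempe chain has at most one end at which the color `d` is missing. -/
theorem chain_end_unique (h : IsColoring G X T) {a d : Fin (D + 1)} {u x y : Fin n}
    (hx : x ∈ chain T a d u) (hy : y ∈ chain T a d u) (hxd : T x d = none) (hyd : T y d = none) :
    x = y := by
  have key : ∀ x ∈ chain T a d u, T x d = none →
      (x, false) ∈ reach (kempe T a d) (u, false) ∧ kempe T a d (x, false) = (x, false) := by
    rintro x ⟨b, hb⟩ hxd
    have : b = false := by
      rcases kempe_back h hb with h1 | ⟨z, -, h1⟩
      · exact (Prod.mk.inj h1).2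
      · cases b <;> simp_all
    subst this
    exact ⟨hb, by simp [kempe, hxd]⟩
  have h1 := fixed_unique (key x hx hxd).1 (key x hx hxd).2 (key y hy hyd).1 (key y hy hyd).2
  exact (Prod.mk.inj h1).1

/-! ### The exchange of two colors on a Kempe chain -/

section Flip

open Classical in
/-- The edge colors after an exchange of the colors `a` and `d` at the vertices of `K`. -/
noncomputable def flipColor (K : Set (Fin n)) (a d : Fin (D + 1))
    (X : Fin n → Fin n → Option (Fin (D + 1))) (x y : Fin n) : Option (Fin (D + 1)) :=
  if x ∈ K then (X x y).map (Equiv.swap a d) else X x y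

open Classical in
/-- The table of edges after an exchange of the colors `a` and `d` at the vertices of `K`. -/
noncomputable def flipVertex (K : Set (Fin n)) (a d : Fin (D + 1))
    (T : Fin n → Fin (D + 1) → Option (Fin n)) (x : Fin n) (c : Fin (D + 1)) : Option (Fin n) :=
  if x ∈ K then T x (Equiv.swap a d c) else T x c

open Classical in
/-- The missing colors after an exchange of the colors `a` and `d` at the vertices of `K`. -/
noncomputable def flipMissing (K : Set (Fin n)) (a d : Fin (D + 1)) (M : Fin n → Fin (D + 1))
    (x : Fin n) : Fin (D + 1) :=
  if x ∈ K then Equiv.swap a d (M x) else M x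

variable {K : Set (Fin n)} {a d : Fin (D + 1)}

theorem IsColoring.flip (h : IsColoring G X T)
    (hK : ∀ x ∈ K, ∀ c y, c = a ∨ c = d → T x c = some y → y ∈ K) :
    IsColoring G (flipColor K a d X) (flipVertex K a d T) := by
  refine ⟨fun v w => ?_, fun v w => ?_, fun v c w => ?_⟩
  · have key : ∀ v w, v ∈ K → w ∉ K → (X v w).map (Equiv.swap a d) = X w v := by
      intro v w hv hw
      rw [h.symm w v]
      cases hc : X v w with
      | none => rfl
      | some c =>
        have h1 : ¬ (c = a ∨ c = d) := fun h1 => hw (hK v hv c w h1 ((h.vertex _ _ _).2 hc))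
        push Not at h1
        simp [Equiv.swap_apply_of_ne_of_ne h1.1 h1.2]
    by_cases hv : v ∈ K <;> by_cases hw : w ∈ K <;> simp only [flipColor, hv, hw, if_true, if_false]
    · rw [h.symm]
    · exact key v w hv hw
    · exact (key w v hw hv).symm
    · exact h.symm v w
  · rw [← h.isSome]
    by_cases hv : v ∈ K <;> simp [flipColor, hv]
  · by_cases hv : v ∈ K
    · simp only [flipVertex, flipColor, hv, if_true, h.vertex, Option.map_eq_some_iff]
      constructor
      · exact fun h1 => ⟨_, h1, Equiv.swap_apply_self a d c⟩
      · rintro ⟨c', h1, rfl⟩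
        simpa using h1
    · simp only [flipVertex, flipColor, hv, if_false, h.vertex]

theorem flip_free (hM : ∀ x, T x (M x) = none) (x : Fin n) :
    flipVertex K a d T x (flipMissing K a d M x) = none := by
  by_cases hx : x ∈ K <;> simp [flipVertex, flipMissing, hx, hM]

/-- After the Kempe chain of `u` is flipped, where `d` is the color that is missing at two vertices
`x` and `y` of the fan, the fan ends: one of `x` and `y` is outside of the chain, and there the fan
stops, if it has not stopped before; elsewhere it is what it was. -/
theorem fan_flip_fixed (h : IsColoring G X T) (hM : ∀ x, T x (M x) = none) {u v x y : Fin n}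
    (hx : x ∈ reach (fan T M u) v) (hy : y ∈ reach (fan T M u) v) (hfx : fan T M u x ≠ x)
    (hfy : fan T M u y ≠ y) (hne : x ≠ y) (hxy : fan T M u x = fan T M u y) :
    ∃ t ∈ reach (fan (flipVertex (chain T (M u) (M x) u) (M u) (M x) T)
        (flipMissing (chain T (M u) (M x) u) (M u) (M x) M) u) v,
      fan (flipVertex (chain T (M u) (M x) u) (M u) (M x) T)
        (flipMissing (chain T (M u) (M x) u) (M u) (M x) M) u t = t := by
  set K := chain T (M u) (M x) u with hK
  have huK : u ∈ K := start_mem_chain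
  set F := fan T M u with hF
  set F' := fan (flipVertex K (M u) (M x) T) (flipMissing K (M u) (M x) M) u with hF'
  have hMxy : M x = M y := missing_eq_of_fan_eq h hfx hfy hxy
  -- the old fan has no end
  have hend : ∀ z ∈ reach F v, F z ≠ z := fun z hz hfz =>
    hne (eq_of_reach_fixed hz hfz hx hy hfx hfy hxy)
  -- the new fan agrees with the old one, except where it ends
  have hstep : ∀ z ∈ reach F v, F' z = F z ∨ F' z = z := by
    intro z hz
    have hza : M z ≠ M u := fun e => hend z hz ((fan_eq_self_iff h hM).2 (by rw [e, hM]))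
    by_cases hzK : z ∈ K
    · left
      simp [hF', hF, fan, flipVertex, flipMissing, huK, hzK]
    · by_cases hzd : M z = M x
      · right
        simp [hF', fan, flipVertex, flipMissing, huK, hzK, hzd, hM]
      · left
        simp [hF', hF, fan, flipVertex, flipMissing, huK, hzK,
          Equiv.swap_apply_of_ne_of_ne hza hzd]
  by_contra! hno
  have hiter : ∀ i, F'^[i] v = F^[i] v := by
    intro i
    induction i with
    | zero => rfl
    | succ i ih =>
      rw [Function.iterate_succ_apply', Function.iterate_succ_apply']
      rcases hstep _ ⟨i, rfl⟩ with h1 | h1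
      · rw [ih, h1]
      · exact absurd h1 (by rw [← ih]; exact hno _ ⟨i, rfl⟩)
  have hinK : ∀ z ∈ reach F v, M z = M x → z ∈ K := by
    rintro z ⟨i, rfl⟩ hzd
    by_contra hzK
    apply hno (F'^[i] v) ⟨i, rfl⟩
    rw [hiter]
    simp [hF', fan, flipVertex, flipMissing, huK, hzK, hzd, hM]
  exact hne (chain_end_unique h (hinK x hx rfl) (hinK y hy hMxy.symm) (hM x)
    (by rw [hMxy]; exact hM y))

end Flip

/-! ### The shift of the colors along a fan -/

section Rotate

open Classical in
/-- The edge colors after the edges from `u` to the vertices of `R` get the colors missing there. -/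
noncomputable def rotateColor (R : Set (Fin n)) (u : Fin n) (M : Fin n → Fin (D + 1))
    (X : Fin n → Fin n → Option (Fin (D + 1))) (x y : Fin n) : Option (Fin (D + 1)) :=
  if x = u ∧ y ∈ R then some (M y) else if y = u ∧ x ∈ R then some (M x) else X x y

theorem notMem_fan (h : IsColoring G X T) {u v : Fin n} (huv : u ≠ v) :
    u ∉ reach (fan T M u) v := by
  intro hu
  refine absurd rfl (reach_induction (p := fun x => x ≠ u) huv.symm (fun x _ hx e => ?_) hu)
  have := fan_of_ne (T := T) (M := M) (u := u) (x := x) (by rw [e]; exact hx.symm)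
  rw [e, h.vertex, h.color_self] at this
  simp at this

theorem mem_fan_adj (h : IsColoring G X T) {u v x : Fin n} (hx : x ∈ reach (fan T M u) v) :
    x = v ∨ G.Adj u x := by
  refine reach_induction (p := fun x => x = v ∨ G.Adj u x) (.inl rfl) (fun x _ hx => ?_) hx
  by_cases hfx : fan T M u x = x
  · rwa [hfx]
  · right
    rw [← h.isSome, (h.vertex _ _ _).1 (fan_of_ne hfx)]
    rfl

/-- The colors missing along a fan that ends are distinct. -/
theorem missing_injOn_fan (h : IsColoring G X T) (hM : ∀ x, T x (M x) = none) {u v t x y : Fin n}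
    (ht : t ∈ reach (fan T M u) v) (hft : fan T M u t = t) (hx : x ∈ reach (fan T M u) v)
    (hy : y ∈ reach (fan T M u) v) (hxy : M x = M y) : x = y := by
  have hiff : fan T M u x = x ↔ fan T M u y = y := by
    rw [fan_eq_self_iff h hM, fan_eq_self_iff h hM, hxy]
  by_cases hfx : fan T M u x = x
  · exact fixed_unique hx hfx hy (hiff.1 hfx)
  · have hfy := mt hiff.2 hfx
    refine eq_of_reach_fixed ht hft hx hy hfx hfy ?_
    have h1 := fan_of_ne hfx
    rw [hxy, fan_of_ne hfy] at h1
    exact (Option.some.inj h1).symm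

/-- The color of an edge from `u` to a vertex outside of the fan is not missing on the fan. -/
theorem mem_fan_of_missing (h : IsColoring G X T) {u v x z : Fin n}
    (hx : x ∈ reach (fan T M u) v) (hz : X u z = some (M x)) : z ∈ reach (fan T M u) v := by
  have := map_mem_reach hx
  rwa [fan, (h.vertex _ _ _).2 hz, Option.getD_some] at this

/-- Shifting the colors along a fan that ends makes room for the new edge. -/
theorem exists_rotate (h : IsColoring G X T) (hM : ∀ x, T x (M x) = none) {u v t : Fin n}
    (huv : u ≠ v) (hadj : ¬ G.Adj u v) {R : Set (Fin n)} (hR : R = reach (fan T M u) v)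
    (ht : t ∈ R) (hft : fan T M u t = t) :
    ∃ T', IsColoring (G ⊔ SimpleGraph.edge u v) (rotateColor R u M X) T' ∧
      (∀ x ∈ R, T' u (M x) = some x) ∧ (∀ c, (∀ x ∈ R, M x ≠ c) → T' u c = T u c) ∧
      (∀ x ∈ R, T' x (M x) = some u) ∧ (∀ x ∈ R, ∀ c, X u x = some c → T' x c = none) ∧
      (∀ x ∈ R, ∀ c, c ≠ M x → X u x ≠ some c → T' x c = T x c) ∧
      ∀ x ∉ R, x ≠ u → T' x = T x := by
  subst hR
  set R := reach (fan T M u) v with hR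
  have huR : u ∉ R := notMem_fan h huv
  have hinj : ∀ x ∈ R, ∀ y ∈ R, M x = M y → x = y := fun x hx y hy =>
    missing_injOn_fan h hM ht hft hx hy
  have hXM : ∀ x y, X x y ≠ some (M x) := fun x y e => by
    have := hM x
    rw [(h.vertex _ _ _).2 e] at this
    simp at this
  have hXp : ∀ v w w' c, X v w = some c → X v w' = some c → w = w' := fun v w w' c h1 h2 => by
    rw [← h.vertex] at h1 h2
    exact Option.some.inj (h1.symm.trans h2)
  -- the rows of the new table of colors
  have hu1 : ∀ y ∈ R, rotateColor R u M X u y = some (M y) := fun y hy => by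
    simp [rotateColor, hy]
  have hu2 : ∀ y ∉ R, rotateColor R u M X u y = X u y := fun y hy => by
    simp [rotateColor, hy, huR]
  have hr1 : ∀ x ∈ R, rotateColor R u M X x u = some (M x) := fun x hx => by
    simp [rotateColor, hx, huR]
  have hr2 : ∀ x y, x ≠ u → y ≠ u → rotateColor R u M X x y = X x y := fun x y hx hy => by
    simp [rotateColor, hx, hy]
  have hr3 : ∀ x y, x ∉ R → x ≠ u → rotateColor R u M X x y = X x y := fun x y hx hy => by
    simp [rotateColor, hx, hy]
  have hsymm : ∀ x y, rotateColor R u M X x y = rotateColor R u M X y x := by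
    intro x y
    simp only [rotateColor]
    by_cases h1 : x = u ∧ y ∈ R
    · rw [if_pos h1, if_neg (fun h2 : y = u ∧ x ∈ R => huR (h2.1 ▸ h1.2)), if_pos h1]
    · by_cases h2 : y = u ∧ x ∈ R
      · rw [if_neg h1, if_pos h2, if_pos h2]
      · rw [if_neg h1, if_neg h2, if_neg h2, if_neg h1, h.symm]
  obtain ⟨T', hT'⟩ : ∃ T', IsColoring (G ⊔ SimpleGraph.edge u v) (rotateColor R u M X) T' := by
    refine exists_isColoring hsymm (fun x y => ?_) (fun x y y' c h1 h2 => ?_)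
    · have hiff : ∀ y ∈ R, (G ⊔ SimpleGraph.edge u v).Adj u y := by
        intro y hy
        rw [SimpleGraph.sup_adj, SimpleGraph.edge_adj]
        rcases mem_fan_adj h hy with rfl | hy
        · exact .inr ⟨.inl ⟨rfl, rfl⟩, huv⟩
        · exact .inl hy
      by_cases h1 : x = u ∧ y ∈ R
      · obtain ⟨rfl, hy⟩ := h1
        simp [hu1 y hy, hiff y hy]
      · by_cases h2 : y = u ∧ x ∈ R
        · obtain ⟨rfl, hx⟩ := h2
          simp [hr1 x hx, (hiff x hx).symm]
        · rw [rotateColor, if_neg h1, if_neg h2, h.isSome, SimpleGraph.sup_adj,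
            SimpleGraph.edge_adj]
          refine ⟨.inl, ?_⟩
          have hvR : v ∈ R := self_mem_reach
          rintro (h3 | ⟨⟨rfl, rfl⟩ | ⟨rfl, rfl⟩, -⟩)
          · exact h3
          · exact absurd ⟨rfl, hvR⟩ h1
          · exact absurd ⟨rfl, hvR⟩ h2
    · by_cases hxu : x = u
      · subst hxu
        have key : ∀ y ∈ R, ∀ z ∉ R, rotateColor R x M X x y = some c →
            rotateColor R x M X x z ≠ some c := by
          intro y hy z hz h1 h2
          rw [hu1 y hy] at h1
          rw [hu2 z hz, ← h1] at h2
          exact hz (mem_fan_of_missing h hy h2)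
        by_cases hy : y ∈ R <;> by_cases hy' : y' ∈ R
        · rw [hu1 _ hy] at h1
          rw [hu1 _ hy'] at h2
          exact hinj y hy y' hy' (by rw [← h2] at h1; exact Option.some.inj h1)
        · exact absurd h2 (key y hy y' hy' h1)
        · exact absurd h1 (key y' hy' y hy h2)
        · rw [hu2 _ hy] at h1
          rw [hu2 _ hy'] at h2
          exact hXp _ _ _ _ h1 h2
      · by_cases hx : x ∈ R
        · by_cases hy : y = u <;> by_cases hy' : y' = u
          · rw [hy, hy']
          · subst hy
            rw [hr1 x hx] at h1
            rw [hr2 x y' hxu hy', ← h1] at h2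
            exact absurd h2 (hXM _ _)
          · subst hy'
            rw [hr1 x hx] at h2
            rw [hr2 x y hxu hy, ← h2] at h1
            exact absurd h1 (hXM _ _)
          · rw [hr2 x y hxu hy] at h1
            rw [hr2 x y' hxu hy'] at h2
            exact hXp _ _ _ _ h1 h2
        · rw [hr3 x y hx hxu] at h1
          rw [hr3 x y' hx hxu] at h2
          exact hXp _ _ _ _ h1 h2
  have hsame : ∀ x c, (∀ y, rotateColor R u M X x y = some c ↔ X x y = some c) →
      T' x c = T x c := fun x c hc => Option.ext fun y => by
    rw [hT'.vertex, h.vertex, hc]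
  refine ⟨T', hT', fun x hx => ?_, fun c hc => ?_, fun x hx => ?_, fun x hx c hc => ?_,
    fun x hx c hc hc' => ?_, fun x hx hxu => ?_⟩
  · rw [hT'.vertex, hu1 x hx]
  · refine hsame u c fun y => ?_
    by_cases hy : y ∈ R
    · rw [hu1 y hy]
      have h1 : some (M y) ≠ some c := fun e => hc y hy (Option.some.inj e)
      refine iff_of_false h1 fun h2 => ?_
      -- an edge from `u` into the fan has the color missing at the predecessor
      have : y = v ∨ ∃ x ∈ R, X u y = some (M x) := by
        refine reach_induction (p := fun y => y = v ∨ ∃ x ∈ R, X u y = some (M x)) (.inl rfl)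
          (fun z hz hz' => ?_) hy
        by_cases hfz : fan T M u z = z
        · rwa [hfz]
        · exact .inr ⟨z, hz, (h.vertex _ _ _).1 (fan_of_ne hfz)⟩
      rcases this with rfl | ⟨x, hx, h3⟩
      · simp [h.color_eq_none hadj] at h2
      · rw [h3] at h2
        exact hc x hx (Option.some.inj h2)
    · rw [hu2 y hy]
  · rw [hT'.vertex, hr1 x hx]
  · cases hT : T' x c with
    | none => rfl
    | some y =>
      exfalso
      rw [hT'.vertex] at hT
      have hxu : x ≠ u := fun e => huR (e ▸ hx)
      by_cases hy : y = u
      · subst hy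
        rw [hr1 x hx] at hT
        rw [← hT, h.symm] at hc
        exact hXM _ _ hc
      · rw [hr2 x y hxu hy] at hT
        rw [h.symm] at hc
        exact hy (hXp _ _ _ _ hT hc)
  · have hxu : x ≠ u := fun e => huR (e ▸ hx)
    refine hsame x c fun y => ?_
    by_cases hy : y = u
    · subst hy
      rw [hr1 x hx, h.symm x]
      exact iff_of_false (fun e => hc (Option.some.inj e).symm) hc'
    · rw [hr2 x y hxu hy]
  · funext c
    exact hsame x c fun y => by rw [hr3 x y hx hxu]

end Rotate

/-! ### Private cells of subroutines -/

variable {n D P b : ℕ}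

/-- The cells that a subroutine with scratch space from `k` on may use. -/
def Cell.Private (k : ℕ) : Cell n D → Prop
  | trash => True
  | scratch i => k ≤ i
  | _ => False

variable (n D) in
/-- Only private cells have changed. Outside of the workspace, this is the cell for the writes whose
guard is zero. -/
def Frame (k : ℕ) (m m' : ℕ → ℕ) : Prop :=
  ∀ c : Cell n D, ¬ c.Private k → m' c.addr = m c.addr

theorem Frame.trans {k : ℕ} {m m' m'' : ℕ → ℕ} (h : Frame n D k m m') (h' : Frame n D k m' m'') :
    Frame n D k m m'' := fun c hc => (h' c hc).trans (h c hc)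

theorem Frame.mono {k k' : ℕ} {m m' : ℕ → ℕ} (h : Frame n D k' m m') (hk : k ≤ k') :
    Frame n D k m m' := fun c hc => h c fun hc' => hc (by
  cases c <;> simp only [Cell.Private] at hc' ⊢
  exact hk.trans hc')

theorem Frame.refl (k : ℕ) (m : ℕ → ℕ) : Frame n D k m m := fun _ _ => rfl

theorem Header.congr {m m' : ℕ → ℕ} (h : Header n D m)
    (h0 : m' (Cell.size : Cell n D).addr = m (Cell.size : Cell n D).addr)
    (h1 : m' (Cell.bound : Cell n D).addr = m (Cell.bound : Cell n D).addr)
    (h4 : m' (Cell.work : Cell n D).addr = m (Cell.work : Cell n D).addr)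
    (hp : ∀ v : Fin n, m' (Cell.pointer v : Cell n D).addr =
      m (Cell.pointer v : Cell n D).addr) : Header n D m' :=
  ⟨h0.trans h.size, h1.trans h.bound, h4.trans h.work, fun v => (hp v).trans (h.pointer v)⟩

theorem Frame.header {k : ℕ} {m m' : ℕ → ℕ} (h : Frame n D k m m') (hH : Header n D m) :
    Header n D m' :=
  hH.congr (h .size id) (h .bound id) (h .work id) fun v => h (.pointer v) id

theorem HoldsTables.congr {m m' : ℕ → ℕ} {G : SimpleGraph (Fin n)}
    {X : Fin n → Fin n → Option (Fin (D + 1))} {T : Fin n → Fin (D + 1) → Option (Fin n)}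
    (hm : HoldsTables m G X T) (hH : Header n D m')
    (he : ∀ (v : Fin n) (f : Field n D), f ≠ .missing →
      m' (Cell.entry v f).addr = m (Cell.entry v f).addr) : HoldsTables m' G X T := by
  refine ⟨hH, hm.isColoring, ?_, ?_, ?_, ?_⟩
  · intro v w; rw [he _ _ (by simp), hm.colorOf]
  · intro v c; rw [he _ _ (by simp), hm.vertexOf]
  · intro v; rw [he _ _ (by simp), hm.degree]
  · intro v w hvw
    obtain ⟨i, h1, h2, h3⟩ := hm.neighbor v w hvw
    exact ⟨i, h1, by rw [he _ _ (by simp), h2], by rw [he _ _ (by simp), h3]⟩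

theorem Holds.congr {m m' : ℕ → ℕ} {G : SimpleGraph (Fin n)}
    {X : Fin n → Fin n → Option (Fin (D + 1))} {T : Fin n → Fin (D + 1) → Option (Fin n)}
    {M : Fin n → Fin (D + 1)} (hm : Holds m G X T M) (hH : Header n D m')
    (he : ∀ (v : Fin n) (f : Field n D), m' (Cell.entry v f).addr = m (Cell.entry v f).addr) :
    Holds m' G X T M :=
  ⟨hm.toHoldsTables.congr hH fun v f _ => he v f, fun v => by rw [he, hm.missing], hm.free⟩

theorem Frame.holds {k : ℕ} {m m' : ℕ → ℕ} (h : Frame n D k m m') {G : SimpleGraph (Fin n)}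
    {X : Fin n → Fin n → Option (Fin (D + 1))} {T : Fin n → Fin (D + 1) → Option (Fin n)}
    {M : Fin n → Fin (D + 1)} (hm : Holds m G X T M) : Holds m' G X T M :=
  hm.congr (h.header hm.header) fun _ _ => h _ id

/-! ### Expressions for the cells -/

open Expr

/-- The number of vertices. -/
def sizeE : Expr := load (const 0)
/-- The pointer to the block of a vertex. -/
def pointerE (v : Expr) : Expr := load (add (const 5) v)
/-- The address of the missing color of a vertex. -/
def missingA (v : Expr) : Expr := pointerE v
/-- The address of the degree of a vertex. -/
def degreeA (v : Expr) : Expr := add (pointerE v) (const 1)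
/-- The address of the edge at `v` with the color that is stored as `k`. -/
def vertexA (v k : Expr) : Expr := add (add (pointerE v) (const 1)) k
/-- The address of the color of the edge from `v` to `w`. -/
def colorA (v w : Expr) : Expr := add (add (add (pointerE v) (const 3)) (load (const 1))) w
/-- The address of the position of `w` in the adjacency list of `v`. -/
def positionA (v w : Expr) : Expr :=
  add (add (add (add (pointerE v) (const 3)) (load (const 1))) sizeE) w
/-- The address of entry `i` of the adjacency list of `v`. -/
def neighborA (v i : Expr) : Expr :=
  add (add (add (add (add (pointerE v) (const 3)) (load (const 1))) sizeE) sizeE) i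
/-- The address of cell `i` of the scratch space; the base cell points to its first cell. -/
def scratchA (i : Expr) : Expr := add (load (const 2)) i
/-- An endpoint of the edge to be inserted. -/
def uE : Expr := load (scratchA (const 0))
/-- The other endpoint of the edge to be inserted. -/
def vE : Expr := load (scratchA (const 1))
/-- The address of the color of the Kempe chain. -/
def chainColorA : Expr := scratchA (const 4)
/-- The address of the length of the jumps, in pointer jumping. -/
def jumpA : Expr := scratchA (const 5)
/-- Twice the number of vertices. -/
def sizeTwiceE : Expr := add sizeE sizeE
/-- The address of the mark of state `j`. -/
def markA (j : Expr) : Expr := scratchA (add (const 6) j)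
/-- The address of the successor of state `j`. -/
def nextA (j : Expr) : Expr := scratchA (add (add (const 6) sizeTwiceE) j)
/-- The address of the predecessor of state `j`. -/
def predA (j : Expr) : Expr := scratchA (add (add (add (const 6) sizeTwiceE) sizeTwiceE) j)

/-- The scratch cell for the mark of state `j`. -/
def markCell (n D b j : ℕ) : Cell n D := .scratch (b + 6 + j)
/-- The scratch cell for the successor of state `j`. -/
def nextCell (n D b j : ℕ) : Cell n D := .scratch (b + 6 + 2 * n + j)
/-- The scratch cell for the predecessor of state `j`. -/
def predCell (n D b j : ℕ) : Cell n D := .scratch (b + 6 + 4 * n + j)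

section Eval

variable {m : ℕ → ℕ} {p : ℕ} {v w k i : Expr}

theorem Header.eval_sizeE (h : Header n D m) : sizeE.eval p m = n := h.size

theorem Header.eval_sizeTwiceE (h : Header n D m) : sizeTwiceE.eval p m = 2 * n := by
  simp only [sizeTwiceE, eval_add, h.eval_sizeE]; omega

theorem Header.eval_pointerE (h : Header n D m) {x : Fin n} (hv : v.eval p m = x) :
    (pointerE v).eval p m = block n D x := by
  have := h.pointer x
  simpa [pointerE, hv, Cell.addr] using this

theorem Header.eval_missingA (h : Header n D m) {x : Fin n} (hv : v.eval p m = x) :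
    (missingA v).eval p m = (Cell.entry x .missing : Cell n D).addr :=
  h.eval_pointerE hv

theorem Header.eval_degreeA (h : Header n D m) {x : Fin n} (hv : v.eval p m = x) :
    (degreeA v).eval p m = (Cell.entry x .degree : Cell n D).addr := by
  simp only [degreeA, eval_add, h.eval_pointerE hv, eval_const, Cell.addr, Field.offset]

theorem Header.eval_vertexA (h : Header n D m) {x : Fin n} {c : Fin (D + 1)} (hv : v.eval p m = x)
    (hk : k.eval p m = c + 1) :
    (vertexA v k).eval p m = (Cell.entry x (.vertexOf c) : Cell n D).addr := by
  simp only [vertexA, eval_add, h.eval_pointerE hv, eval_const, hk, Cell.addr, Field.offset]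
  omega

theorem Header.eval_bound (h : Header n D m) : m 1 = D := h.bound

theorem Header.eval_colorA (h : Header n D m) {x y : Fin n} (hv : v.eval p m = x)
    (hw : w.eval p m = y) :
    (colorA v w).eval p m = (Cell.entry x (.colorOf y) : Cell n D).addr := by
  simp only [colorA, eval_add, h.eval_pointerE hv, eval_const, hw, Cell.addr, Field.offset,
    eval_load, h.eval_bound]
  omega

theorem Header.eval_positionA (h : Header n D m) {x y : Fin n} (hv : v.eval p m = x)
    (hw : w.eval p m = y) :
    (positionA v w).eval p m = (Cell.entry x (.position y) : Cell n D).addr := by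
  simp only [positionA, eval_add, h.eval_pointerE hv, eval_const, hw, Cell.addr, Field.offset,
    eval_load, h.eval_bound, h.eval_sizeE]
  omega

theorem Header.eval_neighborA (h : Header n D m) {x : Fin n} {j : Fin D} (hv : v.eval p m = x)
    (hi : i.eval p m = j) :
    (neighborA v i).eval p m = (Cell.entry x (.neighbor j) : Cell n D).addr := by
  simp only [neighborA, eval_add, h.eval_pointerE hv, eval_const, hi, Cell.addr, Field.offset,
    eval_load, h.eval_bound, h.eval_sizeE]
  omega

/-- The base cell points to the scratch cell `b`. -/
def HasBase (n D b : ℕ) (m : ℕ → ℕ) : Prop :=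
  m (Cell.base : Cell n D).addr = workspace n D + b

theorem Frame.hasBase {k : ℕ} {m m' : ℕ → ℕ} (h : Frame n D k m m') (hb : HasBase n D b m) :
    HasBase n D b m' := (h .base id).trans hb

theorem HasBase.eval_scratchA (h : HasBase n D b m) :
    (scratchA i).eval p m = (Cell.scratch (b + i.eval p m) : Cell n D).addr := by
  have h2 : m 2 = workspace n D + b := h
  simp only [scratchA, eval_add, eval_load, eval_const, h2, Cell.addr]
  omega

theorem HasBase.eval_markA (hb : HasBase n D b m) :
    (markA i).eval p m = (markCell n D b (i.eval p m)).addr := by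
  rw [markA, hb.eval_scratchA, markCell, eval_add, eval_const, add_assoc]

theorem HasBase.eval_nextA (hb : HasBase n D b m) (h : Header n D m) :
    (nextA i).eval p m = (nextCell n D b (i.eval p m)).addr := by
  rw [nextA, hb.eval_scratchA, nextCell, eval_add, eval_add, eval_const, h.eval_sizeTwiceE]
  simp only [add_assoc]

theorem HasBase.eval_predA (hb : HasBase n D b m) (h : Header n D m) :
    (predA i).eval p m = (predCell n D b (i.eval p m)).addr := by
  rw [predA, hb.eval_scratchA, predCell, eval_add, eval_add, eval_add, eval_const,
    h.eval_sizeTwiceE]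
  congr 2
  omega

end Eval

/-- A synchronous assignment that writes to private cells only. -/
theorem frame_of_written {k : ℕ} {l : List Write} {m m' : ℕ → ℕ} (h : Written P l m m')
    {Ws : List (Cell n D → ℕ → Prop)} (hl : List.Forall₂ (Write.Emits P m) l Ws)
    (hW : ∀ W ∈ Ws, ∀ c v, W c v → c.Private k) : Frame n D k m m' := by
  intro c hc
  have hne : c ≠ .trash := by rintro rfl; exact hc trivial
  rcases h.read hl c hne with ⟨-, h1⟩ | ⟨W, hWm, h1⟩
  · exact h1
  · exact absurd (hW W hWm c _ h1) hc

/-! ### Marking an orbit by pointer jumping -/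

/-- One round: marks are passed on to the successors, and the length of the jumps is doubled. -/
def jumpWrites : List Write :=
  [.each sizeTwiceE (load (markA pid)) (markA (load (nextA pid))) (const 1),
   .each sizeTwiceE (const 1) (nextA pid) (load (nextA (load (nextA pid)))),
   .solo (const 1) jumpA (add (load jumpA) (load jumpA))]

/-- The condition under which another round is needed. -/
def jumpCond : Expr := lt (load jumpA) sizeTwiceE

/-- All rounds of pointer jumping. -/
def jump : Stmt := .loop jumpCond (.assign jumpWrites)

/-- A bound on the number of steps of pointer jumping. -/
def jumpTime (n : ℕ) : ℕ :=
  Nat.clog 2 (2 * n) * (assignCost jumpWrites + jumpCond.cost + 3) + (jumpCond.cost + 1)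

/-- The state of pointer jumping after `t` rounds, started on the states in `S`: the jumps have
length `2 ^ t`, and the marked states are those that fewer than `2 ^ t` steps reach. -/
structure JumpState (n D b : ℕ) (f : ℕ → ℕ) (S : Set ℕ) (t : ℕ) (m : ℕ → ℕ) : Prop where
  header : Header n D m
  base : HasBase n D b m
  length : m (Cell.scratch (b + 5) : Cell n D).addr = 2 ^ t
  next : ∀ j < 2 * n, m (nextCell n D b j).addr = f^[2 ^ t] j
  mark : ∀ j < 2 * n, m (markCell n D b j).addr ≠ 0 ↔
    ∃ s ∈ S, s < 2 * n ∧ ∃ i < 2 ^ t, f^[i] s = j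

theorem jumpState_step (hP : 2 * n ≤ P) (hn : 0 < n) {f : ℕ → ℕ} (hf : ∀ x < 2 * n, f x < 2 * n)
    {S : Set ℕ} {t : ℕ} {m m' : ℕ → ℕ} (h : JumpState n D b f S t m)
    (hw : Written P jumpWrites m m') :
    JumpState n D b f S (t + 1) m' ∧ Frame n D (b + 5) m m' := by
  have hH := h.header
  have hb := h.base
  have hfi : ∀ i, ∀ x < 2 * n, f^[i] x < 2 * n := fun i x hx => by
    induction i with
    | zero => exact hx
    | succ i ih => rw [Function.iterate_succ_apply']; exact hf _ ih
  have hl := List.Forall₂.cons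
    (Write.emits_each (D := D) (P := P) (m := m) (N := sizeTwiceE) (g := load (markA pid))
      (a := markA (load (nextA pid))) (v := const 1) (fun p => hH.eval_sizeTwiceE) hP
      (fun j => ∃ s ∈ S, s < 2 * n ∧ ∃ i < 2 ^ t, f^[i] s = j)
      (fun j => markCell n D b (f^[2 ^ t] j)) (fun _ => 1)
      (fun j => by rw [eval_load, hb.eval_markA, eval_pid]; exact h.mark j j.isLt)
      (fun j _ => by
        rw [hb.eval_markA, eval_load, hb.eval_nextA hH, eval_pid, h.next j j.isLt]; simp))
    (.cons (Write.emits_each (D := D) (P := P) (m := m) (N := sizeTwiceE) (g := const 1)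
      (a := nextA pid) (v := load (nextA (load (nextA pid)))) (fun p => hH.eval_sizeTwiceE) hP
      (fun j => True) (fun j => nextCell n D b j) (fun j => f^[2 ^ (t + 1)] j)
      (fun j => by simp)
      (fun j _ => by
        rw [hb.eval_nextA hH, eval_load, hb.eval_nextA hH, eval_load, hb.eval_nextA hH, eval_pid,
          h.next j j.isLt, h.next _ (hfi _ _ j.isLt), ← Function.iterate_add_apply, pow_succ,
          mul_two]
        simp))
    (.cons (Write.emits_solo (D := D) (P := P) (m := m) (g := const 1)
      (a := jumpA) (v := add (load jumpA) (load jumpA)) (by omega) True (.scratch (b + 5))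
      (2 ^ (t + 1)) (by simp)
      (fun _ => by
        rw [jumpA, hb.eval_scratchA, eval_add, eval_load, hb.eval_scratchA, eval_const, h.length,
          pow_succ, mul_two]
        simp)) .nil))
  have hread := fun c hc => hw.read hl c hc
  have hframe : Frame n D (b + 5) m m' := frame_of_written hw hl (by
    simp only [List.mem_cons, List.not_mem_nil, or_false, forall_eq_or_imp, forall_eq]
    refine ⟨?_, ?_, ?_⟩
    · rintro c v ⟨x, -, rfl, -⟩; simp only [markCell, Cell.Private]; omega
    · rintro c v ⟨x, -, rfl, -⟩; simp only [nextCell, Cell.Private]; omega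
    · rintro c v ⟨-, rfl, -⟩; simp only [Cell.Private]; omega)
  refine ⟨⟨hframe.header hH, hframe.hasBase hb, ?_, ?_, ?_⟩, hframe⟩
  · have := hread (.scratch (b + 5)) (by simp)
    simp only [markCell, nextCell, List.mem_cons, List.not_mem_nil, or_false, forall_eq_or_imp,
      exists_eq_or_imp, forall_eq, exists_eq_left, Cell.scratch.injEq] at this
    rcases this with ⟨⟨-, -, h1⟩, -⟩ | ⟨x, -, h1, -⟩ | ⟨x, -, h1, -⟩ | h1
    · exact absurd ⟨trivial, trivial, rfl⟩ (h1 (2 ^ (t + 1)))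
    · omega
    · omega
    · exact h1.2.2
  · intro j hj
    have := hread (nextCell n D b j) (by simp [nextCell])
    simp only [markCell, nextCell, List.mem_cons, List.not_mem_nil, or_false, forall_eq_or_imp,
      exists_eq_or_imp, forall_eq, exists_eq_left, Cell.scratch.injEq] at this
    rcases this with ⟨⟨-, h1, -⟩, -⟩ | ⟨x, -, h1, -⟩ | ⟨x, -, h1, h2⟩ | h1
    · exact absurd ⟨⟨j, hj⟩, trivial, rfl, rfl⟩ (h1 _)
    · have := hfi (2 ^ t) x x.isLt; omega
    · obtain rfl : j = x := by omega
      exact h2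
    · omega
  · intro j hj
    have := hread (markCell n D b j) (by simp [markCell])
    simp only [markCell, nextCell, List.mem_cons, List.not_mem_nil, or_false, forall_eq_or_imp,
      exists_eq_or_imp, forall_eq, exists_eq_left, Cell.scratch.injEq] at this
    have hpow : 2 ^ (t + 1) = 2 ^ t + 2 ^ t := by rw [pow_succ, mul_two]
    rcases this with ⟨⟨h1, -, -⟩, h2⟩ | ⟨x, ⟨s, hs, hsn, i, hi, hsx⟩, h1, h2⟩ | ⟨x, -, h1, -⟩ | h1
    · rw [markCell, h2, ← markCell, h.mark j hj]
      constructor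
      · rintro ⟨s, hs, hsn, i, hi, rfl⟩
        exact ⟨s, hs, hsn, i, by omega, rfl⟩
      · rintro ⟨s, hs, hsn, i, hi, rfl⟩
        by_cases hi' : i < 2 ^ t
        · exact ⟨s, hs, hsn, i, hi', rfl⟩
        · refine absurd ⟨⟨f^[i - 2 ^ t] s, hfi _ _ hsn⟩,
            ⟨s, hs, hsn, i - 2 ^ t, by omega, rfl⟩, ?_, rfl⟩ (h1 1)
          rw [← Function.iterate_add_apply, Nat.add_sub_cancel' (by omega)]
    · rw [markCell, h2]
      refine iff_of_true one_ne_zero ⟨s, hs, hsn, 2 ^ t + i, by omega, ?_⟩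
      rw [Function.iterate_add_apply, hsx]
      omega
    · have := hfi (2 ^ t) x x.isLt; omega
    · omega

/-- Pointer jumping marks what iteration of `f` reaches from the states that are marked at first. -/
theorem runs_jump (hP : 2 * n ≤ P) (hn : 0 < n) {f : ℕ → ℕ} (hf : ∀ x < 2 * n, f x < 2 * n)
    {S : Set ℕ} {m : ℕ → ℕ} (hH : Header n D m) (hb : HasBase n D b m)
    (hlength : m (Cell.scratch (b + 5) : Cell n D).addr = 1)
    (hnext : ∀ j < 2 * n, m (nextCell n D b j).addr = f j)
    (hmark : ∀ j < 2 * n, m (markCell n D b j).addr ≠ 0 ↔ j ∈ S) :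
    Runs P jump (jumpTime n) m fun m' => Frame n D (b + 5) m m' ∧
      ∀ j < 2 * n, m' (markCell n D b j).addr ≠ 0 ↔ ∃ s ∈ S, s < 2 * n ∧ j ∈ reach f s := by
  set r := Nat.clog 2 (2 * n) with hr
  have h := Runs.loop (P := P) (c := jumpCond) (s := .assign jumpWrites)
    (T := assignCost jumpWrites)
    (I := fun k m' => k ≤ r ∧ Frame n D (b + 5) m m' ∧ JumpState n D b f S (r - k) m')
    (by
      rintro k m' ⟨hk, -, hI⟩ p
      rw [jumpCond, eval_lt, hI.header.eval_sizeTwiceE, eval_load, jumpA, hI.base.eval_scratchA,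
        eval_const, hI.length, ← Nat.clog_le_iff_le_pow one_lt_two, ← hr]
      omega)
    (by
      rintro k m' ⟨hk, hF, hI⟩
      refine Runs.assign fun m'' hw => ?_
      obtain ⟨h1, h2⟩ := jumpState_step hP hn hf hI hw
      refine ⟨by omega, hF.trans h2, ?_⟩
      rwa [show r - (k + 1) + 1 = r - k by omega] at h1)
    r m ⟨le_rfl, Frame.refl _ _, hH, hb, by simpa using hlength, by simpa using hnext, by
      intro j hj
      rw [hmark j hj, Nat.sub_self, pow_zero]
      constructor
      · exact fun h => ⟨j, h, hj, 0, one_pos, rfl⟩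
      · rintro ⟨s, hs, -, i, hi, rfl⟩
        obtain rfl : i = 0 := by omega
        exact hs⟩
  refine h.mono le_rfl ?_
  rintro m' ⟨-, hF, hI⟩
  refine ⟨hF, fun j hj => ?_⟩
  rw [hI.mark j hj]
  constructor
  · rintro ⟨s, hs, hsn, i, -, rfl⟩
    exact ⟨s, hs, hsn, i, rfl⟩
  · rintro ⟨s, hs, hsn, i, rfl⟩
    obtain ⟨i', hi', he⟩ := exists_iterate_lt hf hsn i
    refine ⟨s, hs, hsn, i', hi'.trans_le ?_, he⟩
    exact (Nat.le_pow_clog one_lt_two _)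

open Expr

variable {n D P b : ℕ}

/-! ### Marking the fan -/

/-- The memory holds the tables, and the edge `uv` to be inserted in the cells `b` and `b + 1` of
the workspace. -/
structure Ready (m : ℕ → ℕ) (b : ℕ) (G : SimpleGraph (Fin n))
    (X : Fin n → Fin n → Option (Fin (D + 1))) (T : Fin n → Fin (D + 1) → Option (Fin n))
    (M : Fin n → Fin (D + 1)) (u v : Fin n) : Prop extends Holds m G X T M where
  base : HasBase n D b m
  left : m (Cell.scratch b : Cell n D).addr = u
  right : m (Cell.scratch (b + 1) : Cell n D).addr = v

variable {G : SimpleGraph (Fin n)} {X : Fin n → Fin n → Option (Fin (D + 1))}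
  {T : Fin n → Fin (D + 1) → Option (Fin n)} {M : Fin n → Fin (D + 1)} {u v : Fin n} {m m' : ℕ → ℕ}

theorem Frame.ready {k : ℕ} (h : Frame n D k m m') (hk : b + 2 ≤ k) (hm : Ready m b G X T M u v) :
    Ready m' b G X T M u v :=
  ⟨h.holds hm.toHolds, h.hasBase hm.base,
    (h _ (by simp only [Cell.Private]; omega)).trans hm.left,
    (h _ (by simp only [Cell.Private]; omega)).trans hm.right⟩

namespace Ready

variable (h : Ready m b G X T M u v) {p : ℕ} {e k : Expr}
include h

theorem eval_uE : uE.eval p m = u := by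
  rw [uE, eval_load, h.base.eval_scratchA]; exact h.left

theorem eval_vE : vE.eval p m = v := by
  rw [vE, eval_load, h.base.eval_scratchA]; exact h.right

end Ready

namespace HoldsTables

variable (h : HoldsTables m G X T) {p : ℕ} {e k : Expr}
include h

theorem eval_vertexA {x : Fin n} {c : Fin (D + 1)} (he : e.eval p m = x)
    (hk : k.eval p m = c + 1) : (load (vertexA e k)).eval p m = enc (T x c) := by
  rw [eval_load, h.header.eval_vertexA he hk, h.vertexOf]

theorem eval_colorA {x y : Fin n} (he : e.eval p m = x)
    (hk : k.eval p m = y) : (load (colorA e k)).eval p m = enc (X x y) := by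
  rw [eval_load, h.header.eval_colorA he hk, h.colorOf]

theorem eval_degreeA {x : Fin n} (he : e.eval p m = x) :
    (load (degreeA e)).eval p m = (G.neighborSet x).ncard := by
  rw [eval_load, h.header.eval_degreeA he, h.degree]

end HoldsTables

theorem Holds.eval_missingA (h : Holds m G X T M) {p : ℕ} {e : Expr} {x : Fin n}
    (he : e.eval p m = x) : (load (missingA e)).eval p m = M x + 1 := by
  rw [eval_load, h.header.eval_missingA he, h.missing]

/-- The successor of a state on the fan at `u`. -/
def fanE : Expr :=
  ite (and (lt pid sizeE) (load (vertexA uE (load (missingA pid)))))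
    (sub (load (vertexA uE (load (missingA pid)))) (const 1)) pid

theorem Ready.eval_fanE (h : Ready m b G X T M u v) (x : Fin n) :
    fanE.eval x m = fan T M u x := by
  have h1 : (load (vertexA uE (load (missingA pid)))).eval x m = enc (T u (M x)) :=
    h.eval_vertexA h.eval_uE (h.eval_missingA rfl)
  simp only [fanE, eval_ite, eval_and, eval_lt, h.header.eval_sizeE, eval_pid, h1, eval_sub,
    eval_const, fan]
  cases T u (M x) <;> simp

theorem Ready.eval_fanE_of_le (h : Ready m b G X T M u v) {j : ℕ} (hj : n ≤ j) :
    fanE.eval j m = j := by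
  simp [fanE, h.header.eval_sizeE, hj]

/-- The vertex `v` is marked, and every vertex points to its successor on the fan. -/
def fanWrites : List Write :=
  [.each sizeTwiceE (const 1) (nextA pid) fanE,
   .each sizeTwiceE (const 1) (markA pid) (eq pid vE),
   .solo (const 1) jumpA (const 1),
   .solo (const 1) chainColorA (const 0)]

/-- The fan is marked. -/
def markFan : Stmt := .seq (.assign fanWrites) jump

/-- The number of steps of `markFan`. -/
def markFanTime (n : ℕ) : ℕ := assignCost fanWrites + jumpTime n

theorem runs_markFan (hP : 2 * n ≤ P) (h : Ready m b G X T M u v) :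
    Runs P markFan (markFanTime n) m fun m' => Frame n D (b + 4) m m' ∧
      m' (Cell.scratch (b + 4) : Cell n D).addr = 0 ∧
      ∀ x : Fin n, m' (markCell n D b x).addr ≠ 0 ↔ x ∈ reach (fan T M u) v := by
  have hH := h.header
  have hb := h.base
  have hn : 0 < n := u.pos
  refine Runs.seq (Runs.assign fun m₁ hw => ?_)
  have hl := List.Forall₂.cons
    (Write.emits_each (D := D) (P := P) (m := m) (N := sizeTwiceE) (g := const 1)
      (a := nextA pid) (v := fanE) (fun p => hH.eval_sizeTwiceE) hP
      (fun j => True) (fun j => nextCell n D b j) (fun j => fanE.eval j m)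
      (fun j => by simp) (fun j _ => ⟨by rw [hb.eval_nextA hH, eval_pid], rfl⟩))
    (.cons (Write.emits_each (D := D) (P := P) (m := m) (N := sizeTwiceE) (g := const 1)
      (a := markA pid) (v := eq pid vE) (fun p => hH.eval_sizeTwiceE) hP
      (fun j => True) (fun j => markCell n D b j) (fun j => (eq pid vE).eval j m)
      (fun j => by simp) (fun j _ => ⟨by rw [hb.eval_markA, eval_pid], rfl⟩))
    (.cons (Write.emits_solo (D := D) (P := P) (m := m) (g := const 1)
      (a := jumpA) (v := const 1) (by omega) True (.scratch (b + 5)) 1 (by simp)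
      (fun _ => ⟨by rw [jumpA, hb.eval_scratchA, eval_const], rfl⟩))
    (.cons (Write.emits_solo (D := D) (P := P) (m := m) (g := const 1)
      (a := chainColorA) (v := const 0) (by omega) True (.scratch (b + 4)) 0 (by simp)
      (fun _ => ⟨by rw [chainColorA, hb.eval_scratchA, eval_const], rfl⟩)) .nil)))
  have hread := fun c hc => hw.read hl c hc
  have hframe : Frame n D (b + 4) m m₁ := frame_of_written hw hl (by
    simp only [List.mem_cons, List.not_mem_nil, or_false, forall_eq_or_imp, forall_eq]
    refine ⟨?_, ?_, ?_, ?_⟩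
    · rintro c v ⟨x, -, rfl, -⟩; simp only [nextCell, Cell.Private]; omega
    · rintro c v ⟨x, -, rfl, -⟩; simp only [markCell, Cell.Private]; omega
    · rintro c v ⟨-, rfl, -⟩; simp only [Cell.Private]; omega
    · rintro c v ⟨-, rfl, -⟩; simp only [Cell.Private]; omega)
  have hnext : ∀ j < 2 * n, m₁ (nextCell n D b j).addr = fanE.eval j m := by
    intro j hj
    have := hread (nextCell n D b j) (by simp [nextCell])
    simp only [markCell, nextCell, List.mem_cons, List.not_mem_nil, or_false, forall_eq_or_imp,
      exists_eq_or_imp, forall_eq, exists_eq_left, Cell.scratch.injEq] at this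
    rcases this with ⟨⟨h1, -⟩, -⟩ | ⟨x, -, h1, h2⟩ | ⟨x, -, h1, -⟩ | h1 | h1
    · exact absurd ⟨⟨j, hj⟩, trivial, rfl, rfl⟩ (h1 _)
    · obtain rfl : j = x := by omega
      exact h2
    all_goals omega
  have hmark : ∀ j < 2 * n, m₁ (markCell n D b j).addr ≠ 0 ↔ j ∈ ({(v : ℕ)} : Set ℕ) := by
    intro j hj
    have := hread (markCell n D b j) (by simp [markCell])
    simp only [markCell, nextCell, List.mem_cons, List.not_mem_nil, or_false, forall_eq_or_imp,
      exists_eq_or_imp, forall_eq, exists_eq_left, Cell.scratch.injEq] at this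
    rcases this with ⟨⟨-, h1, -⟩, -⟩ | ⟨x, -, h1, h2⟩ | ⟨x, -, h1, h2⟩ | h1 | h1
    · exact absurd ⟨⟨j, hj⟩, trivial, rfl, rfl⟩ (h1 _)
    · omega
    · obtain rfl : j = x := by omega
      rw [markCell, h2]
      simp [h.eval_vE]
    all_goals omega
  have hjump : m₁ (Cell.scratch (b + 5) : Cell n D).addr = 1 := by
    have := hread (.scratch (b + 5)) (by simp)
    simp only [markCell, nextCell, List.mem_cons, List.not_mem_nil, or_false, forall_eq_or_imp,
      exists_eq_or_imp, forall_eq, exists_eq_left, Cell.scratch.injEq] at this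
    rcases this with ⟨⟨-, -, h1, -⟩, -⟩ | ⟨x, -, h1, h2⟩ | ⟨x, -, h1, h2⟩ | h1 | h1
    · exact absurd ⟨trivial, trivial, rfl⟩ (h1 1)
    · omega
    · omega
    · exact h1.2.2
    · omega
  have hcolor : m₁ (Cell.scratch (b + 4) : Cell n D).addr = 0 := by
    have := hread (.scratch (b + 4)) (by simp)
    simp only [markCell, nextCell, List.mem_cons, List.not_mem_nil, or_false, forall_eq_or_imp,
      exists_eq_or_imp, forall_eq, exists_eq_left, Cell.scratch.injEq] at this
    rcases this with ⟨⟨-, -, -, h1⟩, -⟩ | ⟨x, -, h1, h2⟩ | ⟨x, -, h1, h2⟩ | h1 | h1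
    · exact absurd ⟨trivial, trivial, rfl⟩ (h1 0)
    · omega
    · omega
    · omega
    · exact h1.2.2
  have hlt : ∀ j < 2 * n, fanE.eval j m < 2 * n := by
    intro j hj
    by_cases hjn : j < n
    · have := h.eval_fanE ⟨j, hjn⟩
      have h2 := (fan T M u ⟨j, hjn⟩).isLt
      simp only at this
      omega
    · rw [h.eval_fanE_of_le (by omega)]
      exact hj
  refine (runs_jump hP hn (f := fun j => fanE.eval j m) hlt (hframe.header hH) (hframe.hasBase hb)
    hjump hnext hmark).mono le_rfl ?_
  rintro m₂ ⟨hF, hmark'⟩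
  refine ⟨hframe.trans (hF.mono (by omega)), ?_, fun x => ?_⟩
  · rw [hF _ (by simp [Cell.Private]), hcolor]
  · have hx := x.isLt
    rw [hmark' x (by omega)]
    have hr := reach_map (f := fan T M u) (g := fun j => fanE.eval j m) (e := Fin.val) (s := v)
      h.eval_fanE
    simp only [Set.mem_singleton_iff, exists_eq_left, hr, Set.mem_image, Fin.val_inj,
      exists_eq_right]
    exact and_iff_right (by omega)

/-! ### Finding the color of the Kempe chain -/

/-- The marked vertices that are not the end of the fan. -/
def fanInnerE : Expr := and (load (markA pid)) (ne fanE pid)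

/-- Every vertex of the fan announces itself to its successor. -/
def announceWrites : List Write := [.each sizeE fanInnerE (predA fanE) pid]

/-- A vertex that sees another predecessor of its successor writes down its missing color. -/
def collideWrites : List Write :=
  [.each sizeE (and fanInnerE (ne (load (predA fanE)) pid)) chainColorA (load (missingA pid))]

/-- If the fan runs into itself, then the color missing at the two vertices before the place of the
collision is determined. The cell for this color keeps its value `0` if the fan ends. -/
def collide : Stmt := .seq (.assign announceWrites) (.assign collideWrites)

theorem Ready.eval_fanInnerE (h : Ready m b G X T M u v) (x : Fin n) :
    fanInnerE.eval x m ≠ 0 ↔ m (markCell n D b x).addr ≠ 0 ∧ fan T M u x ≠ x := by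
  simp only [fanInnerE, ne_eq, eval_and, eval_load, h.base.eval_markA, eval_pid, eval_ne,
    h.eval_fanE, Fin.val_inj, not_or]

theorem runs_collide (hP : 2 * n ≤ P) (h : Ready m b G X T M u v)
    (hcolor : m (Cell.scratch (b + 4) : Cell n D).addr = 0)
    (hmark : ∀ x : Fin n, m (markCell n D b x).addr ≠ 0 ↔ x ∈ reach (fan T M u) v) :
    Runs P collide (assignCost announceWrites + assignCost collideWrites) m fun m' =>
      Frame n D (b + 4) m m' ∧
      ((m' (Cell.scratch (b + 4) : Cell n D).addr = 0 ∧ ∀ x ∈ reach (fan T M u) v,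
        ∀ y ∈ reach (fan T M u) v, fan T M u x ≠ x → fan T M u y ≠ y →
          fan T M u x = fan T M u y → x = y) ∨
      ∃ x ∈ reach (fan T M u) v, ∃ y ∈ reach (fan T M u) v, fan T M u x ≠ x ∧ fan T M u y ≠ y ∧
        x ≠ y ∧ fan T M u x = fan T M u y ∧
        m' (Cell.scratch (b + 4) : Cell n D).addr = M x + 1) := by
  set R := reach (fan T M u) v
  set F := fan T M u
  have hn : 0 < n := u.pos
  refine Runs.seq (Runs.assign fun m₁ hw => Runs.assign fun m₂ hw₂ => ?_)
  -- the successor of every inner vertex of the fan now points to one of its predecessors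
  have hl := List.Forall₂.cons
    (Write.emits_each (D := D) (P := P) (m := m) (N := sizeE) (g := fanInnerE)
      (a := predA fanE) (v := pid) (fun p => h.header.eval_sizeE) (by omega)
      (fun x => x ∈ R ∧ F x ≠ x) (fun x => predCell n D b (F x)) (fun x => x)
      (fun x => by rw [h.eval_fanInnerE, hmark])
      (fun x _ => ⟨by rw [h.base.eval_predA h.header, h.eval_fanE], rfl⟩)) .nil
  have hframe : Frame n D (b + 5) m m₁ := frame_of_written hw hl (by
    simp only [List.mem_singleton, forall_eq]
    rintro c v ⟨x, -, rfl, -⟩; simp only [predCell, Cell.Private]; omega)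
  have hpred : ∀ x ∈ R, F x ≠ x → ∃ y ∈ R, F y ≠ y ∧ F y = F x ∧
      m₁ (predCell n D b (F x)).addr = y := by
    intro x hx hFx
    have := hw.read hl (predCell n D b (F x)) (by simp [predCell])
    simp only [predCell, List.mem_singleton, forall_eq, exists_eq_left, Cell.scratch.injEq] at this
    rcases this with ⟨h1, -⟩ | ⟨y, hy, h1, h2⟩
    · exact absurd ⟨x, ⟨hx, hFx⟩, rfl, rfl⟩ (h1 x)
    · exact ⟨y, hy.1, hy.2, Fin.ext (by omega), h2⟩
  have hmark₁ : ∀ x : Fin n, m₁ (markCell n D b x).addr ≠ 0 ↔ x ∈ R := by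
    intro x
    have := hw.read hl (markCell n D b x) (by simp [markCell])
    simp only [predCell, markCell, List.mem_singleton, forall_eq, exists_eq_left,
      Cell.scratch.injEq] at this
    rcases this with ⟨-, h1⟩ | ⟨y, -, h1, -⟩
    · rw [markCell, h1, ← markCell, hmark]
    · omega
  have h₁ := hframe.ready (by omega) h
  have hl₂ := List.Forall₂.cons
    (Write.emits_each (D := D) (P := P) (m := m₁) (N := sizeE)
      (g := and fanInnerE (ne (load (predA fanE)) pid))
      (a := chainColorA) (v := load (missingA pid)) (fun p => h₁.header.eval_sizeE) (by omega)
      (fun x => (x ∈ R ∧ F x ≠ x) ∧ m₁ (predCell n D b (F x)).addr ≠ x)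
      (fun x => .scratch (b + 4)) (fun x => M x + 1)
      (fun x => by
        rw [Ne, eval_and, not_or, ← Ne, ← Ne, h₁.eval_fanInnerE, hmark₁, Ne, Ne, eval_ne, eval_load,
          h₁.base.eval_predA h₁.header, h₁.eval_fanE]
        rfl)
      (fun x _ => ⟨by rw [chainColorA, h₁.base.eval_scratchA, eval_const],
        h₁.eval_missingA rfl⟩)) .nil
  have hframe₂ : Frame n D (b + 4) m₁ m₂ := frame_of_written hw₂ hl₂ (by
    simp only [List.mem_singleton, forall_eq]
    rintro c v ⟨x, -, rfl, -⟩; simp [Cell.Private])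
  refine ⟨(hframe.mono (by omega)).trans hframe₂, ?_⟩
  have := hw₂.read hl₂ (.scratch (b + 4)) (by simp)
  simp only [List.mem_singleton, forall_eq, exists_eq_left, true_and] at this
  rcases this with ⟨h1, h2⟩ | ⟨x, ⟨⟨hx, hFx⟩, h1⟩, h2⟩
  · left
    refine ⟨?_, fun x hx y hy hFx hFy hxy => ?_⟩
    · rw [h2, hframe _ (by simp [Cell.Private]), hcolor]
    · -- both vertices see themselves as the predecessor
      have key : ∀ x ∈ R, F x ≠ x → m₁ (predCell n D b (F x)).addr = x := fun x hx hFx => by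
        by_contra hne
        exact h1 (M x + 1) ⟨x, ⟨⟨hx, hFx⟩, hne⟩, rfl⟩
      apply Fin.ext
      rw [← key x hx hFx, hxy, key y hy hFy]
  · right
    obtain ⟨y, hy, hFy, hxy, h3⟩ := hpred x hx hFx
    exact ⟨x, hx, y, hy, hFx, hFy, fun e => h1 (by rw [h3, e]), hxy.symm, h2⟩

/-! ### Marking the Kempe chain -/

/-- The stored color of the Kempe chain, `0` if there is no chain to be flipped. -/
def chainE : Expr := load chainColorA
/-- The color missing at `u`. -/
def freeE : Expr := load (missingA uE)

/-- The edge along which the Kempe walk continues. -/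
def kempeEdgeE : Expr :=
  load (vertexA (ite (lt pid sizeE) pid (sub pid sizeE)) (ite (lt pid sizeE) chainE freeE))

/-- The successor of a state on the Kempe walk; the states below `n` continue with the color of the
chain, the other ones with the color missing at `u`. -/
def kempeE : Expr :=
  ite (and chainE kempeEdgeE)
    (ite (lt pid sizeE) (add (sub kempeEdgeE (const 1)) sizeE) (sub kempeEdgeE (const 1))) pid

/-- The number of a state of the Kempe walk. -/
def stateCode (s : Fin n × Bool) : ℕ := s.1 + bif s.2 then n else 0

/-- The start of the Kempe walk is marked, and every state points to its successor. -/
def kempeWrites : List Write :=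
  [.each sizeTwiceE (const 1) (nextA pid) kempeE,
   .each sizeTwiceE (const 1) (markA pid) (and chainE (eq pid uE)),
   .solo (const 1) jumpA (const 1)]

/-- The states of the Kempe walk are marked. -/
def markChain : Stmt := .seq (.assign kempeWrites) jump

/-- The number of steps of `markChain`. -/
def markChainTime (n : ℕ) : ℕ := assignCost kempeWrites + jumpTime n

theorem stateCode_lt (s : Fin n × Bool) : stateCode s < 2 * n := by
  have := s.1.isLt
  unfold stateCode
  cases s.2 <;> simp <;> omega

theorem exists_stateCode {j : ℕ} (hj : j < 2 * n) : ∃ s : Fin n × Bool, stateCode s = j := by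
  by_cases h : j < n
  · exact ⟨(⟨j, h⟩, false), rfl⟩
  · exact ⟨(⟨j - n, by omega⟩, true), by simp [stateCode]; omega⟩

theorem stateCode_injective : Function.Injective (stateCode (n := n)) := by
  rintro ⟨x, _ | _⟩ ⟨y, _ | _⟩ h <;> simp only [stateCode, cond_true, cond_false] at h
  · rw [Fin.ext (by omega : (x : ℕ) = y)]
  · omega
  · omega
  · rw [Fin.ext (by omega : (x : ℕ) = y)]

theorem Ready.eval_chainE (h : Ready m b G X T M u v) {p : ℕ} :
    chainE.eval p m = m (Cell.scratch (b + 4) : Cell n D).addr := by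
  rw [chainE, eval_load, chainColorA, h.base.eval_scratchA, eval_const]

theorem Ready.eval_freeE (h : Ready m b G X T M u v) {p : ℕ} : freeE.eval p m = M u + 1 :=
  h.eval_missingA h.eval_uE

theorem Ready.eval_kempeE (h : Ready m b G X T M u v) {d : Fin (D + 1)}
    (hd : m (Cell.scratch (b + 4) : Cell n D).addr = d + 1) (s : Fin n × Bool) :
    kempeE.eval (stateCode s) m = stateCode (kempe T (M u) d s) := by
  have hs : (ite (lt pid sizeE) pid (sub pid sizeE)).eval (stateCode s) m = s.1 := by
    have := s.1.isLt
    obtain ⟨x, _ | _⟩ := s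
    · simp [stateCode, h.header.eval_sizeE]
    · simp [stateCode, h.header.eval_sizeE]
  have hc : (ite (lt pid sizeE) chainE freeE).eval (stateCode s) m =
      ((bif s.2 then M u else d : Fin (D + 1)) : ℕ) + 1 := by
    obtain ⟨x, _ | _⟩ := s
    · simp [stateCode, h.header.eval_sizeE, h.eval_chainE, hd]
    · simp [stateCode, h.header.eval_sizeE, h.eval_freeE]
  have he : kempeEdgeE.eval (stateCode s) m = enc (T s.1 (bif s.2 then M u else d)) :=
    h.eval_vertexA hs hc
  simp only [kempeE, eval_ite, eval_and, h.eval_chainE, hd, he, eval_lt, h.header.eval_sizeE,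
    eval_pid, eval_add, eval_sub, eval_const, kempe]
  obtain ⟨x, b⟩ := s
  cases T x (bif b then M u else d) <;> cases b <;> simp [stateCode]

theorem runs_markChain (hP : 2 * n ≤ P) (h : Ready m b G X T M u v) {o : Option (Fin (D + 1))}
    (ho : m (Cell.scratch (b + 4) : Cell n D).addr = enc o) :
    Runs P markChain (markChainTime n) m fun m' => Frame n D (b + 5) m m' ∧
      ∀ x : Fin n, (m' (markCell n D b x).addr ≠ 0 ∨ m' (markCell n D b (x + n)).addr ≠ 0 ↔
        ∃ d, o = some d ∧ x ∈ chain T (M u) d u) := by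
  have hH := h.header
  have hb := h.base
  have hn : 0 < n := u.pos
  refine Runs.seq (Runs.assign fun m₁ hw => ?_)
  have hl := List.Forall₂.cons
    (Write.emits_each (D := D) (P := P) (m := m) (N := sizeTwiceE) (g := const 1)
      (a := nextA pid) (v := kempeE) (fun p => hH.eval_sizeTwiceE) hP
      (fun j => True) (fun j => nextCell n D b j) (fun j => kempeE.eval j m)
      (fun j => by simp) (fun j _ => ⟨by rw [hb.eval_nextA hH, eval_pid], rfl⟩))
    (.cons (Write.emits_each (D := D) (P := P) (m := m) (N := sizeTwiceE) (g := const 1)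
      (a := markA pid) (v := and chainE (eq pid uE)) (fun p => hH.eval_sizeTwiceE) hP
      (fun j => True) (fun j => markCell n D b j) (fun j => (and chainE (eq pid uE)).eval j m)
      (fun j => by simp) (fun j _ => ⟨by rw [hb.eval_markA, eval_pid], rfl⟩))
    (.cons (Write.emits_solo (D := D) (P := P) (m := m) (g := const 1)
      (a := jumpA) (v := const 1) (by omega) True (.scratch (b + 5)) 1 (by simp)
      (fun _ => ⟨by rw [jumpA, hb.eval_scratchA, eval_const], rfl⟩)) .nil))
  have hread := fun c hc => hw.read hl c hc
  have hframe : Frame n D (b + 5) m m₁ := frame_of_written hw hl (by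
    simp only [List.mem_cons, List.not_mem_nil, or_false, forall_eq_or_imp, forall_eq]
    refine ⟨?_, ?_, ?_⟩
    · rintro c v ⟨x, -, rfl, -⟩; simp only [nextCell, Cell.Private]; omega
    · rintro c v ⟨x, -, rfl, -⟩; simp only [markCell, Cell.Private]; omega
    · rintro c v ⟨-, rfl, -⟩; simp only [Cell.Private]; omega)
  have hnext : ∀ j < 2 * n, m₁ (nextCell n D b j).addr = kempeE.eval j m := by
    intro j hj
    have := hread (nextCell n D b j) (by simp [nextCell])
    simp only [markCell, nextCell, List.mem_cons, List.not_mem_nil, or_false, forall_eq_or_imp,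
      exists_eq_or_imp, forall_eq, exists_eq_left, Cell.scratch.injEq] at this
    rcases this with ⟨⟨h1, -⟩, -⟩ | ⟨x, -, h1, h2⟩ | ⟨x, -, h1, -⟩ | h1
    · exact absurd ⟨⟨j, hj⟩, trivial, rfl, rfl⟩ (h1 _)
    · obtain rfl : j = x := by omega
      exact h2
    all_goals omega
  have hmark : ∀ j < 2 * n, m₁ (markCell n D b j).addr ≠ 0 ↔
      j ∈ {j : ℕ | m (Cell.scratch (b + 4) : Cell n D).addr ≠ 0 ∧ j = u} := by
    intro j hj
    have := hread (markCell n D b j) (by simp [markCell])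
    simp only [markCell, nextCell, List.mem_cons, List.not_mem_nil, or_false, forall_eq_or_imp,
      exists_eq_or_imp, forall_eq, exists_eq_left, Cell.scratch.injEq] at this
    rcases this with ⟨⟨-, h1, -⟩, -⟩ | ⟨x, -, h1, h2⟩ | ⟨x, -, h1, h2⟩ | h1
    · exact absurd ⟨⟨j, hj⟩, trivial, rfl, rfl⟩ (h1 _)
    · omega
    · obtain rfl : j = x := by omega
      rw [markCell, h2]
      simp [h.eval_uE, h.eval_chainE]
    all_goals omega
  have hjump : m₁ (Cell.scratch (b + 5) : Cell n D).addr = 1 := by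
    have := hread (.scratch (b + 5)) (by simp)
    simp only [markCell, nextCell, List.mem_cons, List.not_mem_nil, or_false, forall_eq_or_imp,
      exists_eq_or_imp, forall_eq, exists_eq_left, Cell.scratch.injEq] at this
    rcases this with ⟨⟨-, -, h1⟩, -⟩ | ⟨x, -, h1, h2⟩ | ⟨x, -, h1, h2⟩ | h1
    · exact absurd ⟨trivial, trivial, rfl⟩ (h1 1)
    · omega
    · omega
    · exact h1.2.2
  have hu := u.isLt
  cases o with
  | none =>
    have h0 : m (Cell.scratch (b + 4) : Cell n D).addr = 0 := ho
    have hid : ∀ j, kempeE.eval j m = j := fun j => by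
      simp [kempeE, h.eval_chainE, h0]
    refine (runs_jump hP hn (f := fun j => kempeE.eval j m) (fun j hj => by simpa [hid] using hj)
      (hframe.header hH) (hframe.hasBase hb) hjump hnext hmark).mono le_rfl ?_
    rintro m₂ ⟨hF, hmark'⟩
    refine ⟨hframe.trans hF, fun x => ?_⟩
    have key : ∀ j < 2 * n, ¬ m₂ (markCell n D b j).addr ≠ 0 := fun j hj hne => by
      obtain ⟨s, hs, -⟩ := (hmark' j hj).1 hne
      exact hs.1 h0
    have hx := x.isLt
    have h1 := key x (by omega)
    have h2 := key (x + n) (by omega)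
    simp [h1, h2]
  | some d =>
    have hd : m (Cell.scratch (b + 4) : Cell n D).addr = d + 1 := ho
    have h0 : m (Cell.scratch (b + 4) : Cell n D).addr ≠ 0 := by omega
    have hcode := h.eval_kempeE hd
    have hlt : ∀ j < 2 * n, kempeE.eval j m < 2 * n := by
      intro j hj
      obtain ⟨s, rfl⟩ := exists_stateCode hj
      rw [hcode]
      exact stateCode_lt _
    refine (runs_jump hP hn (f := fun j => kempeE.eval j m) hlt
      (hframe.header hH) (hframe.hasBase hb) hjump hnext hmark).mono le_rfl ?_
    rintro m₂ ⟨hF, hmark'⟩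
    refine ⟨hframe.trans hF, fun x => ?_⟩
    have hr := reach_map (f := kempe T (M u) d) (g := fun j => kempeE.eval j m) (e := stateCode)
      (s := (u, false)) hcode
    have key : ∀ (x : Fin n) (c : Bool), m₂ (markCell n D b (stateCode (x, c))).addr ≠ 0 ↔
        (x, c) ∈ reach (kempe T (M u) d) (u, false) := by
      intro x c
      rw [hmark' _ (stateCode_lt _), ← stateCode_injective.mem_set_image, ← hr]
      constructor
      · rintro ⟨s, ⟨-, rfl⟩, -, hs⟩
        exact hs
      · exact fun hs => ⟨u, ⟨h0, rfl⟩, by omega, hs⟩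
    rw [← show stateCode (x, false) = x from rfl]
    have h2 := key x true
    rw [key x false]
    simp only [stateCode, cond_true, cond_false, add_zero] at h2 ⊢
    rw [h2]
    simp [chain]

open Expr

variable {n D P b : ℕ} {G : SimpleGraph (Fin n)} {X : Fin n → Fin n → Option (Fin (D + 1))}
  {T : Fin n → Fin (D + 1) → Option (Fin n)} {M : Fin n → Fin (D + 1)} {u v : Fin n} {m m' : ℕ → ℕ}

/-! ### Flipping the Kempe chain -/

/-- Nonzero for the vertices of the Kempe chain. -/
def inChainE : Expr := or (load (markA pid)) (load (markA (add pid sizeE)))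

/-- The colors of the chain and the color missing at `u` are exchanged on the Kempe chain. -/
def flipWrites : List Write :=
  [.each sizeE inChainE (vertexA pid freeE) (load (vertexA pid chainE)),
   .each sizeE inChainE (vertexA pid chainE) (load (vertexA pid freeE)),
   .each sizeE (and inChainE (load (vertexA pid freeE)))
     (colorA pid (sub (load (vertexA pid freeE)) (const 1))) chainE,
   .each sizeE (and inChainE (load (vertexA pid chainE)))
     (colorA pid (sub (load (vertexA pid chainE)) (const 1))) freeE,
   .each sizeE (and inChainE (eq (load (missingA pid)) freeE)) (missingA pid) chainE,
   .each sizeE (and inChainE (eq (load (missingA pid)) chainE)) (missingA pid) freeE]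

theorem Ready.eval_inChainE (h : Ready m b G X T M u v) (x : ℕ) : inChainE.eval x m ≠ 0 ↔
    m (markCell n D b x).addr ≠ 0 ∨ m (markCell n D b (x + n)).addr ≠ 0 := by
  rw [inChainE, Ne, eval_or, eval_load, eval_load, h.base.eval_markA, h.base.eval_markA, eval_add,
    eval_pid, h.header.eval_sizeE]
  tauto

/-- If no vertex is marked, then nothing is written. -/
theorem frame_flip_of_unmarked {k : ℕ} (h : Ready m b G X T M u v)
    (hmark : ∀ x : Fin n, ¬ (m (markCell n D b x).addr ≠ 0 ∨ m (markCell n D b (x + n)).addr ≠ 0))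
    (hw : Written P flipWrites m m') : Frame n D k m m' := by
  have h0 : ∀ p < n, inChainE.eval p m = 0 := fun p hp => by
    have := mt (h.eval_inChainE p).1 (hmark ⟨p, hp⟩)
    simpa using this
  intro c hc
  have hne : c.addr ≠ 3 := fun e => hc (by
    rw [Cell.addr_injective (show c.addr = (Cell.trash : Cell n D).addr from e)]
    trivial)
  rcases hw c.addr hne with ⟨-, h1⟩ | ⟨p, w, hwm, hg, -⟩
  · exact h1
  · exfalso
    simp only [flipWrites, List.mem_cons, List.not_mem_nil, or_false] at hwm
    rcases hwm with rfl | rfl | rfl | rfl | rfl | rfl <;>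
    · simp only [Write.each, ne_eq, eval_and, eval_lt, h.header.eval_sizeE, eval_pid, not_or,
        not_le] at hg
      first
        | exact hg.2 (h0 p hg.1)
        | exact hg.2.1 (h0 p hg.1)

/-- The flip of the marked Kempe chain, in memory. -/
theorem ready_flip (hP : 2 * n ≤ P) (h : Ready m b G X T M u v) {d : Fin (D + 1)}
    (hd : m (Cell.scratch (b + 4) : Cell n D).addr = d + 1) {K : Set (Fin n)}
    (hmark : ∀ x : Fin n, m (markCell n D b x).addr ≠ 0 ∨ m (markCell n D b (x + n)).addr ≠ 0 ↔
      x ∈ K)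
    (hK : ∀ x ∈ K, ∀ c y, c = M u ∨ c = d → T x c = some y → y ∈ K)
    (hw : Written P flipWrites m m') :
    Ready m' b G (flipColor K (M u) d X) (flipVertex K (M u) d T) (flipMissing K (M u) d M) u v ∧
      ∀ i, m' (Cell.scratch i : Cell n D).addr = m (Cell.scratch i : Cell n D).addr := by
  classical
  have hH := h.header
  have hg : ∀ x : Fin n, inChainE.eval x m ≠ 0 ↔ x ∈ K := fun x => by rw [h.eval_inChainE, hmark]
  have hfree : ∀ p, freeE.eval p m = M u + 1 := fun p => h.eval_freeE
  have hchain : ∀ p, chainE.eval p m = d + 1 := fun p => by rw [h.eval_chainE, hd]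
  have hTa : ∀ x : Fin n, (load (vertexA pid freeE)).eval x m = enc (T x (M u)) := fun x =>
    h.eval_vertexA rfl (hfree _)
  have hTd : ∀ x : Fin n, (load (vertexA pid chainE)).eval x m = enc (T x d) := fun x =>
    h.eval_vertexA rfl (hchain _)
  have hMx : ∀ x : Fin n, (load (missingA pid)).eval x m = M x + 1 := fun x => h.eval_missingA rfl
  have hN : ∀ p, sizeE.eval p m = n := fun p => hH.eval_sizeE
  have hP' : n ≤ P := by omega
  have hl := List.Forall₂.cons
    (Write.emits_each (D := D) (P := P) (m := m) (N := sizeE) (g := inChainE)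
      (a := vertexA pid freeE) (v := load (vertexA pid chainE)) hN hP'
      (fun x => x ∈ K) (fun x => .entry x (.vertexOf (M u))) (fun x => enc (T x d)) hg
      (fun x _ => ⟨hH.eval_vertexA rfl (hfree _), hTd x⟩))
    (.cons (Write.emits_each (D := D) (P := P) (m := m) (N := sizeE) (g := inChainE)
      (a := vertexA pid chainE) (v := load (vertexA pid freeE)) hN hP'
      (fun x => x ∈ K) (fun x => .entry x (.vertexOf d)) (fun x => enc (T x (M u))) hg
      (fun x _ => ⟨hH.eval_vertexA rfl (hchain _), hTa x⟩))
    (.cons (Write.emits_each (D := D) (P := P) (m := m) (N := sizeE)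
      (g := and inChainE (load (vertexA pid freeE)))
      (a := colorA pid (sub (load (vertexA pid freeE)) (const 1))) (v := chainE) hN hP'
      (fun x => x ∈ K ∧ ∃ y, T x (M u) = some y)
      (fun x => .entry x (.colorOf ((T x (M u)).getD x))) (fun x => d + 1)
      (fun x => by
        rw [Ne, eval_and, not_or, ← Ne, hg, hTa, enc_eq_zero, ← Ne, Option.ne_none_iff_exists'])
      (fun x hx => by
        obtain ⟨-, y, hy⟩ := hx
        exact ⟨hH.eval_colorA rfl (by rw [eval_sub, hTa]; simp [hy]), hchain _⟩))
    (.cons (Write.emits_each (D := D) (P := P) (m := m) (N := sizeE)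
      (g := and inChainE (load (vertexA pid chainE)))
      (a := colorA pid (sub (load (vertexA pid chainE)) (const 1))) (v := freeE) hN hP'
      (fun x => x ∈ K ∧ ∃ y, T x d = some y)
      (fun x => .entry x (.colorOf ((T x d).getD x))) (fun x => M u + 1)
      (fun x => by
        rw [Ne, eval_and, not_or, ← Ne, hg, hTd, enc_eq_zero, ← Ne, Option.ne_none_iff_exists'])
      (fun x hx => by
        obtain ⟨-, y, hy⟩ := hx
        exact ⟨hH.eval_colorA rfl (by rw [eval_sub, hTd]; simp [hy]), hfree _⟩))
    (.cons (Write.emits_each (D := D) (P := P) (m := m) (N := sizeE)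
      (g := and inChainE (eq (load (missingA pid)) freeE)) (a := missingA pid) (v := chainE) hN hP'
      (fun x => x ∈ K ∧ M x = M u) (fun x => .entry x .missing) (fun x => d + 1)
      (fun x => by
        rw [Ne, eval_and, not_or, ← Ne, hg, eval_eq, hMx, hfree, not_not, Nat.add_right_cancel_iff,
          Fin.val_inj])
      (fun x _ => ⟨hH.eval_missingA rfl, hchain _⟩))
    (.cons (Write.emits_each (D := D) (P := P) (m := m) (N := sizeE)
      (g := and inChainE (eq (load (missingA pid)) chainE)) (a := missingA pid) (v := freeE) hN hP'
      (fun x => x ∈ K ∧ M x = d) (fun x => .entry x .missing) (fun x => M u + 1)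
      (fun x => by
        rw [Ne, eval_and, not_or, ← Ne, hg, eval_eq, hMx, hchain, not_not, Nat.add_right_cancel_iff,
          Fin.val_inj])
      (fun x _ => ⟨hH.eval_missingA rfl, hfree _⟩)) .nil)))))
  have hread := fun c hc => hw.read hl c hc
  simp only [List.mem_cons, List.not_mem_nil, or_false, forall_eq_or_imp, exists_eq_or_imp,
    forall_eq, exists_eq_left] at hread
  have hsame : ∀ c : Cell n D, c ≠ .trash → (∀ x f, c ≠ .entry x f) → m' c.addr = m c.addr := by
    intro c hc hce
    simpa [hce] using hread c hc
  have hscratch : ∀ i, m' (Cell.scratch i : Cell n D).addr = m (Cell.scratch i : Cell n D).addr :=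
    fun i => hsame _ (by simp) (by simp)
  have hbase : m' 2 = m 2 := hsame .base (by simp) (by simp)
  have hvertex : ∀ x c, m' (Cell.entry x (.vertexOf c) : Cell n D).addr =
      enc (flipVertex K (M u) d T x c) := by
    intro x c
    have := hread (.entry x (.vertexOf c)) (by simp)
    simp only [Cell.entry.injEq, Field.vertexOf.injEq, reduceCtorEq, and_false, false_and,
      exists_false, or_false, not_false_iff, implies_true, and_true] at this
    rcases this with ⟨⟨h1, h2⟩, h3⟩ | ⟨y, hy, ⟨rfl, rfl⟩, h1⟩ | ⟨y, hy, ⟨rfl, rfl⟩, h1⟩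
    · rw [h3, h.vertexOf]
      by_cases hx : x ∈ K
      · have h4 : c ≠ M u := fun e => h1 _ ⟨x, hx, ⟨rfl, e⟩, rfl⟩
        have h5 : c ≠ d := fun e => h2 _ ⟨x, hx, ⟨rfl, e⟩, rfl⟩
        simp [flipVertex, hx, Equiv.swap_apply_of_ne_of_ne h4 h5]
      · simp [flipVertex, hx]
    · simp [h1, flipVertex, hy]
    · simp [h1, flipVertex, hy]
  have hcolor : ∀ x y, m' (Cell.entry x (.colorOf y) : Cell n D).addr =
      enc (flipColor K (M u) d X x y) := by
    intro x y
    have := hread (.entry x (.colorOf y)) (by simp)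
    simp only [Cell.entry.injEq, Field.colorOf.injEq, reduceCtorEq, and_false, false_and,
      exists_false, or_false, not_false_iff, implies_true, and_true, true_and, false_or] at this
    rcases this with ⟨⟨h1, h2⟩, h3⟩ | ⟨z, ⟨hz, w, hw⟩, ⟨rfl, rfl⟩, h1⟩ |
      ⟨z, ⟨hz, w, hw⟩, ⟨rfl, rfl⟩, h1⟩
    · rw [h3, h.colorOf]
      by_cases hx : x ∈ K
      · cases hXc : X x y with
        | none => simp [flipColor, hx, hXc]
        | some c =>
          have hT := (h.isColoring.vertex x c y).2 hXc
          have h4 : c ≠ M u := fun e => by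
            subst e
            exact h1 _ ⟨x, ⟨hx, y, hT⟩, ⟨rfl, by simp [hT]⟩, rfl⟩
          have h5 : c ≠ d := fun e => by
            subst e
            exact h2 _ ⟨x, ⟨hx, y, hT⟩, ⟨rfl, by simp [hT]⟩, rfl⟩
          simp [flipColor, hx, hXc, Equiv.swap_apply_of_ne_of_ne h4 h5]
      · simp [flipColor, hx]
    · have := (h.isColoring.vertex _ _ _).1 hw
      rw [h1]
      simp [flipColor, hz, hw, this]
    · have := (h.isColoring.vertex _ _ _).1 hw
      rw [h1]
      simp [flipColor, hz, hw, this]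
  have hmissing : ∀ x, m' (Cell.entry x .missing : Cell n D).addr =
      flipMissing K (M u) d M x + 1 := by
    intro x
    have := hread (.entry x .missing) (by simp)
    simp only [Cell.entry.injEq, reduceCtorEq, and_false, false_and,
      exists_false, not_false_iff, implies_true, and_true, true_and, false_or] at this
    rcases this with ⟨⟨h1, h2⟩, h3⟩ | ⟨z, ⟨hz, hw⟩, rfl, h1⟩ | ⟨z, ⟨hz, hw⟩, rfl, h1⟩
    · rw [h3, h.missing]
      by_cases hx : x ∈ K
      · have h4 : M x ≠ M u := fun e => h1 _ ⟨x, ⟨hx, e⟩, rfl, rfl⟩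
        have h5 : M x ≠ d := fun e => h2 _ ⟨x, ⟨hx, e⟩, rfl, rfl⟩
        simp [flipMissing, hx, Equiv.swap_apply_of_ne_of_ne h4 h5]
      · simp [flipMissing, hx]
    · simp [h1, flipMissing, hz, hw]
    · simp [h1, flipMissing, hz, hw]
  have hlists : ∀ (x : Fin n) (f : Field n D), (f = .degree ∨ (∃ w, f = .position w) ∨
      ∃ i, f = .neighbor i) → m' (Cell.entry x f).addr = m (Cell.entry x f).addr := by
    intro x f hf
    have := hread (.entry x f) (by simp)
    rcases hf with rfl | ⟨w, rfl⟩ | ⟨i, rfl⟩ <;> simpa using this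
  refine ⟨⟨⟨⟨?_, h.isColoring.flip hK, hcolor, hvertex, fun x => ?_, fun x y hxy => ?_⟩, hmissing,
    flip_free h.free⟩, hbase.trans h.base, (hscratch _).trans h.left, (hscratch _).trans h.right⟩,
    hscratch⟩
  · exact hH.congr (hsame .size (by simp) (by simp)) (hsame .bound (by simp) (by simp))
      (hsame .work (by simp) (by simp)) fun x => hsame _ (by simp) (by simp)
  · rw [hlists _ _ (by simp), h.degree]
  · obtain ⟨i, h1, h2, h3⟩ := h.neighbor x y hxy
    exact ⟨i, h1, by rw [hlists _ _ (by simp), h2], by rw [hlists _ _ (by simp), h3]⟩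

/-! ### Making the fan end -/

/-- The tables are changed so that the fan ends. -/
def openFan : Stmt := .seq markFan (.seq collide (.seq markChain (.assign flipWrites)))

/-- The number of steps of `openFan`. -/
def openFanTime (n : ℕ) : ℕ := markFanTime n +
  (assignCost announceWrites + assignCost collideWrites + (markChainTime n + assignCost flipWrites))

theorem runs_openFan (hP : 2 * n ≤ P) (h : Ready m b G X T M u v) (huv : ¬ G.Adj u v) :
    Runs P openFan (openFanTime n) m fun m' =>
      (∀ i < b + 4, m' (Cell.scratch i : Cell n D).addr = m (Cell.scratch i : Cell n D).addr) ∧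
      ∃ X' T' M', Ready m' b G X' T' M' u v ∧
        ∃ t ∈ reach (fan T' M' u) v, fan (D := D) T' M' u t = t := by
  refine Runs.seq ((runs_markFan hP h).mono le_rfl ?_)
  rintro m₁ ⟨hF₁, hcolor, hmark⟩
  have h₁ := hF₁.ready (by omega) h
  refine Runs.seq ((runs_collide hP h₁ hcolor hmark).mono le_rfl ?_)
  rintro m₂ ⟨hF₂, hcase⟩
  have h₂ := hF₂.ready (by omega) h₁
  have hF₁₂ := hF₁.trans hF₂
  rcases hcase with ⟨hcolor₂, hno⟩ | ⟨x, hx, y, hy, hFx, hFy, hne, hxy, hcolor₂⟩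
  · refine Runs.seq ((runs_markChain hP h₂ (o := none) hcolor₂).mono le_rfl ?_)
    rintro m₃ ⟨hF₃, hmark₃⟩
    refine Runs.assign fun m₄ hw => ?_
    have h₃ := hF₃.ready (by omega) h₂
    have hF₄ : Frame n D (b + 4) m₃ m₄ :=
      frame_flip_of_unmarked h₃ (fun x => by rw [hmark₃]; simp) hw
    refine ⟨fun i hi => ?_, X, T, M, hF₄.ready (by omega) h₃, ?_⟩
    · exact (hF₁₂.trans ((hF₃.mono (by omega)).trans hF₄)) _
        (by simp only [Cell.Private]; omega)
    · rcases fan_fixed_or_collision h.isColoring huv with ht | ⟨x, hx, y, hy, hFx, hFy, hne, hxy⟩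
      · exact ht
      · exact absurd (hno x hx y hy hFx hFy hxy) hne
  · refine Runs.seq ((runs_markChain hP h₂ (o := some (M x)) hcolor₂).mono le_rfl ?_)
    rintro m₃ ⟨hF₃, hmark₃⟩
    refine Runs.assign fun m₄ hw => ?_
    have h₃ := hF₃.ready (by omega) h₂
    obtain ⟨h₄, hscratch⟩ := ready_flip hP h₃ (d := M x) (K := chain T (M u) (M x) u)
      (by rw [hF₃ _ (by simp [Cell.Private]), hcolor₂])
      (fun x => by rw [hmark₃]; simp)
      (fun x hx c y hc hxy => chain_closed h.isColoring (h.free u) hx hc hxy) hw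
    refine ⟨fun i hi => ?_, _, _, _, h₄, ?_⟩
    · rw [hscratch]
      exact (hF₁₂.trans (hF₃.mono (by omega))) _ (by simp only [Cell.Private]; omega)
    · exact fan_flip_fixed h.isColoring h.free hx hy hFx hFy hne hxy

open Expr

variable {n D P b : ℕ} {G : SimpleGraph (Fin n)} {X : Fin n → Fin n → Option (Fin (D + 1))}
  {T : Fin n → Fin (D + 1) → Option (Fin n)} {M : Fin n → Fin (D + 1)} {u v : Fin n} {m m' : ℕ → ℕ}

/-! ### Shifting the colors along the fan -/

theorem neighborSet_sup_edge (huv : u ≠ v) (x : Fin n) :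
    (G ⊔ SimpleGraph.edge u v).neighborSet x =
      G.neighborSet x ∪ {y | (x = u ∧ y = v) ∨ (x = v ∧ y = u)} := by
  ext y
  simp only [SimpleGraph.mem_neighborSet, SimpleGraph.sup_adj, SimpleGraph.edge_adj, Set.mem_union,
    Set.mem_ofPred_eq]
  constructor
  · rintro (h | ⟨h, -⟩)
    · exact .inl h
    · exact .inr h
  · rintro (h | h)
    · exact .inl h
    · refine .inr ⟨h, ?_⟩
      rcases h with ⟨rfl, rfl⟩ | ⟨rfl, rfl⟩
      · exact huv
      · exact huv.symm

theorem ncard_neighborSet_left (huv : u ≠ v) (hadj : ¬ G.Adj u v) :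
    ((G ⊔ SimpleGraph.edge u v).neighborSet u).ncard = (G.neighborSet u).ncard + 1 := by
  have : (G ⊔ SimpleGraph.edge u v).neighborSet u = insert v (G.neighborSet u) := by
    rw [neighborSet_sup_edge huv]
    ext y
    simp [huv, or_comm]
  rw [this]
  exact Set.ncard_insert_of_notMem hadj (Set.toFinite _)

theorem ncard_neighborSet_right (huv : u ≠ v) (hadj : ¬ G.Adj u v) :
    ((G ⊔ SimpleGraph.edge u v).neighborSet v).ncard = (G.neighborSet v).ncard + 1 := by
  rw [SimpleGraph.edge_comm]
  exact ncard_neighborSet_left huv.symm fun h => hadj h.symm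

theorem neighborSet_of_ne (huv : u ≠ v) {x : Fin n} (hu : x ≠ u) (hv : x ≠ v) :
    (G ⊔ SimpleGraph.edge u v).neighborSet x = G.neighborSet x := by
  rw [neighborSet_sup_edge huv]
  simp [hu, hv]

/-- The color to be shifted to the edge from `u` to this vertex. -/
def ownE : Expr := load (missingA pid)
/-- The old color of the edge from `u` to this vertex. -/
def oldE : Expr := load (colorA uE pid)
/-- Nonzero for the vertices of the fan. -/
def inFanE : Expr := load (markA pid)

/-- The edge from `u` to a vertex of the fan gets the color missing at that vertex, and the old
color is missing there from now on. The two endpoints of the new edge are added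
to the adjacency lists. -/
def rotateWrites : List Write :=
  [.each sizeE inFanE (vertexA pid ownE) (add uE (const 1)),
   .each sizeE (and inFanE oldE) (vertexA pid oldE) (const 0),
   .each sizeE inFanE (colorA pid uE) ownE,
   .each sizeE inFanE (colorA uE pid) ownE,
   .each sizeE inFanE (vertexA uE ownE) (add pid (const 1)),
   .each sizeE (and inFanE oldE) (missingA pid) oldE,
   .solo (const 1) (positionA uE vE) (load (degreeA uE)),
   .solo (const 1) (positionA vE uE) (load (degreeA vE)),
   .solo (const 1) (neighborA uE (load (degreeA uE))) vE,
   .solo (const 1) (neighborA vE (load (degreeA vE))) uE,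
   .solo (const 1) (degreeA uE) (add (load (degreeA uE)) (const 1)),
   .solo (const 1) (degreeA vE) (add (load (degreeA vE)) (const 1))]

/-- After the shift, the tables describe a coloring of the graph with the new edge; the cells for
the missing colors are right except, possibly, at the endpoints of the new edge. -/
theorem holdsTables_rotate (hP : 2 * n ≤ P) (h : Ready m b G X T M u v) (huv : u ≠ v)
    (hadj : ¬ G.Adj u v) (hdeg : MaxDegreeLE (G ⊔ SimpleGraph.edge u v) D)
    (hmark : ∀ x : Fin n, m (markCell n D b x).addr ≠ 0 ↔ x ∈ reach (fan T M u) v)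
    {t : Fin n} (ht : t ∈ reach (fan T M u) v) (hft : fan T M u t = t)
    (hw : Written P rotateWrites m m') :
    (∀ i, m' (Cell.scratch i : Cell n D).addr = m (Cell.scratch i : Cell n D).addr) ∧
    m' 2 = m 2 ∧
    ∃ X' T', HoldsTables m' (G ⊔ SimpleGraph.edge u v) X' T' ∧ ∃ M' : Fin n → Fin (D + 1),
      ∀ x, x ≠ u → x ≠ v → m' (Cell.entry x .missing : Cell n D).addr = M' x + 1 ∧
        T' x (M' x) = none := by
  classical
  have hH := h.header
  have hI := h.isColoring
  have hn : 0 < n := u.pos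
  set R := reach (fan T M u) v with hR
  obtain ⟨T', hI', hT1, hT2, hT3, hT4, hT5, hT6⟩ := exists_rotate hI h.free huv hadj hR ht hft
  have huR : u ∉ R := notMem_fan hI huv
  have hg : ∀ x : Fin n, inFanE.eval x m ≠ 0 ↔ x ∈ R := fun x => by
    rw [inFanE, eval_load, h.base.eval_markA, eval_pid, hmark]
  have hu : ∀ p, uE.eval p m = u := fun p => h.eval_uE
  have hv : ∀ p, vE.eval p m = v := fun p => h.eval_vE
  have hown : ∀ x : Fin n, ownE.eval x m = M x + 1 := fun x => h.eval_missingA rfl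
  have hold : ∀ x : Fin n, oldE.eval x m = enc (X u x) := fun x => h.eval_colorA (hu _) rfl
  have hgold : ∀ x : Fin n, (and inFanE oldE).eval x m ≠ 0 ↔ x ∈ R ∧ ∃ c, X u x = some c :=
    fun x => by
      rw [Ne, eval_and, not_or, ← Ne, hg, hold, enc_eq_zero, ← Ne, Option.ne_none_iff_exists']
  have hN : ∀ p, sizeE.eval p m = n := fun p => hH.eval_sizeE
  have hP' : n ≤ P := by omega
  have hdu : ∀ p, (load (degreeA uE)).eval p m = (G.neighborSet u).ncard := fun p =>
    h.eval_degreeA (hu p)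
  have hdv : ∀ p, (load (degreeA vE)).eval p m = (G.neighborSet v).ncard := fun p =>
    h.eval_degreeA (hv p)
  have hltu : (G.neighborSet u).ncard < D := by
    have := hdeg u
    rwa [ncard_neighborSet_left huv hadj] at this
  have hltv : (G.neighborSet v).ncard < D := by
    have := hdeg v
    rwa [ncard_neighborSet_right huv hadj] at this
  have hl := List.Forall₂.cons
    (Write.emits_each (D := D) (P := P) (m := m) (N := sizeE) (g := inFanE)
      (a := vertexA pid ownE) (v := add uE (const 1)) hN hP'
      (fun x => x ∈ R) (fun x => .entry x (.vertexOf (M x))) (fun x => u + 1) hg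
      (fun x _ => ⟨hH.eval_vertexA rfl (hown _), by rw [eval_add, hu]; rfl⟩))
    (.cons (Write.emits_each (D := D) (P := P) (m := m) (N := sizeE) (g := and inFanE oldE)
      (a := vertexA pid oldE) (v := const 0) hN hP'
      (fun x => x ∈ R ∧ ∃ c, X u x = some c) (fun x => .entry x (.vertexOf ((X u x).getD 0)))
      (fun x => 0) hgold
      (fun x hx => by
        obtain ⟨-, c, hc⟩ := hx
        exact ⟨hH.eval_vertexA rfl (by rw [hold, hc]; rfl), rfl⟩))
    (.cons (Write.emits_each (D := D) (P := P) (m := m) (N := sizeE) (g := inFanE)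
      (a := colorA pid uE) (v := ownE) hN hP'
      (fun x => x ∈ R) (fun x => .entry x (.colorOf u)) (fun x => M x + 1) hg
      (fun x _ => ⟨hH.eval_colorA rfl (hu _), hown x⟩))
    (.cons (Write.emits_each (D := D) (P := P) (m := m) (N := sizeE) (g := inFanE)
      (a := colorA uE pid) (v := ownE) hN hP'
      (fun x => x ∈ R) (fun x => .entry u (.colorOf x)) (fun x => M x + 1) hg
      (fun x _ => ⟨hH.eval_colorA (hu _) rfl, hown x⟩))
    (.cons (Write.emits_each (D := D) (P := P) (m := m) (N := sizeE) (g := inFanE)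
      (a := vertexA uE ownE) (v := add pid (const 1)) hN hP'
      (fun x => x ∈ R) (fun x => .entry u (.vertexOf (M x))) (fun x => x + 1) hg
      (fun x _ => ⟨hH.eval_vertexA (hu _) (hown x), rfl⟩))
    (.cons (Write.emits_each (D := D) (P := P) (m := m) (N := sizeE) (g := and inFanE oldE)
      (a := missingA pid) (v := oldE) hN hP'
      (fun x => x ∈ R ∧ ∃ c, X u x = some c) (fun x => .entry x .missing)
      (fun x => enc (X u x)) hgold (fun x _ => ⟨hH.eval_missingA rfl, hold x⟩))
    (.cons (Write.emits_solo (D := D) (P := P) (m := m) (g := const 1)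
      (a := positionA uE vE) (v := load (degreeA uE)) (by omega) True (.entry u (.position v))
      (G.neighborSet u).ncard (by simp) (fun _ => ⟨hH.eval_positionA (hu _) (hv _), hdu _⟩))
    (.cons (Write.emits_solo (D := D) (P := P) (m := m) (g := const 1)
      (a := positionA vE uE) (v := load (degreeA vE)) (by omega) True (.entry v (.position u))
      (G.neighborSet v).ncard (by simp) (fun _ => ⟨hH.eval_positionA (hv _) (hu _), hdv _⟩))
    (.cons (Write.emits_solo (D := D) (P := P) (m := m) (g := const 1)
      (a := neighborA uE (load (degreeA uE))) (v := vE) (by omega) True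
      (.entry u (.neighbor ⟨_, hltu⟩)) v (by simp)
      (fun _ => ⟨hH.eval_neighborA (hu _) (hdu _), hv _⟩))
    (.cons (Write.emits_solo (D := D) (P := P) (m := m) (g := const 1)
      (a := neighborA vE (load (degreeA vE))) (v := uE) (by omega) True
      (.entry v (.neighbor ⟨_, hltv⟩)) u (by simp)
      (fun _ => ⟨hH.eval_neighborA (hv _) (hdv _), hu _⟩))
    (.cons (Write.emits_solo (D := D) (P := P) (m := m) (g := const 1)
      (a := degreeA uE) (v := add (load (degreeA uE)) (const 1)) (by omega) True
      (.entry u .degree) ((G.neighborSet u).ncard + 1) (by simp)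
      (fun _ => ⟨hH.eval_degreeA (hu _), by rw [eval_add, hdu]; rfl⟩))
    (.cons (Write.emits_solo (D := D) (P := P) (m := m) (g := const 1)
      (a := degreeA vE) (v := add (load (degreeA vE)) (const 1)) (by omega) True
      (.entry v .degree) ((G.neighborSet v).ncard + 1) (by simp)
      (fun _ => ⟨hH.eval_degreeA (hv _), by rw [eval_add, hdv]; rfl⟩)) .nil)))))))))))
  have hread := fun c hc => hw.read hl c hc
  simp only [List.mem_cons, List.not_mem_nil, or_false, forall_eq_or_imp, exists_eq_or_imp,
    forall_eq, exists_eq_left, true_and] at hread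
  clear hl
  have hsame : ∀ c : Cell n D, c ≠ .trash → (∀ x f, c ≠ .entry x f) → m' c.addr = m c.addr := by
    intro c hc hce
    simpa [hce] using hread c hc
  refine ⟨fun i => hsame _ (by simp) (by simp), hsame .base (by simp) (by simp), _, T',
    ⟨?_, hI', ?_, ?_, ?_, ?_⟩, ?_⟩
  · exact hH.congr (hsame .size (by simp) (by simp)) (hsame .bound (by simp) (by simp))
      (hsame .work (by simp) (by simp)) fun x => hsame _ (by simp) (by simp)
  · intro x y
    have := hread (.entry x (.colorOf y)) (by simp)
    simp only [Cell.entry.injEq, Field.colorOf.injEq, reduceCtorEq, and_false, false_and,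
      exists_false, or_false, not_false_iff, implies_true, and_true, true_and, false_or] at this
    rcases this with ⟨⟨h1, h2⟩, h3⟩ | ⟨z, hz, ⟨rfl, rfl⟩, h1⟩ | ⟨z, hz, ⟨rfl, rfl⟩, h1⟩
    · have h4 : ¬ (x = u ∧ y ∈ R) := fun h4 => h2 _ ⟨y, h4.2, ⟨h4.1, rfl⟩, rfl⟩
      have h5 : ¬ (y = u ∧ x ∈ R) := fun h5 => h1 _ ⟨x, h5.2, ⟨rfl, h5.1⟩, rfl⟩
      rw [h3, h.colorOf, rotateColor, if_neg h4, if_neg h5]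
    · rw [h1]
      simp [rotateColor, hz, huR]
    · rw [h1]
      simp [rotateColor, hz]
  · intro x c
    have := hread (.entry x (.vertexOf c)) (by simp)
    simp only [Cell.entry.injEq, Field.vertexOf.injEq, reduceCtorEq, and_false, false_and,
      exists_false, or_false, not_false_iff, implies_true, and_true, true_and, false_or] at this
    rcases this with ⟨⟨h1, h2, h3⟩, h4⟩ | ⟨z, hz, ⟨rfl, rfl⟩, h1⟩ |
      ⟨z, ⟨hz, c', hc'⟩, ⟨rfl, rfl⟩, h1⟩ | ⟨z, hz, ⟨rfl, rfl⟩, h1⟩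
    · rw [h4, h.vertexOf]
      congr 1
      by_cases hxu : x = u
      · subst hxu
        exact (hT2 c fun y hy e => h3 _ ⟨y, hy, ⟨rfl, e.symm⟩, rfl⟩).symm
      · by_cases hx : x ∈ R
        · refine (hT5 x hx c (fun e => h1 _ ⟨x, hx, ⟨rfl, e⟩, rfl⟩) fun e => ?_).symm
          exact h2 _ ⟨x, ⟨hx, c, e⟩, ⟨rfl, by rw [e]; rfl⟩, rfl⟩
        · rw [hT6 x hx hxu]
    · rw [h1, hT3 _ hz, enc_some]
    · rw [h1, hT4 _ hz _ (by rw [hc']; rfl), enc_none]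
    · rw [h1, hT1 _ hz, enc_some]
  · intro x
    have := hread (.entry x .degree) (by simp)
    simp only [Cell.entry.injEq, reduceCtorEq, and_false, false_and, and_true,
      exists_false, not_false_iff, implies_true, true_and, false_or] at this
    rcases this with ⟨⟨h1, h2⟩, h3⟩ | ⟨rfl, h1⟩ | ⟨rfl, h1⟩
    · have h4 : x ≠ u := fun e => h1 _ ⟨e, rfl⟩
      have h5 : x ≠ v := fun e => h2 _ ⟨e, rfl⟩
      rw [h3, h.degree, neighborSet_of_ne huv h4 h5]
    · rw [h1, ncard_neighborSet_left huv hadj]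
    · rw [h1, ncard_neighborSet_right huv hadj]
  · have hpos : ∀ x y, ¬ (x = u ∧ y = v) → ¬ (x = v ∧ y = u) →
        m' (Cell.entry x (.position y) : Cell n D).addr =
          m (Cell.entry x (.position y) : Cell n D).addr := by
      intro x y h1 h2
      have := hread (.entry x (.position y)) (by simp)
      simpa [h1, h2] using this
    have hposu : m' (Cell.entry u (.position v) : Cell n D).addr = (G.neighborSet u).ncard := by
      have := hread (.entry u (.position v)) (by simp)
      simpa [huv] using this
    have hposv : m' (Cell.entry v (.position u) : Cell n D).addr = (G.neighborSet v).ncard := by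
      have := hread (.entry v (.position u)) (by simp)
      simpa [huv.symm] using this
    have hnbr : ∀ x (i : Fin D), (i : ℕ) < (G.neighborSet x).ncard →
        m' (Cell.entry x (.neighbor i) : Cell n D).addr =
          m (Cell.entry x (.neighbor i) : Cell n D).addr := by
      intro x i hi
      have := hread (.entry x (.neighbor i)) (by simp)
      have h1 : ¬ (x = u ∧ i = ⟨_, hltu⟩) := by
        rintro ⟨rfl, rfl⟩
        exact lt_irrefl _ hi
      have h2 : ¬ (x = v ∧ i = ⟨_, hltv⟩) := by
        rintro ⟨rfl, rfl⟩
        exact lt_irrefl _ hi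
      simpa [h1, h2] using this
    have hnbru : m' (Cell.entry u (.neighbor ⟨_, hltu⟩) : Cell n D).addr = v := by
      have := hread (.entry u (.neighbor ⟨_, hltu⟩)) (by simp)
      simpa [huv] using this
    have hnbrv : m' (Cell.entry v (.neighbor ⟨_, hltv⟩) : Cell n D).addr = u := by
      have := hread (.entry v (.neighbor ⟨_, hltv⟩)) (by simp)
      simpa [huv.symm] using this
    intro x y hxy
    by_cases h1 : x = u ∧ y = v
    · obtain ⟨rfl, rfl⟩ := h1
      exact ⟨⟨_, hltu⟩, by rw [ncard_neighborSet_left huv hadj]; exact Nat.lt_succ_self _,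
        hposu, hnbru⟩
    by_cases h2 : x = v ∧ y = u
    · obtain ⟨rfl, rfl⟩ := h2
      exact ⟨⟨_, hltv⟩, by rw [ncard_neighborSet_right huv hadj]; exact Nat.lt_succ_self _,
        hposv, hnbrv⟩
    have hxy' : G.Adj x y := by
      have : y ∈ (G ⊔ SimpleGraph.edge u v).neighborSet x := hxy
      rw [neighborSet_sup_edge huv] at this
      rcases this with h3 | h3 | h3
      · exact h3
      · exact absurd h3 h1
      · exact absurd h3 h2
    obtain ⟨i, h3, h4, h5⟩ := h.neighbor x y hxy'
    refine ⟨i, h3.trans_le ?_, by rw [hpos x y h1 h2, h4], by rw [hnbr x i h3, h5]⟩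
    refine Set.ncard_le_ncard (fun z hz => ?_) (Set.toFinite _)
    exact .inl hz
  · refine ⟨fun x => if x ∈ R then (X u x).getD 0 else M x, fun x hxu hxv => ?_⟩
    have := hread (.entry x .missing) (by simp)
    simp only [Cell.entry.injEq, reduceCtorEq, and_false, false_and, and_true,
      exists_false, or_false, not_false_iff, implies_true, true_and, false_or] at this
    rcases this with ⟨h1, h2⟩ | ⟨z, ⟨hz, c, hc⟩, rfl, h1⟩
    · have hx : x ∉ R := fun hx => by
        have h3 := (mem_fan_adj hI hx).resolve_left hxv
        rw [← hI.isSome, Option.isSome_iff_exists] at h3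
        exact h1 _ ⟨x, ⟨hx, h3⟩, rfl, rfl⟩
      simp only [if_neg hx, h2, hT6 x hx hxu]
      exact ⟨h.missing x, h.free x⟩
    · simp only [if_pos hz, h1, hc]
      exact ⟨rfl, hT4 x hz c hc⟩

/-! ### New missing colors at the endpoints -/

/-- Nonzero if this processor has the number of a color that is missing at `x`. -/
def freeAtE (x : Expr) : Expr :=
  and (not (lt (load (const 1)) pid)) (not (load (vertexA x (add pid (const 1)))))

/-- Every processor whose number is that of a missing color offers this color. -/
def refillWrites : List Write :=
  [.each sizeE (freeAtE uE) (missingA uE) (add pid (const 1)),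
   .each sizeE (freeAtE vE) (missingA vE) (add pid (const 1))]

/-- Some color with a number below `n` is missing at `x`, so that `n` processors find one however
large `D` is. -/
theorem exists_free_lt (h : IsColoring G X T) (hdeg : MaxDegreeLE G D) (x : Fin n) :
    ∃ c : Fin (D + 1), (c : ℕ) < n ∧ T x c = none := by
  classical
  by_contra! hno
  -- otherwise these colors have distinct neighbors, all different from `x`
  have h1 : ∀ c : Fin (min (D + 1) n), ∃ y, T x ⟨c, by omega⟩ = some y := fun c =>
    Option.ne_none_iff_exists'.1 (hno ⟨c, by omega⟩ (by simp only; omega))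
  choose f hf using h1
  have hadj : ∀ c, G.Adj x (f c) := fun c => by
    rw [← h.isSome, (h.vertex _ _ _).1 (hf c)]; rfl
  have hinj : Function.Injective f := fun c c' e => by
    have h2 := (h.vertex _ _ _).1 (hf c)
    rw [e, (h.vertex _ _ _).1 (hf c')] at h2
    have := congrArg Fin.val (Option.some.inj h2)
    exact Fin.ext this.symm
  have hle : min (D + 1) n ≤ (G.neighborSet x).ncard := by
    have h2 : (Set.range f).ncard = min (D + 1) n := by
      rw [Set.ncard_eq_toFinset_card', Set.toFinset_range, Finset.card_image_of_injective _ hinj]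
      simp
    rw [← h2]
    exact Set.ncard_le_ncard (by rintro _ ⟨c, rfl⟩; exact hadj c) (Set.toFinite _)
  have hlt : (G.neighborSet x).ncard < n := by
    have h2 : (G.neighborSet x).ncard < (Set.univ : Set (Fin n)).ncard :=
      Set.ncard_lt_ncard ⟨Set.subset_univ _, fun h3 => G.irrefl (h3 (Set.mem_univ x))⟩
        (Set.toFinite _)
    simpa [Set.ncard_univ] using h2
  have := hdeg x
  omega

theorem holds_refill (hP : 2 * n ≤ P) (h : HoldsTables m G X T) (hdeg : MaxDegreeLE G D)
    (huv : u ≠ v) (hM : ∀ x, x ≠ u → x ≠ v →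
      m (Cell.entry x .missing : Cell n D).addr = M x + 1 ∧ T x (M x) = none)
    (hu : ∀ p, uE.eval p m = u) (hv : ∀ p, vE.eval p m = v) (hw : Written P refillWrites m m') :
    (∀ i, m' (Cell.scratch i : Cell n D).addr = m (Cell.scratch i : Cell n D).addr) ∧
    m' 2 = m 2 ∧ ∃ M', Holds m' G X T M' := by
  have hH := h.header
  have hfree : ∀ (e : Expr) (w : Fin n), (∀ p, e.eval p m = w) → ∀ x : Fin n,
      (freeAtE e).eval x m ≠ 0 ↔ ∃ hx : (x : ℕ) < D + 1, T w ⟨x, hx⟩ = none := by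
    intro e w he x
    by_cases hx : (x : ℕ) < D + 1
    · have h1 := h.eval_vertexA (p := x) (e := e) (k := add pid (const 1)) (c := ⟨x, hx⟩) (he _) rfl
      simp only [freeAtE, ne_eq, eval_and, eval_not, eval_lt, h1, enc_eq_zero, eval_load,
        eval_const, eval_pid, hH.eval_bound, hx, exists_true_left]
      have : (x : ℕ) ≤ D := by omega
      simp [this]
    · simp only [freeAtE, ne_eq, eval_and, eval_not, eval_lt, eval_load, eval_const, eval_pid,
        hH.eval_bound, hx, IsEmpty.exists_iff, iff_false, not_not]
      exact .inl (by omega)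
  have hl := List.Forall₂.cons
    (Write.emits_each (D := D) (P := P) (m := m) (N := sizeE) (g := freeAtE uE)
      (a := missingA uE) (v := add pid (const 1)) (fun p => hH.eval_sizeE) (by omega)
      (fun x => ∃ hx : (x : ℕ) < D + 1, T u ⟨x, hx⟩ = none) (fun x => .entry u .missing)
      (fun x => x + 1) (hfree uE u hu) (fun x _ => ⟨hH.eval_missingA (hu _), rfl⟩))
    (.cons (Write.emits_each (D := D) (P := P) (m := m) (N := sizeE) (g := freeAtE vE)
      (a := missingA vE) (v := add pid (const 1)) (fun p => hH.eval_sizeE) (by omega)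
      (fun x => ∃ hx : (x : ℕ) < D + 1, T v ⟨x, hx⟩ = none) (fun x => .entry v .missing)
      (fun x => x + 1) (hfree vE v hv) (fun x _ => ⟨hH.eval_missingA (hv _), rfl⟩)) .nil)
  have hread := fun c hc => hw.read hl c hc
  simp only [List.mem_cons, List.not_mem_nil, or_false, forall_eq_or_imp, exists_eq_or_imp,
    forall_eq, exists_eq_left] at hread
  have hsame : ∀ c : Cell n D, c ≠ .trash → (∀ x, c ≠ .entry x .missing) →
      m' c.addr = m c.addr := by
    intro c hc hce
    simpa [hce] using hread c hc
  have hmiss : ∀ x, ∃ c : Fin (D + 1),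
      m' (Cell.entry x .missing : Cell n D).addr = c + 1 ∧ T x c = none := by
    intro x
    have := hread (.entry x .missing) (by simp)
    simp only [Cell.entry.injEq, and_true] at this
    rcases this with ⟨⟨h1, h2⟩, h3⟩ | ⟨y, ⟨hy, hT⟩, rfl, h1⟩ | ⟨y, ⟨hy, hT⟩, rfl, h1⟩
    · obtain ⟨c, hc, hT⟩ := exists_free_lt h.isColoring hdeg x
      have hxu : x ≠ u := fun e => h1 _ ⟨⟨c, hc⟩, ⟨c.isLt, e ▸ hT⟩, e, rfl⟩
      have hxv : x ≠ v := fun e => h2 _ ⟨⟨c, hc⟩, ⟨c.isLt, e ▸ hT⟩, e, rfl⟩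
      exact ⟨M x, h3.trans (hM x hxu hxv).1, (hM x hxu hxv).2⟩
    · exact ⟨_, h1, hT⟩
    · exact ⟨_, h1, hT⟩
  choose M' hM' hM'' using hmiss
  have hH' : Header n D m' := hH.congr (hsame .size (by simp) (by simp))
    (hsame .bound (by simp) (by simp)) (hsame .work (by simp) (by simp))
    fun x => hsame _ (by simp) (by simp)
  exact ⟨fun i => hsame _ (by simp) (by simp), hsame .base (by simp) (by simp), M',
    h.congr hH' fun x f hf => hsame _ (by simp) (by simp [hf]), hM', hM''⟩

/-! ### Insertion of an edge -/

/-- Insertion of the edge whose endpoints are in the first two cells of the scratch space. -/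
def insertEdge : Stmt :=
  .seq openFan (.seq markFan (.seq (.assign rotateWrites) (.assign refillWrites)))

/-- The number of steps of `insertEdge`. -/
def insertEdgeTime (n : ℕ) : ℕ :=
  openFanTime n + (markFanTime n + (assignCost rotateWrites + assignCost refillWrites))

theorem runs_insertEdge (hP : 2 * n ≤ P) (h : Ready m b G X T M u v) (huv : u ≠ v)
    (hadj : ¬ G.Adj u v) (hdeg : MaxDegreeLE (G ⊔ SimpleGraph.edge u v) D) :
    Runs P insertEdge (insertEdgeTime n) m fun m' => HasBase n D b m' ∧
      (∀ i < b + 4, m' (Cell.scratch i : Cell n D).addr = m (Cell.scratch i : Cell n D).addr) ∧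
      ∃ X' T' M', Holds (D := D) m' (G ⊔ SimpleGraph.edge u v) X' T' M' := by
  refine Runs.seq ((runs_openFan hP h hadj).mono le_rfl ?_)
  rintro m₁ ⟨hs₁, X₁, T₁, M₁, h₁, t, ht, hft⟩
  refine Runs.seq ((runs_markFan hP h₁).mono le_rfl ?_)
  rintro m₂ ⟨hF, -, hmark⟩
  have h₂ := hF.ready (by omega) h₁
  refine Runs.seq (Runs.assign fun m₃ hw₃ => Runs.assign fun m₄ hw₄ => ?_)
  obtain ⟨hs₃, hb₃, X₃, T₃, h₃, M₃, hM₃⟩ :=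
    holdsTables_rotate hP h₂ huv hadj hdeg hmark ht hft hw₃
  have hb : HasBase n D b m₃ := hb₃.trans h₂.base
  have hu : ∀ p, uE.eval p m₃ = u := fun p => by
    rw [uE, eval_load, hb.eval_scratchA, hs₃]
    exact h₂.left
  have hv : ∀ p, vE.eval p m₃ = v := fun p => by
    rw [vE, eval_load, hb.eval_scratchA, hs₃]
    exact h₂.right
  obtain ⟨hs₄, hb₄, M₄, h₄⟩ := holds_refill hP h₃ hdeg huv hM₃ hu hv hw₄
  refine ⟨hb₄.trans hb, fun i hi => ?_, X₃, T₃, M₄, h₄⟩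
  rw [hs₄, hs₃, hF _ (by simp only [Cell.Private]; omega), hs₁ i hi]

open Expr

variable {n D P b : ℕ} {G : SimpleGraph (Fin n)} {X : Fin n → Fin n → Option (Fin (D + 1))}
  {T : Fin n → Fin (D + 1) → Option (Fin n)} {M : Fin n → Fin (D + 1)} {u v : Fin n} {m m' : ℕ → ℕ}

/-! ### The program for one edge -/

/-- The edge given in cells `2` and `3` is copied to the beginning of the workspace, which becomes
the scratch space. -/
def insertionInitWrites : List Write :=
  [.solo (const 1) (load (const 4)) (load (const 2)),
   .solo (const 1) (add (load (const 4)) (const 1)) (load (const 3)),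
   .solo (const 1) (const 2) (load (const 4))]

/-- Insertion of the edge given in cells `2` and `3`. -/
def insertion : Stmt := .seq (.assign insertionInitWrites) insertEdge

theorem Header.eval_work (h : Header n D m) : m 4 = workspace n D := h.work

theorem runs_insertion (hP : 2 * n ≤ P) (h : Holds m G X T M) (hu : m 2 = u) (hv : m 3 = v)
    (huv : u ≠ v) (hadj : ¬ G.Adj u v) (hdeg : MaxDegreeLE (G ⊔ SimpleGraph.edge u v) D) :
    Runs P insertion (assignCost insertionInitWrites + insertEdgeTime n) m
      (StoresColoring D (G ⊔ SimpleGraph.edge u v)) := by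
  have hH := h.header
  have hn : 0 < n := u.pos
  refine Runs.seq (Runs.assign fun m₁ hw => ?_)
  have hl := List.Forall₂.cons
    (Write.emits_solo (n := n) (D := D) (P := P) (m := m) (g := const 1)
      (a := load (const 4)) (v := load (const 2)) (by omega) True (.scratch 0) u (by simp)
      (fun _ => ⟨hH.eval_work, hu⟩))
    (.cons (Write.emits_solo (n := n) (D := D) (P := P) (m := m) (g := const 1)
      (a := add (load (const 4)) (const 1)) (v := load (const 3)) (by omega) True (.scratch 1) v
      (by simp) (fun _ => ⟨by simp [hH.eval_work, Cell.addr], hv⟩))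
    (.cons (Write.emits_solo (n := n) (D := D) (P := P) (m := m) (g := const 1)
      (a := const 2) (v := load (const 4)) (by omega) True .base (workspace n D)
      (by simp) (fun _ => ⟨rfl, hH.eval_work⟩)) .nil))
  have hread := fun c hc => hw.read hl c hc
  simp only [List.mem_cons, List.not_mem_nil, or_false, forall_eq_or_imp, exists_eq_or_imp,
    forall_eq, exists_eq_left, true_and] at hread
  have hH' : Header n D m₁ := hH.congr (by simpa using hread .size (by simp))
    (by simpa using hread .bound (by simp)) (by simpa using hread .work (by simp))
    fun x => by simpa using hread (.pointer x) (by simp)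
  have h₁ : Ready m₁ 0 G X T M u v :=
    ⟨h.congr hH' fun x f => by simpa using hread (.entry x f) (by simp),
      by simpa [HasBase] using hread .base (by simp), by simpa using hread (.scratch 0) (by simp),
      by simpa using hread (.scratch 1) (by simp)⟩
  refine (runs_insertEdge hP h₁ huv hadj hdeg).mono le_rfl ?_
  rintro m₂ ⟨-, -, X', T', M', h₂⟩
  exact h₂.storesColoring

/-! ### Deletion of an edge -/

/-- An endpoint of the edge to be deleted. -/
def delE : Expr := load (const 2)
/-- The other endpoint of the edge to be deleted. -/
def delE' : Expr := load (const 3)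
/-- The color of the edge to be deleted. -/
def delColorE : Expr := load (colorA delE delE')
/-- The last entry of the adjacency list of `x`. -/
def lastE (x : Expr) : Expr := load (neighborA x (sub (load (degreeA x)) (const 1)))

/-- The edge is removed from the tables, its color is missing at its endpoints from now on, and the
gaps in the adjacency lists are filled with the last entries. -/
def deletionWrites : List Write :=
  [.solo (const 1) (vertexA delE delColorE) (const 0),
   .solo (const 1) (vertexA delE' delColorE) (const 0),
   .solo (const 1) (colorA delE delE') (const 0),
   .solo (const 1) (colorA delE' delE) (const 0),
   .solo (const 1) (missingA delE) delColorE,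
   .solo (const 1) (missingA delE') delColorE,
   .solo (const 1) (degreeA delE) (sub (load (degreeA delE)) (const 1)),
   .solo (const 1) (degreeA delE') (sub (load (degreeA delE')) (const 1)),
   .solo (const 1) (neighborA delE (load (positionA delE delE'))) (lastE delE),
   .solo (const 1) (neighborA delE' (load (positionA delE' delE))) (lastE delE'),
   .solo (const 1) (positionA delE (lastE delE)) (load (positionA delE delE')),
   .solo (const 1) (positionA delE' (lastE delE')) (load (positionA delE' delE))]

/-- Every entry of an adjacency list up to the degree is a neighbor. -/
theorem HoldsTables.exists_neighbor (h : HoldsTables m G X T) (x : Fin n) {k : ℕ}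
    (hk : k < (G.neighborSet x).ncard) : ∃ y, G.Adj x y ∧ ∃ i : Fin D, (i : ℕ) = k ∧
      m (Cell.entry x (.position y) : Cell n D).addr = i ∧
      m (Cell.entry x (.neighbor i) : Cell n D).addr = y := by
  classical
  set pos := fun y => m (Cell.entry x (.position y) : Cell n D).addr
  have hinj : Set.InjOn pos (G.neighborSet x) := by
    intro y hy z hz hyz
    obtain ⟨i, -, h1, h2⟩ := h.neighbor x y hy
    obtain ⟨j, -, h3, h4⟩ := h.neighbor x z hz
    have : i = j := Fin.ext (by rw [← h1, ← h3]; exact hyz)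
    subst this
    exact Fin.ext (h2.symm.trans h4)
  have hsub : pos '' G.neighborSet x ⊆ Set.Iio (G.neighborSet x).ncard := by
    rintro _ ⟨y, hy, rfl⟩
    obtain ⟨i, h1, h2, -⟩ := h.neighbor x y hy
    exact h2.trans_lt h1
  have heq := Set.eq_of_subset_of_ncard_le hsub (by
    rw [hinj.ncard_image, ← Finset.coe_Iio, Set.ncard_coe_finset, Nat.card_Iio])
    (Set.finite_Iio _)
  obtain ⟨y, hy, hyk⟩ : k ∈ pos '' G.neighborSet x := by rw [heq]; exact hk
  obtain ⟨i, h1, h2, h3⟩ := h.neighbor x y hy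
  exact ⟨y, hy, i, h2.symm.trans hyk, h2, h3⟩

/-- Removal of `z` from the adjacency list of `x`: the last entry `l` moves to the position `p` of
`z`. -/
theorem HoldsTables.neighbor_remove (h : HoldsTables m G X T) {x z l : Fin n} {p q : Fin D}
    (hz : m (Cell.entry x (.position z) : Cell n D).addr = p)
    (hp : (p : ℕ) < (G.neighborSet x).ncard)
    (hpz : m (Cell.entry x (.neighbor p) : Cell n D).addr = z)
    (hq : (q : ℕ) = (G.neighborSet x).ncard - 1)
    (hl : m (Cell.entry x (.position l) : Cell n D).addr = q)
    (hql : m (Cell.entry x (.neighbor q) : Cell n D).addr = l)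
    (h1 : m' (Cell.entry x (.position l) : Cell n D).addr = p)
    (h2 : m' (Cell.entry x (.neighbor p) : Cell n D).addr = l)
    (h3 : ∀ y, y ≠ l → m' (Cell.entry x (.position y) : Cell n D).addr =
      m (Cell.entry x (.position y) : Cell n D).addr)
    (h4 : ∀ i, i ≠ p → m' (Cell.entry x (.neighbor i) : Cell n D).addr =
      m (Cell.entry x (.neighbor i) : Cell n D).addr) (y : Fin n) (hy : G.Adj x y) (hyz : y ≠ z) :
    ∃ i : Fin D, (i : ℕ) < (G.neighborSet x).ncard - 1 ∧
      m' (Cell.entry x (.position y) : Cell n D).addr = i ∧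
      m' (Cell.entry x (.neighbor i) : Cell n D).addr = y := by
  by_cases hyl : y = l
  · subst hyl
    have hpq : (p : ℕ) ≠ q := fun e => hyz (Fin.ext (by rw [← hql, ← hpz, Fin.ext e]))
    exact ⟨p, by omega, h1, h2⟩
  · obtain ⟨i, h5, h6, h7⟩ := h.neighbor x y hy
    have hiq : (i : ℕ) ≠ q := fun e => hyl (Fin.ext (by rw [← h7, ← hql, Fin.ext e]))
    have hip : i ≠ p := fun e => hyz (Fin.ext (by rw [← h7, ← hpz, e]))
    exact ⟨i, by omega, by rw [h3 y hyl, h6], by rw [h4 i hip, h7]⟩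

/-- The deletion of an edge is a single synchronous assignment of one processor. -/
theorem storesColoring_delete (hP : 1 ≤ P) (h : Holds m G X T M) (hu : m 2 = u) (hv : m 3 = v)
    (hadj : G.Adj u v) (hw : Written P deletionWrites m m') :
    StoresColoring D (G.deleteEdges {s(u, v)}) m' := by
  classical
  have hH := h.header
  have hI := h.isColoring
  have huv : u ≠ v := hadj.ne
  have huE : delE.eval 0 m = u := hu
  have hvE : delE'.eval 0 m = v := hv
  obtain ⟨c, hc⟩ := Option.isSome_iff_exists.1 ((hI.isSome u v).2 hadj)
  have hc' : X v u = some c := by rw [hI.symm, hc]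
  have hTu := (hI.vertex u c v).2 hc
  have hTv := (hI.vertex v c u).2 hc'
  have hcE : delColorE.eval 0 m = c + 1 := (h.eval_colorA huE hvE).trans (by rw [hc]; rfl)
  have hdu : (load (degreeA delE)).eval 0 m = (G.neighborSet u).ncard := h.eval_degreeA huE
  have hdv : (load (degreeA delE')).eval 0 m = (G.neighborSet v).ncard := h.eval_degreeA hvE
  obtain ⟨p, hp1, hp2, hp3⟩ := h.neighbor u v hadj
  obtain ⟨p', hp1', hp2', hp3'⟩ := h.neighbor v u hadj.symm
  obtain ⟨l, hul, q, hq1, hq2, hq3⟩ := h.exists_neighbor u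
    (k := (G.neighborSet u).ncard - 1) (by omega)
  obtain ⟨l', hvl, q', hq1', hq2', hq3'⟩ := h.exists_neighbor v
    (k := (G.neighborSet v).ncard - 1) (by omega)
  have hpE : (load (positionA delE delE')).eval 0 m = p := by
    rw [eval_load, hH.eval_positionA huE hvE, hp2]
  have hpE' : (load (positionA delE' delE)).eval 0 m = p' := by
    rw [eval_load, hH.eval_positionA hvE huE, hp2']
  have hlE : (lastE delE).eval 0 m = l := by
    rw [lastE, eval_load, hH.eval_neighborA huE (j := q) (by rw [eval_sub, hdu, hq1]; rfl), hq3]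
  have hlE' : (lastE delE').eval 0 m = l' := by
    rw [lastE, eval_load, hH.eval_neighborA hvE (j := q') (by rw [eval_sub, hdv, hq1']; rfl), hq3']
  have key : ∀ {a e : Expr} {cell : Cell n D} {k : ℕ}, a.eval 0 m = cell.addr → e.eval 0 m = k →
      (Write.solo (const 1) a e).Emits P m fun c y => True ∧ c = cell ∧ y = k := fun h1 h2 =>
    Write.emits_solo hP True _ _ (by simp) fun _ => ⟨h1, h2⟩
  have hl := List.Forall₂.cons (key (hH.eval_vertexA huE hcE) (eval_const 0 m 0))
    (.cons (key (hH.eval_vertexA hvE hcE) (eval_const 0 m 0))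
    (.cons (key (hH.eval_colorA huE hvE) (eval_const 0 m 0))
    (.cons (key (hH.eval_colorA hvE huE) (eval_const 0 m 0))
    (.cons (key (hH.eval_missingA huE) hcE)
    (.cons (key (hH.eval_missingA hvE) hcE)
    (.cons (key (e := sub (load (degreeA delE)) (const 1)) (hH.eval_degreeA huE)
      (by rw [eval_sub, hdu, eval_const]))
    (.cons (key (e := sub (load (degreeA delE')) (const 1)) (hH.eval_degreeA hvE)
      (by rw [eval_sub, hdv, eval_const]))
    (.cons (key (hH.eval_neighborA huE hpE) hlE)
    (.cons (key (hH.eval_neighborA hvE hpE') hlE')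
    (.cons (key (hH.eval_positionA huE hlE) hpE)
    (.cons (key (hH.eval_positionA hvE hlE') hpE') .nil)))))))))))
  have hread := fun c hc => hw.read hl c hc
  simp only [List.mem_cons, List.not_mem_nil, or_false, forall_eq_or_imp, exists_eq_or_imp,
    forall_eq, exists_eq_left, true_and] at hread
  clear hl
  have hH' : Header n D m' := hH.congr (by simpa using hread .size (by simp))
    (by simpa using hread .bound (by simp)) (by simpa using hread .work (by simp))
    fun x => by simpa using hread (.pointer x) (by simp)
  have hnu : (G.deleteEdges {s(u, v)}).neighborSet u = G.neighborSet u \ {v} := by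
    ext y
    simp [SimpleGraph.deleteEdges_adj, huv]
  have hnv : (G.deleteEdges {s(u, v)}).neighborSet v = G.neighborSet v \ {u} := by
    ext y
    simp [SimpleGraph.deleteEdges_adj, huv.symm]
  have hn : ∀ x, x ≠ u → x ≠ v →
      (G.deleteEdges {s(u, v)}).neighborSet x = G.neighborSet x := by
    intro x hxu hxv
    ext y
    simp [SimpleGraph.deleteEdges_adj, hxu, hxv]
  have hcu : (G.neighborSet u \ {v}).ncard = (G.neighborSet u).ncard - 1 :=
    Set.ncard_sdiff_singleton_of_mem hadj
  have hcv : (G.neighborSet v \ {u}).ncard = (G.neighborSet v).ncard - 1 :=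
    Set.ncard_sdiff_singleton_of_mem hadj.symm
  refine Holds.storesColoring (X := fun x y =>
    if (x = u ∧ y = v) ∨ (x = v ∧ y = u) then none else X x y)
    (T := fun x k => if (x = u ∨ x = v) ∧ k = c then none else T x k)
    (M := fun x => if x = u ∨ x = v then c else M x)
    ⟨⟨hH', ⟨?_, ?_, ?_⟩, ?_, ?_, ?_, ?_⟩, ?_, ?_⟩
  · intro x y
    rw [hI.symm x y]
    congr 1
    simp only [eq_iff_iff]
    tauto
  · intro x y
    simp only [SimpleGraph.deleteEdges_adj, Set.mem_singleton_iff, Sym2.eq_iff]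
    split_ifs with h1
    · simp [h1]
    · simp [h1, hI.isSome]
  · intro x k y
    by_cases h1 : (x = u ∨ x = v) ∧ k = c
    · rw [if_pos h1]
      obtain ⟨h1, rfl⟩ := h1
      refine iff_of_false (by simp) fun h2 => ?_
      split_ifs at h2 with h3
      rw [← hI.vertex] at h2
      rcases h1 with rfl | rfl
      · rw [hTu] at h2
        exact h3 (.inl ⟨rfl, (Option.some.inj h2).symm⟩)
      · rw [hTv] at h2
        exact h3 (.inr ⟨rfl, (Option.some.inj h2).symm⟩)
    · rw [if_neg h1]
      by_cases h2 : (x = u ∧ y = v) ∨ (x = v ∧ y = u)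
      · rw [if_pos h2]
        refine iff_of_false (fun h3 => ?_) (by simp)
        rw [hI.vertex] at h3
        rcases h2 with ⟨rfl, rfl⟩ | ⟨rfl, rfl⟩
        · rw [hc] at h3
          exact h1 ⟨.inl rfl, (Option.some.inj h3).symm⟩
        · rw [hc'] at h3
          exact h1 ⟨.inr rfl, (Option.some.inj h3).symm⟩
      · rw [if_neg h2, hI.vertex]
  · intro x y
    have := hread (.entry x (.colorOf y)) (by simp)
    simp only [Cell.entry.injEq, Field.colorOf.injEq, reduceCtorEq, and_false, false_and,
      or_false, not_false_iff, implies_true, and_true, true_and, false_or] at this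
    rcases this with ⟨⟨h1, h2⟩, h3⟩ | ⟨⟨rfl, rfl⟩, h1⟩ | ⟨⟨rfl, rfl⟩, h1⟩
    · rw [h3, h.colorOf, if_neg]
      rintro (h4 | h4)
      · exact h1 _ ⟨h4, rfl⟩
      · exact h2 _ ⟨h4, rfl⟩
    · rw [h1]; simp
    · rw [h1]; simp
  · intro x k
    have := hread (.entry x (.vertexOf k)) (by simp)
    simp only [Cell.entry.injEq, Field.vertexOf.injEq, reduceCtorEq, and_false, false_and,
      or_false, not_false_iff, implies_true, and_true] at this
    rcases this with ⟨⟨h1, h2⟩, h3⟩ | ⟨⟨rfl, rfl⟩, h1⟩ | ⟨⟨rfl, rfl⟩, h1⟩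
    · rw [h3, h.vertexOf, if_neg]
      rintro ⟨h4 | h4, h5⟩
      · exact h1 _ ⟨⟨h4, h5⟩, rfl⟩
      · exact h2 _ ⟨⟨h4, h5⟩, rfl⟩
    · rw [h1]; simp
    · rw [h1]; simp
  · intro x
    have := hread (.entry x .degree) (by simp)
    simp only [Cell.entry.injEq, reduceCtorEq, and_false, false_and,
      or_false, not_false_iff, implies_true, and_true, true_and, false_or] at this
    rcases this with ⟨⟨h1, h2⟩, h3⟩ | ⟨rfl, h1⟩ | ⟨rfl, h1⟩
    · rw [h3, h.degree, hn x (fun e => h1 _ ⟨e, rfl⟩) fun e => h2 _ ⟨e, rfl⟩]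
    · rw [h1, hnu, hcu]
    · rw [h1, hnv, hcv]
  · have hpos : ∀ x y, ¬ (x = u ∧ y = l) → ¬ (x = v ∧ y = l') →
        m' (Cell.entry x (.position y) : Cell n D).addr =
          m (Cell.entry x (.position y) : Cell n D).addr := by
      intro x y h1 h2
      have := hread (.entry x (.position y)) (by simp)
      simpa [h1, h2] using this
    have hnbr : ∀ x i, ¬ (x = u ∧ i = p) → ¬ (x = v ∧ i = p') →
        m' (Cell.entry x (.neighbor i) : Cell n D).addr =
          m (Cell.entry x (.neighbor i) : Cell n D).addr := by
      intro x i h1 h2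
      have := hread (.entry x (.neighbor i)) (by simp)
      simpa [h1, h2] using this
    intro x y hxy
    rw [SimpleGraph.deleteEdges_adj, Set.mem_singleton_iff] at hxy
    obtain ⟨hxy, hne⟩ := hxy
    by_cases hxu : x = u
    · subst hxu
      rw [hnu, hcu]
      exact h.neighbor_remove hp2 hp1 hp3 hq1 hq2 hq3
        (by simpa [huv] using hread (.entry x (.position l)) (by simp))
        (by simpa [huv] using hread (.entry x (.neighbor p)) (by simp))
        (fun y hy => hpos x y (by simp [hy]) (by simp [huv]))
        (fun i hi => hnbr x i (by simp [hi]) (by simp [huv])) y hxy (fun e => hne (by rw [e]))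
    by_cases hxv : x = v
    · subst hxv
      rw [hnv, hcv]
      exact h.neighbor_remove hp2' hp1' hp3' hq1' hq2' hq3'
        (by simpa [huv.symm] using hread (.entry x (.position l')) (by simp))
        (by simpa [huv.symm] using hread (.entry x (.neighbor p')) (by simp))
        (fun y hy => hpos x y (by simp [huv.symm]) (by simp [hy]))
        (fun i hi => hnbr x i (by simp [huv.symm]) (by simp [hi])) y hxy
        (fun e => hne (by rw [e, Sym2.eq_swap]))
    rw [hn x hxu hxv]
    obtain ⟨i, h1, h2, h3⟩ := h.neighbor x y hxy
    exact ⟨i, h1, by rw [hpos x y (by simp [hxu]) (by simp [hxv]), h2],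
      by rw [hnbr x i (by simp [hxu]) (by simp [hxv]), h3]⟩
  · intro x
    have := hread (.entry x .missing) (by simp)
    simp only [Cell.entry.injEq, reduceCtorEq, and_false, false_and,
      or_false, not_false_iff, implies_true, and_true, true_and, false_or] at this
    rcases this with ⟨⟨h1, h2⟩, h3⟩ | ⟨rfl, h1⟩ | ⟨rfl, h1⟩
    · rw [h3, h.missing, if_neg]
      rintro (h4 | h4)
      · exact h1 _ ⟨h4, rfl⟩
      · exact h2 _ ⟨h4, rfl⟩
    · rw [h1]; simp
    · rw [h1]; simp
  · intro x
    by_cases hx : x = u ∨ x = v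
    · simp [hx]
    · simp [hx, h.free]

/-! ### Insertion of a list of edges -/

/-- The first cell after the list. -/
def listEndE : Expr := add (add (load (const 4)) (load (const 2))) (load (const 2))

/-- The scratch space begins after the list; it holds the number of edges inserted so far, and the
number of all edges to be inserted. -/
def batchInitWrites : List Write :=
  [.solo (const 1) (const 2) listEndE,
   .solo (const 1) (add listEndE (const 2)) (const 0),
   .solo (const 1) (add listEndE (const 3)) (load (const 2))]

/-- The number of edges inserted so far. -/
def countE : Expr := load (scratchA (const 2))

/-- The next edge of the list is copied to the scratch space. -/
def fetchWrites : List Write :=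
  [.solo (const 1) (scratchA (const 0)) (load (add (load (const 4)) (add countE countE))),
   .solo (const 1) (scratchA (const 1))
     (load (add (add (load (const 4)) (add countE countE)) (const 1)))]

/-- One more edge is inserted. -/
def countWrites : List Write := [.solo (const 1) (scratchA (const 2)) (add countE (const 1))]

/-- The condition under which there are edges left. -/
def batchCond : Expr := lt countE (load (scratchA (const 3)))

/-- Insertion of the next edge of the list. -/
def batchStep : Stmt := .seq (.assign fetchWrites) (.seq insertEdge (.assign countWrites))

/-- Insertion of the edges of a list of length `m 2` at the beginning of the workspace. -/
def batch : Stmt := .seq (.assign batchInitWrites) (.loop batchCond batchStep)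

/-- The number of steps of `batchStep`. -/
def batchStepTime (n : ℕ) : ℕ :=
  assignCost fetchWrites + (insertEdgeTime n + assignCost countWrites)

section Batch

variable {K : ℕ} {e : Fin K → Fin n × Fin n}

/-- The graph after the insertion of the first `i` edges of a list. -/
def insertFirst (G : SimpleGraph (Fin n)) (e : Fin K → Fin n × Fin n) (i : ℕ) :
    SimpleGraph (Fin n) :=
  G ⊔ SimpleGraph.fromEdgeSet {s | ∃ j : Fin K, (j : ℕ) < i ∧ s((e j).1, (e j).2) = s}

theorem insertFirst_zero : insertFirst G e 0 = G := by
  simp [insertFirst]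

theorem insertFirst_succ {i : ℕ} (hi : i < K) : insertFirst G e (i + 1) =
    insertFirst G e i ⊔ SimpleGraph.edge (e ⟨i, hi⟩).1 (e ⟨i, hi⟩).2 := by
  rw [insertFirst, insertFirst, SimpleGraph.edge, sup_assoc,
    ← SimpleGraph.fromEdgeSet_union]
  congr 2
  ext s
  simp only [Set.mem_ofPred_eq, Set.mem_union, Set.mem_singleton_iff]
  constructor
  · rintro ⟨j, hj, rfl⟩
    rcases Nat.lt_succ_iff_lt_or_eq.1 hj with hj | hj
    · exact .inl ⟨j, hj, rfl⟩
    · right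
      rw [Fin.ext hj (b := ⟨i, hi⟩)]
  · rintro (⟨j, hj, rfl⟩ | rfl)
    · exact ⟨j, by omega, rfl⟩
    · exact ⟨⟨i, hi⟩, Nat.lt_succ_self i, rfl⟩

theorem insertFirst_all : insertFirst G e K =
    G ⊔ SimpleGraph.fromEdgeSet (Set.range fun i => s((e i).1, (e i).2)) := by
  rw [insertFirst]
  congr 2
  ext s
  simp

theorem insertFirst_le {i : ℕ} : insertFirst G e i ≤
    G ⊔ SimpleGraph.fromEdgeSet (Set.range fun i => s((e i).1, (e i).2)) := by
  refine sup_le_sup_left (SimpleGraph.fromEdgeSet_mono ?_) _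
  rintro _ ⟨j, -, rfl⟩
  exact ⟨j, rfl⟩

theorem MaxDegreeLE.mono {G' : SimpleGraph (Fin n)} (h : MaxDegreeLE G' D) (hG : G ≤ G') :
    MaxDegreeLE G D := fun x =>
  (Set.ncard_le_ncard (fun _ hy => hG hy) (Set.toFinite _)).trans (h x)

theorem not_insertFirst_adj (he : ∀ i, (e i).1 ≠ (e i).2 ∧ ¬ G.Adj (e i).1 (e i).2)
    (hinj : Function.Injective (fun i => s((e i).1, (e i).2))) {i : ℕ} (hi : i < K) :
    ¬ (insertFirst G e i).Adj (e ⟨i, hi⟩).1 (e ⟨i, hi⟩).2 := by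
  rw [insertFirst, SimpleGraph.sup_adj, SimpleGraph.fromEdgeSet_adj]
  rintro (h | ⟨⟨j, hj, h⟩, -⟩)
  · exact (he _).2 h
  · have := hinj (a₁ := j) (a₂ := ⟨i, hi⟩) h
    rw [this] at hj
    exact lt_irrefl _ hj

/-- The state of the insertion of a list of edges after `i` insertions. -/
structure BatchState (G : SimpleGraph (Fin n)) (D : ℕ) (e : Fin K → Fin n × Fin n) (i : ℕ)
    (m : ℕ → ℕ) : Prop where
  holds : ∃ X T M, Holds (D := D) m (insertFirst G e i) X T M
  base : HasBase n D (2 * K) m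
  count : m (Cell.scratch (2 * K + 2) : Cell n D).addr = i
  total : m (Cell.scratch (2 * K + 3) : Cell n D).addr = K
  left : ∀ j : Fin K, m (Cell.scratch (2 * j) : Cell n D).addr = (e j).1
  right : ∀ j : Fin K, m (Cell.scratch (2 * j + 1) : Cell n D).addr = (e j).2

theorem runs_batchStep (hP : 2 * n ≤ P) (he : ∀ i, (e i).1 ≠ (e i).2 ∧ ¬ G.Adj (e i).1 (e i).2)
    (hinj : Function.Injective (fun i => s((e i).1, (e i).2)))
    (hdeg : MaxDegreeLE (G ⊔ SimpleGraph.fromEdgeSet (Set.range fun i => s((e i).1, (e i).2))) D)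
    {i : ℕ} (hi : i < K) (h : BatchState G D e i m) :
    Runs P batchStep (batchStepTime n) m (BatchState G D e (i + 1)) := by
  obtain ⟨X, T, M, hm⟩ := h.holds
  have hH := hm.header
  have hb := h.base
  set u := (e ⟨i, hi⟩).1 with hu
  set v := (e ⟨i, hi⟩).2 with hv
  have hn : 0 < n := u.pos
  have hcount : countE.eval 0 m = i := by
    rw [countE, eval_load, hb.eval_scratchA, eval_const, h.count]
  have hleft : (load (add (load (const 4)) (add countE countE))).eval 0 m = u := by
    have h1 := h.left ⟨i, hi⟩
    simp only [eval_load, eval_add, eval_const, hH.eval_work, hcount]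
    simp only [Cell.addr] at h1
    rw [← two_mul, h1]
  have hright :
      (load (add (add (load (const 4)) (add countE countE)) (const 1))).eval 0 m = v := by
    have h1 := h.right ⟨i, hi⟩
    simp only [eval_load, eval_add, eval_const, hH.eval_work, hcount]
    simp only [Cell.addr] at h1
    rw [← two_mul, add_assoc, h1]
  refine Runs.seq (Runs.assign fun m₁ hw => ?_)
  have hl := List.Forall₂.cons
    (Write.emits_solo (n := n) (D := D) (P := P) (m := m) (g := const 1) (a := scratchA (const 0))
      (by omega) True (.scratch (2 * K)) u (by simp) (fun _ => ⟨hb.eval_scratchA, hleft⟩))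
    (.cons (Write.emits_solo (n := n) (D := D) (P := P) (m := m) (g := const 1)
      (a := scratchA (const 1)) (by omega) True (.scratch (2 * K + 1)) v (by simp)
      (fun _ => ⟨hb.eval_scratchA, hright⟩)) .nil)
  have hread := fun c hc => hw.read hl c hc
  simp only [List.mem_cons, List.not_mem_nil, or_false, forall_eq_or_imp, exists_eq_or_imp,
    forall_eq, exists_eq_left, true_and] at hread
  have hother : ∀ k, k ≠ 2 * K → k ≠ 2 * K + 1 → m₁ (Cell.scratch k : Cell n D).addr =
      m (Cell.scratch k : Cell n D).addr := by
    intro k h1 h2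
    simpa [h1, h2] using hread (.scratch k) (by simp)
  have hH' : Header n D m₁ := hH.congr (by simpa using hread .size (by simp))
    (by simpa using hread .bound (by simp)) (by simpa using hread .work (by simp))
    fun x => by simpa using hread (.pointer x) (by simp)
  have h₁ : Ready m₁ (2 * K) (insertFirst G e i) X T M u v :=
    ⟨hm.congr hH' fun x f => by simpa using hread (.entry x f) (by simp),
      (by simpa using hread .base (by simp) : _ = m _).trans hb,
      by simpa using hread (.scratch (2 * K)) (by simp),
      by simpa using hread (.scratch (2 * K + 1)) (by simp)⟩
  refine Runs.seq ((runs_insertEdge hP h₁ (he _).1 (not_insertFirst_adj he hinj hi) ?_).mono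
    le_rfl ?_)
  · rw [← insertFirst_succ hi]
    exact hdeg.mono insertFirst_le
  rintro m₂ ⟨hb₂, hs₂, X₂, T₂, M₂, h₂⟩
  rw [← insertFirst_succ hi] at h₂
  refine Runs.assign fun m₃ hw₃ => ?_
  have hcount₂ : countE.eval 0 m₂ = i := by
    rw [countE, eval_load, hb₂.eval_scratchA, eval_const, hs₂ _ (by omega),
      hother _ (by omega) (by omega), h.count]
  have hl₃ := List.Forall₂.cons
    (Write.emits_solo (n := n) (D := D) (P := P) (m := m₂) (g := const 1) (a := scratchA (const 2))
      (v := add countE (const 1)) (by omega) True (.scratch (2 * K + 2)) (i + 1) (by simp)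
      (fun _ => ⟨hb₂.eval_scratchA, by rw [eval_add, hcount₂]; rfl⟩)) .nil
  have hread₃ := fun c hc => hw₃.read hl₃ c hc
  simp only [List.mem_singleton, forall_eq, exists_eq_left, true_and] at hread₃
  have hother₃ : ∀ k < 2 * K + 4, k ≠ 2 * K → k ≠ 2 * K + 1 → k ≠ 2 * K + 2 →
      m₃ (Cell.scratch k : Cell n D).addr = m (Cell.scratch k : Cell n D).addr := by
    intro k h0 h1 h2 h3
    rw [← hother k h1 h2, ← hs₂ k h0]
    simpa [h3] using hread₃ (.scratch k) (by simp)
  have hH₃ : Header n D m₃ := h₂.header.congr (by simpa using hread₃ .size (by simp))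
    (by simpa using hread₃ .bound (by simp)) (by simpa using hread₃ .work (by simp))
    fun x => by simpa using hread₃ (.pointer x) (by simp)
  refine ⟨⟨X₂, T₂, M₂, h₂.congr hH₃ fun x f => by simpa using hread₃ (.entry x f) (by simp)⟩,
    (by simpa using hread₃ .base (by simp) : _ = m₂ _).trans hb₂,
    by simpa using hread₃ (.scratch (2 * K + 2)) (by simp), ?_, fun j => ?_, fun j => ?_⟩
  · rw [hother₃ _ (by omega) (by omega) (by omega) (by omega), h.total]
  · have := j.isLt
    rw [hother₃ _ (by omega) (by omega) (by omega) (by omega), h.left]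
  · have := j.isLt
    rw [hother₃ _ (by omega) (by omega) (by omega) (by omega), h.right]

theorem runs_batch (hP : 2 * n ≤ P) (hn : 0 < n) (h : Holds m G X T M)
    (he : ∀ i, (e i).1 ≠ (e i).2 ∧ ¬ G.Adj (e i).1 (e i).2)
    (hinj : Function.Injective (fun i => s((e i).1, (e i).2)))
    (hdeg : MaxDegreeLE (G ⊔ SimpleGraph.fromEdgeSet (Set.range fun i => s((e i).1, (e i).2))) D)
    (hK : m 2 = K)
    (hlist : ∀ i : Fin K, m (workspace n D + 2 * i) = (e i).1 ∧
      m (workspace n D + 2 * i + 1) = (e i).2) :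
    Runs P batch (assignCost batchInitWrites +
        (K * (batchStepTime n + batchCond.cost + 3) + (batchCond.cost + 1))) m
      (StoresColoring D
        (G ⊔ SimpleGraph.fromEdgeSet (Set.range fun i => s((e i).1, (e i).2)))) := by
  have hH := h.header
  refine Runs.seq (Runs.assign fun m₁ hw => ?_)
  have hend : listEndE.eval 0 m = workspace n D + 2 * K := by
    simp only [listEndE, eval_add, eval_load, eval_const, hH.eval_work, hK]; omega
  have hl := List.Forall₂.cons
    (Write.emits_solo (n := n) (D := D) (P := P) (m := m) (g := const 1) (a := const 2)
      (v := listEndE) (by omega) True .base (workspace n D + 2 * K) (by simp)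
      (fun _ => ⟨rfl, hend⟩))
    (.cons (Write.emits_solo (n := n) (D := D) (P := P) (m := m) (g := const 1)
      (a := add listEndE (const 2)) (v := const 0) (by omega) True (.scratch (2 * K + 2)) 0
      (by simp) (fun _ => ⟨by rw [eval_add, hend, eval_const, Cell.addr, add_assoc], rfl⟩))
    (.cons (Write.emits_solo (n := n) (D := D) (P := P) (m := m) (g := const 1)
      (a := add listEndE (const 3)) (v := load (const 2)) (by omega) True (.scratch (2 * K + 3)) K
      (by simp) (fun _ => ⟨by rw [eval_add, hend, eval_const, Cell.addr, add_assoc], hK⟩)) .nil))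
  have hread := fun c hc => hw.read hl c hc
  simp only [List.mem_cons, List.not_mem_nil, or_false, forall_eq_or_imp, exists_eq_or_imp,
    forall_eq, exists_eq_left, true_and] at hread
  have hH' : Header n D m₁ := hH.congr (by simpa using hread .size (by simp))
    (by simpa using hread .bound (by simp)) (by simpa using hread .work (by simp))
    fun x => by simpa using hread (.pointer x) (by simp)
  have hother : ∀ k < 2 * K, m₁ (Cell.scratch k : Cell n D).addr =
      m (Cell.scratch k : Cell n D).addr := by
    intro k hk
    have h1 : k ≠ 2 * K + 2 := by omega
    have h2 : k ≠ 2 * K + 3 := by omega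
    simpa [h1, h2] using hread (.scratch k) (by simp)
  have h₁ : BatchState G D e 0 m₁ := by
    refine ⟨⟨X, T, M, ?_⟩, by simpa [HasBase] using hread .base (by simp),
      by simpa using hread (.scratch (2 * K + 2)) (by simp),
      by simpa using hread (.scratch (2 * K + 3)) (by simp), fun j => ?_, fun j => ?_⟩
    · rw [insertFirst_zero]
      exact h.congr hH' fun x f => by simpa using hread (.entry x f) (by simp)
    · rw [hother _ (by omega)]
      exact (hlist j).1
    · rw [hother _ (by omega)]
      exact (hlist j).2
  refine (Runs.loop (I := fun k m' => k ≤ K ∧ BatchState G D e (K - k) m') ?_ ?_ K m₁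
    ⟨le_rfl, by rwa [Nat.sub_self]⟩).mono le_rfl ?_
  · rintro k m' ⟨hk, hI⟩ p
    rw [batchCond, eval_lt, countE, eval_load, eval_load, hI.base.eval_scratchA,
      hI.base.eval_scratchA, eval_const, eval_const, hI.count, hI.total]
    omega
  · rintro k m' ⟨hk, hI⟩
    refine (runs_batchStep hP he hinj hdeg (by omega) hI).mono le_rfl fun m'' hI' => ⟨by omega, ?_⟩
    rwa [show K - (k + 1) + 1 = K - k by omega] at hI'
  · rintro m' ⟨-, hI⟩
    obtain ⟨X', T', M', h'⟩ := hI.holds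
    rw [Nat.sub_zero, insertFirst_all] at h'
    exact h'.storesColoring

end Batch

/-! ### Running times -/

theorem half_le_log {n : ℕ} (hn : 2 ≤ n) : 1 / 2 ≤ Real.log n := by
  have h1 : Real.log 2 ≤ Real.log n :=
    Real.log_le_log two_pos (by exact_mod_cast hn)
  linarith [Real.log_two_gt_d9]

theorem clog_le_log {n : ℕ} (hn : 2 ≤ n) : (Nat.clog 2 (2 * n) : ℝ) ≤ 5 * Real.log n := by
  have h0 : (0 : ℝ) < n := by exact_mod_cast (by omega : 0 < n)
  have h1 := Nat.pow_pred_clog_lt_self one_lt_two (x := 2 * n) (by omega)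
  have h2 : ((2 : ℝ) ^ (Nat.clog 2 (2 * n) - 1)) ≤ 2 * n := by exact_mod_cast h1.le
  have h3 := Real.log_le_log (by positivity) h2
  rw [Real.log_pow, Real.log_mul two_ne_zero h0.ne'] at h3
  have h4 : Real.log 2 ≤ Real.log n := Real.log_le_log two_pos (by exact_mod_cast hn)
  have h5 : (Nat.clog 2 (2 * n) : ℝ) ≤ (Nat.clog 2 (2 * n) - 1 : ℕ) + 1 := by
    exact_mod_cast (by omega : Nat.clog 2 (2 * n) ≤ Nat.clog 2 (2 * n) - 1 + 1)
  have h6 := Real.log_two_gt_d9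
  have h7 : (0 : ℝ) ≤ (Nat.clog 2 (2 * n) - 1 : ℕ) := Nat.cast_nonneg _
  nlinarith

theorem insertEdgeTime_le : ∃ A : ℕ, ∀ n : ℕ, 2 ≤ n → (insertEdgeTime n : ℝ) ≤ A * Real.log n := by
  refine ⟨5 * (3 * (assignCost jumpWrites + jumpCond.cost + 3)) + 2 * (3 * (jumpCond.cost + 1) +
    (2 * assignCost fanWrites + assignCost announceWrites + assignCost collideWrites +
      assignCost kempeWrites + assignCost flipWrites + assignCost rotateWrites +
      assignCost refillWrites)), fun n hn => ?_⟩
  have h1 := half_le_log hn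
  have h2 := clog_le_log hn
  simp only [insertEdgeTime, openFanTime, markFanTime, markChainTime, jumpTime]
  push_cast
  have h3 : (0 : ℝ) ≤ 3 * (assignCost jumpWrites + jumpCond.cost + 3) := by positivity
  have h4 : (0 : ℝ) ≤ 3 * (jumpCond.cost + 1) + (2 * assignCost fanWrites +
      assignCost announceWrites + assignCost collideWrites + assignCost kempeWrites +
      assignCost flipWrites + assignCost rotateWrites + assignCost refillWrites) := by positivity
  have h5 := mul_le_mul_of_nonneg_left h2 h3
  have h6 := mul_le_mul_of_nonneg_left h1 h4
  linarith

/-- The work outside of the insertions can be charged to the iterations. -/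
theorem batchTime_le {K : ℕ} (hK : 1 ≤ K) (n : ℕ) : assignCost batchInitWrites +
    (K * (batchStepTime n + batchCond.cost + 3) + (batchCond.cost + 1)) ≤
    K * (insertEdgeTime n + (assignCost batchInitWrites + assignCost fetchWrites +
      assignCost countWrites + 2 * batchCond.cost + 4)) := by
  rw [batchStepTime]
  generalize insertEdgeTime n = t
  generalize assignCost batchInitWrites = a₁
  generalize assignCost fetchWrites = a₂
  generalize assignCost countWrites = a₃
  generalize batchCond.cost = a₄
  nlinarith [Nat.mul_le_mul_right (a₁ + a₄ + 1) hK]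

end EdgeColoringUpdate

theorem mainTheorem5 :
    ∃ (insertion deletion batch : Program) (C : ℕ),
      -- inserting an edge: `O(log n)` time, `O(n)` processors
      (∀ (n D : ℕ) (G : SimpleGraph (Fin n)) (φ : ProperEdgeColoring G (D + 1)) (u v : Fin n)
          (m : ℕ → ℕ),
        MaxDegreeLE G D → u ≠ v → ¬ G.Adj u v → MaxDegreeLE (G ⊔ SimpleGraph.edge u v) D →
        Represents m G φ → m 2 = u → m 3 = v →
        Computes insertion (C * n) (C * Real.log n) m
          (StoresColoring D (G ⊔ SimpleGraph.edge u v))) ∧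
      -- deleting an edge: `O(1)` time, `O(1)` processors
      (∀ (n D : ℕ) (G : SimpleGraph (Fin n)) (φ : ProperEdgeColoring G (D + 1)) (u v : Fin n)
          (m : ℕ → ℕ),
        MaxDegreeLE G D → G.Adj u v →
        Represents m G φ → m 2 = u → m 3 = v →
        Computes deletion C C m (StoresColoring D (G.deleteEdges {s(u, v)}))) ∧
      -- inserting `K` edges, listed in the workspace: `O(K log n)` time, `O(n)` processors
      (∀ (n D K : ℕ) (G : SimpleGraph (Fin n)) (φ : ProperEdgeColoring G (D + 1))
          (e : Fin K → Fin n × Fin n) (m : ℕ → ℕ),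
        1 ≤ K → MaxDegreeLE G D →
        (∀ i, (e i).1 ≠ (e i).2 ∧ ¬ G.Adj (e i).1 (e i).2) →
        Function.Injective (fun i => s((e i).1, (e i).2)) →
        MaxDegreeLE (G ⊔ SimpleGraph.fromEdgeSet (Set.range fun i => s((e i).1, (e i).2))) D →
        Represents m G φ → m 2 = K →
        (∀ i : Fin K, m (workspace n D + 2 * i) = (e i).1 ∧
          m (workspace n D + 2 * i + 1) = (e i).2) →
        Computes batch (C * n) (C * (K * Real.log n)) m
          (StoresColoring D
            (G ⊔ SimpleGraph.fromEdgeSet (Set.range fun i => s((e i).1, (e i).2))))) := by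
  obtain ⟨A, hA⟩ := insertEdgeTime_le
  -- two distinct vertices exist wherever an edge is inserted
  have two_le : ∀ {n : ℕ} {u v : Fin n}, u ≠ v → 2 ≤ n := fun {n u v} huv => by
    by_contra hn
    exact huv (Fin.ext (by omega))
  obtain ⟨B₁, hB₁⟩ : ∃ B, B = assignCost insertionInitWrites :=
    ⟨_, rfl⟩
  obtain ⟨B₂, hB₂⟩ : ∃ B, B = assignCost deletionWrites :=
    ⟨_, rfl⟩
  obtain ⟨B₃, hB₃⟩ : ∃ B, B = assignCost batchInitWrites + assignCost fetchWrites +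
      assignCost countWrites + 2 * batchCond.cost + 4 :=
    ⟨_, rfl⟩
  refine ⟨EdgeColoringUpdate.insertion.code 0, (Stmt.assign deletionWrites).code 0,
    EdgeColoringUpdate.batch.code 0, A + 2 * (B₁ + B₂ + B₃) + 2, ?_, ?_, ?_⟩
  · intro n D G φ u v m hG huv hadj hdeg h hu hv
    obtain ⟨X, T, M, hm⟩ := h.holds hG
    refine (runs_insertion (by gcongr; omega) hm hu hv huv hadj hdeg).computes ?_
    have hn := two_le huv
    have h1 := hA n hn
    have h2 := half_le_log hn
    have h3 : (0 : ℝ) ≤ B₁ := Nat.cast_nonneg _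
    have h4 : (0 : ℝ) ≤ B₂ := Nat.cast_nonneg _
    have h5 : (0 : ℝ) ≤ B₃ := Nat.cast_nonneg _
    rw [← hB₁]
    generalize insertEdgeTime n = t at h1 ⊢
    clear hB₁ hB₂ hB₃
    push_cast
    nlinarith
  · intro n D G φ u v m hG hadj h hu hv
    obtain ⟨X, T, M, hm⟩ := h.holds hG
    refine (Runs.assign fun m' hw => storesColoring_delete (by omega) hm hu hv hadj hw).computes ?_
    rw [← hB₂]
    exact_mod_cast (by omega : B₂ ≤ A + 2 * (B₁ + B₂ + B₃) + 2)
  · intro n D K G φ e m hK hG he hinj hdeg h hm2 hlist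
    obtain ⟨X, T, M, hm⟩ := h.holds hG
    have hn := two_le (he ⟨0, hK⟩).1
    refine (runs_batch (by gcongr; omega) (by omega) hm he hinj hdeg hm2 hlist).computes ?_
    have h1 := hA n hn
    have h2 := half_le_log hn
    have h3 : (0 : ℝ) ≤ B₁ := Nat.cast_nonneg _
    have h4 : (0 : ℝ) ≤ B₂ := Nat.cast_nonneg _
    have hK' : (1 : ℝ) ≤ K := by exact_mod_cast hK
    have h6 : assignCost batchInitWrites +
        (K * (batchStepTime n + batchCond.cost + 3) + (batchCond.cost + 1)) ≤
        K * (insertEdgeTime n + B₃) := by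
      rw [hB₃]
      exact batchTime_le hK n
    have h7 := (Nat.cast_le (α := ℝ)).2 h6
    generalize insertEdgeTime n = t at h1 h7
    rw [Nat.cast_mul, Nat.cast_add t] at h7
    refine h7.trans ?_
    clear hB₁ hB₂ hB₃ h6 h7
    have h5 : (0 : ℝ) ≤ B₃ := Nat.cast_nonneg _
    have h8 : (t + B₃ : ℝ) ≤
        (A + 2 * (B₁ + B₂ + B₃) + 2 : ℝ) * Real.log n := by nlinarith
    calc (K : ℝ) * (t + B₃)
        ≤ K * ((A + 2 * (B₁ + B₂ + B₃) + 2 : ℝ) * Real.log n) := by gcongr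
      _ = _ := by push_cast; ring
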